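/- **Theorem (online natural gradient update).** Let $A\in\mathbb R^{d_x\times d_x}$, $B\in\mathbb R^{d_x\times d_u}$, $d=\max(d_x,d_u)$, and consider $x_{t+1}=Ax_t+Bu_t+w_t$ for rounds $t=0,\dots,T-1$, with $x_0=0$ and $T\ge 2$. Matrix norms are spectral norms. Let $\kappa\ge 1$, $0<\gamma<1$, $\sigma>0$, $\alpha>0$, $\|B\|\le\kappa_B$, and $\kappa_B(1-\gamma)\ge 2$. A matrix $K$ is *$(\kappa,\gamma)$-diagonal strongly stable* if $A-BK=QLQ^{-1}$ with a complex diagonal $L$ and a non-singular complex $Q$, where $\|L\|\le 1-\gamma$ and $\|K\|,\|Q\|,\|Q^{-1}\|\le\kappa$; let $\mathcal K$ be the set of these matrices, and fix $\mathbb K\in\mathcal K$. Assume that * the $w_t$ are i.i.d. with a law $\mathcal D$ such that $\mathbb E[w_t]=0$, $\mathbb E[w_tw_t^\top]\succeq\sigma^2I$, and $\|w_t\|\le W$ almost surely; * the costs $c_t(x,u)$ are a fixed (deterministic) sequence of differentiable, jointly $\alpha$-strongly convex functions such that, for every $D$, $\|x\|,\|u\|\le D$ implies $\|\nabla_xc_t(x,u)\|,\|\nabla_uc_t(x,u)\|\le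 GD$. Let $H=\lceil\gamma^{-1}\log(T\kappa^2)\rceil$ and $\mathcal M=\{M=(M^{[0]},\dots,M^{[H-1]}),\ M^{[i]}\in\mathbb R^{d_u\times d_x}:\ \|M^{[i-1]}\|\le\kappa^3\kappa_B(1-\gamma)^i,\ 1\le i\le H\}$, and write $M_{\rm vec}$ for the vector of all entries of $M$, with the Euclidean norm. For independent $\xi_0,\dots,\xi_{2H}\sim\mathcal D$ and $\tilde A=A-B\mathbb K$ define the surrogate state, action and cost $$y(M)=\sum_{i=0}^{2H}\Psi_i(M)\,\xi_i,\quad \Psi_i(M)=\tilde A^i\mathbf 1_{i\le H}+\sum_{j=0}^{H}\tilde A^jBM^{[i-j-1]}\mathbf 1_{1\le i-j\le H},\quad v(M)=-\mathbb Ky(M)+\sum_{i=1}^HM^{[i-1]}\xi_{i-1},$$ and $f_t(M)=\mathbb E[c_t(y(M),v(M))]$. Let $J$ be the (random) Jacobian of the affine map $M_{\rm vec}\mapsto(y(M),v(M))$ and $P=\mathbb E[J^\top J]$. Starting from an arbitrary $M_0\in\mathcal M$, the algorithm $\mathcal A$ plays, in round $t$, $$u_t=-\mathbb Kx_t+\sum_{i=1}^HM_t^{[i-1]}w_{t-i}\qquad(w_s=0\text{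 for }s<0)$$ and updates $$M_{t+1}=\Pi_{\mathcal M}\bigl(M_t-\eta_tP^{-1}\nabla f_t(M_t)\bigr),\qquad \eta_t=\frac{a}{\alpha(t+1)},$$ where $a\ge1$ and $\Pi_{\mathcal M}$ is the projection onto $\mathcal M$ in the norm $\|v\|_P=\sqrt{v^\top Pv}$. For a controller $\pi$ let $J_T(\pi)=\mathbb E\bigl[\sum_{t=0}^{T-1}c_t(x_t,u_t)\bigr]$ be the expected cost of its trajectory, and let $J_T(K)$ be the cost of $u_t=-Kx_t$. Then $$J_T(\mathcal A)-\min_{K\in\mathcal K}J_T(K)\ \le\ a\,p(\gamma^{-1},\kappa_B,\kappa,d)\ \frac{GW^2}{\alpha\mu}\,\log^7T,\qquad \mu^{-1}:=\max_{0\le t<T}\ \max_{M\in\mathcal M}\bigl\|P^{-1}\nabla f_t(M)\bigr\|,$$ where $p$ is a universal polynomial (independent of the system, the costs, the noise, $T$ and $a$). -/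

import Mathlib

open MeasureTheory ProbabilityTheory
open scoped Matrix.Norms.L2Operator

namespace OnlineControl

noncomputable section

/-- States and disturbances, `ℝ^dx` with the Euclidean norm; also used for controls, `ℝ^du`. -/
abbrev Vec (n : ℕ) := EuclideanSpace ℝ (Fin n)

/-- Real matrices; `‖·‖` on matrices is the spectral norm throughout. -/
abbrev Mat (m n : ℕ) := Matrix (Fin m) (Fin n) ℝ

/-- Matrix-vector product. -/
def app {m n : ℕ} (S : Mat m n) (x : Vec n) : Vec m := Matrix.toEuclideanLin S x

/-! ### Assumptions on the system -/

/-- `K` is `(κ, γ)`-diagonal strongly stable for the dynamics `(A, B)`. -/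
def DiagStronglyStable {dx du : ℕ} (A : Mat dx dx) (B : Mat dx du) (κ γ : ℝ)
    (K : Mat du dx) : Prop :=
  ∃ (l : Fin dx → ℂ) (Q : Matrix (Fin dx) (Fin dx) ℂ),
    IsUnit Q ∧
    (A - B * K).map (algebraMap ℝ ℂ) = Q * Matrix.diagonal l * Q⁻¹ ∧
    ‖(Matrix.diagonal l : Matrix (Fin dx) (Fin dx) ℂ)‖ ≤ 1 - γ ∧
    ‖K‖ ≤ κ ∧ ‖Q‖ ≤ κ ∧ ‖Q⁻¹‖ ≤ κ

/-- The disturbance law `ν` is bounded by `W`, centred, and has covariance `⪰ σ² I`. -/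
structure NoiseLaw {dx : ℕ} (ν : Measure (Vec dx)) (σ W : ℝ) : Prop where
  isProb : IsProbabilityMeasure ν
  bounded : ∀ᵐ w ∂ν, ‖w‖ ≤ W
  centred : ∫ w, w ∂ν = 0
  covariance : (Matrix.of (fun a b : Fin dx => ∫ w, w a * w b ∂ν)
    - σ ^ 2 • (1 : Mat dx dx)).PosSemidef

/-- The cost `c(x, u)` is differentiable and jointly `α`-strongly convex (Euclidean norm on
state-control pairs), and its partial gradients are bounded by `G D` on `‖x‖, ‖u‖ ≤ D`. -/
structure CostClass {dx du : ℕ} (c : Vec dx → Vec du → ℝ) (α G : ℝ) : Prop where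
  differentiable : Differentiable ℝ (fun z : WithLp 2 (Vec dx × Vec du) => c z.fst z.snd)
  strongConvex : StrongConvexOn Set.univ α
    (fun z : WithLp 2 (Vec dx × Vec du) => c z.fst z.snd)
  grad_bound : ∀ (D : ℝ) (x : Vec dx) (u : Vec du), ‖x‖ ≤ D → ‖u‖ ≤ D →
    ‖gradient (fun x' => c x' u) x‖ ≤ G * D ∧ ‖gradient (fun u' => c x u') u‖ ≤ G * D

/-! ### Trajectories and costs

Rounds are numbered `0, 1, …, T - 1` and the initial state is `x 0 = 0`. -/

/-- A controller: the control as a function of the round `t`, the current state and the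
disturbance sequence. The controllers below only read disturbances of earlier rounds. -/
abbrev Controller (dx du : ℕ) := ℕ → Vec dx → (ℕ → Vec dx) → Vec du

/-- `x (t+1) = A x t + B u t + w t`, started at `0`. -/
def state {dx du : ℕ} (A : Mat dx dx) (B : Mat dx du) (π : Controller dx du)
    (w : ℕ → Vec dx) : ℕ → Vec dx
  | 0 => 0
  | t + 1 => app A (state A B π w t) + app B (π t (state A B π w t) w) + w t

/-- The expected total cost `J_T(π)` under the disturbance process `w`. -/
def totalCost {dx du : ℕ} {Ω : Type*} [MeasurableSpace Ω] (P : Measure Ω)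
    (w : ℕ → Ω → Vec dx) (A : Mat dx dx) (B : Mat dx du) (c : ℕ → Vec dx → Vec du → ℝ)
    (T : ℕ) (π : Controller dx du) : ℝ :=
  ∫ ω, ∑ t ∈ Finset.range T,
    c t (state A B π (fun s => w s ω) t)
      (π t (state A B π (fun s => w s ω) t) (fun s => w s ω)) ∂P

/-- The linear controller `u = -K x`. -/
def linearController {dx du : ℕ} (K : Mat du dx) : Controller dx du :=
  fun _ x _ => - app K x

/-! ### Disturbance-action policies -/

/-- The flattened policy parameter `M_vec` of `M = (M^[0], …, M^[H-1])`, with the Euclidean norm: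
the coordinate `(i, a, b)` is the entry `(a, b)` of `M^[i]`. -/
abbrev Policy (H dx du : ℕ) := EuclideanSpace ℝ (Fin H × Fin du × Fin dx)

/-- The matrix `M^[i]`. -/
def Policy.block {H dx du : ℕ} (M : Policy H dx du) (i : Fin H) : Mat du dx :=
  Matrix.of fun a b => M (i, a, b)

/-- The controller playing, in round `t`,
`u t = -𝕂 x t + ∑_{i=1}^H (M t)^[i-1] w (t-i)`, where disturbances before round `0` are zero. -/
def policyController {H dx du : ℕ} (Kst : Mat du dx) (M : ℕ → Policy H dx du) :
    Controller dx du :=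
  fun t x w => - app Kst x
    + ∑ i : Fin H, if (i : ℕ) + 1 ≤ t then app ((M t).block i) (w (t - (i + 1))) else 0

/-- The set `𝓜`: `‖M^[i-1]‖ ≤ κ³ κ_B (1-γ)^i` for `i = 1, …, H`. -/
def policySet (H dx du : ℕ) (κ κB γ : ℝ) : Set (Policy H dx du) :=
  {M | ∀ i : Fin H, ‖M.block i‖ ≤ κ ^ 3 * κB * (1 - γ) ^ ((i : ℕ) + 1)}

/-! ### Surrogate state, action and cost -/

/-- The disturbance-state transfer matrix at a constant policy `M`, with `Ã = A - B 𝕂`: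
`Ψ_i(M) = Ã^i 1_{i ≤ H} + ∑_{j=0}^H Ã^j B M^[i-j-1] 1_{i-j ∈ [1,H]}`. -/
def transfer {H dx du : ℕ} (A : Mat dx dx) (B : Mat dx du) (Kst : Mat du dx)
    (M : Policy H dx du) (i : ℕ) : Mat dx dx :=
  (if i ≤ H then (A - B * Kst) ^ i else 0)
    + ∑ j ∈ Finset.range (H + 1),
        if h : j + 1 ≤ i ∧ i ≤ j + H then
          (A - B * Kst) ^ j * B * M.block ⟨i - j - 1, by omega⟩
        else 0

/-- The surrogate state. The disturbances are listed backwards in time: `ξ i` is the one that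
occurred `i + 1` steps before the surrogate state. -/
def surrogateState {H dx du : ℕ} (A : Mat dx dx) (B : Mat dx du) (Kst : Mat du dx)
    (M : Policy H dx du) (ξ : Fin (2 * H + 1) → Vec dx) : Vec dx :=
  ∑ i : Fin (2 * H + 1), app (transfer A B Kst M i) (ξ i)

/-- The surrogate action. -/
def surrogateAction {H dx du : ℕ} (A : Mat dx dx) (B : Mat dx du) (Kst : Mat du dx)
    (M : Policy H dx du) (ξ : Fin (2 * H + 1) → Vec dx) : Vec du :=
  - app Kst (surrogateState A B Kst M ξ)
    + ∑ i : Fin H, app (M.block i) (ξ (Fin.castLE (by omega) i))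

/-- The stacked vector `z(M) = (y(M), v(M))`. -/
def surrogatePair {H dx du : ℕ} (A : Mat dx dx) (B : Mat dx du) (Kst : Mat du dx)
    (M : Policy H dx du) (ξ : Fin (2 * H + 1) → Vec dx) : WithLp 2 (Vec dx × Vec du) :=
  WithLp.toLp 2 (surrogateState A B Kst M ξ, surrogateAction A B Kst M ξ)

/-- The surrogate cost `f(M) = 𝔼[c(y(M), v(M))]`, over independent disturbances of law `ν`. -/
def surrogateCost {H dx du : ℕ} (ν : Measure (Vec dx)) (A : Mat dx dx) (B : Mat dx du)
    (Kst : Mat du dx) (c : Vec dx → Vec du → ℝ) (M : Policy H dx du) : ℝ :=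
  ∫ ξ, c (surrogateState A B Kst M ξ) (surrogateAction A B Kst M ξ)
    ∂(Measure.pi fun _ : Fin (2 * H + 1) => ν)

/-- The `p`-th column of the Jacobian `J` of `M_vec ↦ z(M)`; since `z` is affine in `M_vec`, it is
the increment of `z` along the `p`-th basis vector. -/
def jacobianCol {H dx du : ℕ} (A : Mat dx dx) (B : Mat dx du) (Kst : Mat du dx)
    (ξ : Fin (2 * H + 1) → Vec dx) (p : Fin H × Fin du × Fin dx) :
    WithLp 2 (Vec dx × Vec du) :=
  surrogatePair A B Kst (EuclideanSpace.single p (1 : ℝ)) ξ - surrogatePair A B Kst 0 ξ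

/-- The preconditioner `𝔼[Jᵀ J]`. -/
def gram (H : ℕ) {dx du : ℕ} (ν : Measure (Vec dx)) (A : Mat dx dx) (B : Mat dx du)
    (Kst : Mat du dx) : Matrix (Fin H × Fin du × Fin dx) (Fin H × Fin du × Fin dx) ℝ :=
  Matrix.of fun p q => ∫ ξ, inner ℝ (jacobianCol A B Kst ξ p) (jacobianCol A B Kst ξ q)
    ∂(Measure.pi fun _ : Fin (2 * H + 1) => ν)

/-- The natural gradient `(𝔼[Jᵀ J])⁻¹ ∇f(M)`. -/
def naturalGradient {H dx du : ℕ} (ν : Measure (Vec dx)) (A : Mat dx dx) (B : Mat dx du)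
    (Kst : Mat du dx) (c : Vec dx → Vec du → ℝ) (M : Policy H dx du) : Policy H dx du :=
  Matrix.toEuclideanLin (gram H ν A B Kst)⁻¹ (gradient (surrogateCost ν A B Kst c) M)

/-! ### The algorithm -/

/-- `‖v‖²_S = vᵀ S v`. -/
def weightedSq {ι : Type*} [Fintype ι] (S : Matrix ι ι ℝ) (v : EuclideanSpace ℝ ι) : ℝ :=
  dotProduct v.ofLp (S.mulVec v.ofLp)

/-- `q` is a projection of `p` onto `C` in the norm `‖·‖_S`. -/
def IsProjection {ι : Type*} [Fintype ι] (S : Matrix ι ι ℝ) (C : Set (EuclideanSpace ℝ ι))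
    (p q : EuclideanSpace ℝ ι) : Prop :=
  q ∈ C ∧ ∀ r ∈ C, weightedSq S (q - p) ≤ weightedSq S (r - p)

/-- The memory length `H = γ⁻¹ log(T κ²)`, rounded up. -/
def memory (κ γ : ℝ) (T : ℕ) : ℕ := ⌈γ⁻¹ * Real.log (T * κ ^ 2)⌉₊

/-- `M 0, M 1, …` are the policies of a run of the online natural gradient algorithm over `T`
rounds with step sizes `η`: arbitrary start in `𝓜`, then
`M (t+1) = Π_𝓜 (M t - η t (𝔼[JᵀJ])⁻¹ ∇f_t(M t))`, with the projection taken in the norm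
of the preconditioner. -/
def IsNaturalGradientRun {H dx du : ℕ} (ν : Measure (Vec dx)) (A : Mat dx dx) (B : Mat dx du)
    (Kst : Mat du dx) (c : ℕ → Vec dx → Vec du → ℝ) (κ κB γ : ℝ) (T : ℕ) (η : ℕ → ℝ)
    (M : ℕ → Policy H dx du) : Prop :=
  M 0 ∈ policySet H dx du κ κB γ ∧
  ∀ t < T, IsProjection (gram H ν A B Kst) (policySet H dx du κ κB γ)
    (M t - η t • naturalGradient ν A B Kst (c t) (M t)) (M (t + 1))

/-- `μ⁻¹`: the largest norm of the natural gradient over `𝓜` and over the `T` rounds. -/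
def muInv (H : ℕ) {dx du : ℕ} (ν : Measure (Vec dx)) (A : Mat dx dx) (B : Mat dx du)
    (Kst : Mat du dx) (c : ℕ → Vec dx → Vec du → ℝ) (κ κB γ : ℝ) (T : ℕ) : ℝ :=
  sSup {r | ∃ t < T, ∃ M ∈ policySet H dx du κ κB γ, r = ‖naturalGradient ν A B Kst (c t) M‖}

end

end OnlineControl

open OnlineControl

namespace OnlineControl

/-! Let `N` be the policy that imitates a linear controller `K` by truncating, after `H` terms, the
expansion of `(𝕂 - K) x` in past disturbances (`comparator`). In each round the excess cost of the
learner splits into its true cost minus `f_t(M_t)`, the surrogate regret `f_t(M_t) - f_t(N)`, and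
`f_t(N)` minus the true cost of `K`.

Surrogate regret. The pair `(y, v)` is affine in the policy and `‖N‖²_P = 𝔼‖J N‖²`, so `f_t`
inherits `α`-strong convexity in the norm of `P` (`NoiseLaw.add_inner_gradient_add_le`), and the
natural gradient is exactly the gradient for the inner product of `P`. Projected gradient descent
with steps `a / (α (t + 1))` then has regret at most half of `∑ η_t ‖n_t‖²_P`, a harmonic sum
(`Setting.regret_le`). One factor `‖n_t‖_P` is bounded by duality through the size of the cost
gradient, the other by `μ⁻¹`; hence the bound is linear in `μ⁻¹`.

True against surrogate cost. States and controls stay below `sizeBound`, so by convexity a cost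
difference is at most `G` times this size times a distance. The distance from a trajectory to the
surrogate of a fixed policy consists of a truncation error of order `(1 - γ)^H ≤ 1 / T` and the
deviation of the recent added controls from those of the policy (`Setting.exists_deviation_bound`).
For the learner this deviation is the drift of `M_t` over at most `H + 1` rounds. It is measured by
`Policy.energy`, the mean square of the added control, which `P` controls up to `(2 κ)²` because the
added control equals `v + 𝕂 y` (`NoiseLaw.energy_le_integral_response`). No power of `σ` enters, and
the drifts sum to order `H log T`.

The first `2 H + 1` rounds and the truncation errors contribute multiples of `G W²` without the
factor `1 / (α μ)`. They are absorbed by `Setting.le_muInv`: a strongly convex function cannot have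
a uniformly small gradient on a set as large as `𝓜`, so `α ≤ C μ⁻¹` with `C` polynomial. -/

/-! ### Matrix-vector products -/

section App

variable {l m n : ℕ}

theorem app_apply (S : Mat m n) (x : Vec n) (a : Fin m) : app S x a = ∑ b, S a b * x b := by
  simp [app, Matrix.toLpLin_apply, Matrix.mulVec, dotProduct]

@[simp] theorem app_zero (S : Mat m n) : app S 0 = 0 := map_zero _

@[simp] theorem zero_app (x : Vec n) : app (0 : Mat m n) x = 0 := by simp [app]

theorem app_add (S : Mat m n) (x y : Vec n) : app S (x + y) = app S x + app S y := map_add _ x y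

theorem app_sub (S : Mat m n) (x y : Vec n) : app S (x - y) = app S x - app S y := map_sub _ x y

theorem app_neg (S : Mat m n) (x : Vec n) : app S (-x) = - app S x := map_neg _ x

theorem app_smul (S : Mat m n) (r : ℝ) (x : Vec n) : app S (r • x) = r • app S x := map_smul _ r x

theorem app_sum {ι : Type*} (s : Finset ι) (S : Mat m n) (x : ι → Vec n) :
    app S (∑ i ∈ s, x i) = ∑ i ∈ s, app S (x i) := map_sum _ x s

theorem add_app (S R : Mat m n) (x : Vec n) : app (S + R) x = app S x + app R x := by simp [app]

theorem sub_app (S R : Mat m n) (x : Vec n) : app (S - R) x = app S x - app R x := by simp [app]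

theorem smul_app (r : ℝ) (S : Mat m n) (x : Vec n) : app (r • S) x = r • app S x := by simp [app]

theorem sum_app {ι : Type*} (s : Finset ι) (S : ι → Mat m n) (x : Vec n) :
    app (∑ i ∈ s, S i) x = ∑ i ∈ s, app (S i) x := by simp [app, map_sum]

theorem mul_app (S : Mat l m) (R : Mat m n) (x : Vec n) : app (S * R) x = app S (app R x) := by
  simp [app, Matrix.toLpLin_apply, Matrix.mulVec_mulVec]

@[simp] theorem one_app (x : Vec n) : app (1 : Mat n n) x = x := by
  simp [app]

theorem norm_app_le (S : Mat m n) (x : Vec n) : ‖app S x‖ ≤ ‖S‖ * ‖x‖ :=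
  Matrix.l2_opNorm_mulVec S x

theorem continuous_app (S : Mat m n) : Continuous (app S) :=
  LinearMap.continuous_of_finiteDimensional (Matrix.toEuclideanLin S)

@[fun_prop] theorem continuous_app_comp {X : Type*} [TopologicalSpace X] (S : Mat m n)
    {f : X → Vec n} (hf : Continuous f) : Continuous fun x => app S (f x) :=
  (continuous_app S).comp hf

@[fun_prop] theorem measurable_app_comp {X : Type*} [MeasurableSpace X] (S : Mat m n)
    {f : X → Vec n} (hf : Measurable f) : Measurable fun x => app S (f x) :=
  (continuous_app S).measurable.comp hf

theorem opNorm_le_of_app (S : Mat m n) {C : ℝ} (hC : 0 ≤ C) (h : ∀ x, ‖app S x‖ ≤ C * ‖x‖) :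
    ‖S‖ ≤ C := by
  rw [Matrix.l2_opNorm_def]
  exact ContinuousLinearMap.opNorm_le_bound _ hC h

/-- The spectral norm of a real matrix is at most that of its complexification. -/
theorem norm_le_norm_map_complex (S : Mat m n) : ‖S‖ ≤ ‖S.map (algebraMap ℝ ℂ)‖ := by
  refine opNorm_le_of_app S (norm_nonneg _) fun x => ?_
  have key := Matrix.l2_opNorm_mulVec (S.map (algebraMap ℝ ℂ))
    (WithLp.toLp 2 fun b => (x b : ℂ))
  have h1 : ‖(WithLp.toLp 2 fun b => (x b : ℂ) : EuclideanSpace ℂ (Fin n))‖ = ‖x‖ := by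
    simp [EuclideanSpace.norm_eq]
  have h2 : ‖(EuclideanSpace.equiv (Fin m) ℂ).symm ((S.map (algebraMap ℝ ℂ)).mulVec
      (WithLp.toLp 2 fun b => (x b : ℂ) : EuclideanSpace ℂ (Fin n)).ofLp)‖ = ‖app S x‖ := by
    rw [EuclideanSpace.norm_eq, EuclideanSpace.norm_eq]
    congr 1
    refine Finset.sum_congr rfl fun a _ => ?_
    have : ((EuclideanSpace.equiv (Fin m) ℂ).symm ((S.map (algebraMap ℝ ℂ)).mulVec
      (WithLp.toLp 2 fun b => (x b : ℂ) : EuclideanSpace ℂ (Fin n)).ofLp)) a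
        = ((app S x a : ℝ) : ℂ) := by
      rw [app_apply]
      simp [Matrix.mulVec, dotProduct]
    rw [this, Complex.norm_real]
  rwa [h1, h2] at key

/-- The spectral norm is at most the Frobenius norm, applied to a vector. -/
theorem norm_app_sq_le_frobenius (S : Mat m n) (x : Vec n) :
    ‖app S x‖ ^ 2 ≤ (∑ a, ∑ b, S a b ^ 2) * ‖x‖ ^ 2 := by
  rw [EuclideanSpace.real_norm_sq_eq, EuclideanSpace.real_norm_sq_eq, Finset.sum_mul]
  refine Finset.sum_le_sum fun a _ => ?_
  rw [app_apply]
  exact Finset.sum_mul_sq_le_sq_mul_sq _ _ _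

end App

/-! ### Powers of a strongly stable closed loop -/

section Stable

variable {dx du : ℕ} {A : Mat dx dx} {B : Mat dx du} {κ γ : ℝ} {K : Mat du dx}

/-- In a power of `Q L Q⁻¹` the inner factors cancel, so the price `‖Q‖ ‖Q⁻¹‖ ≤ κ²` is paid once,
whatever the exponent. -/
theorem DiagStronglyStable.norm_pow_le (h : DiagStronglyStable A B κ γ K) (hκ : 0 ≤ κ) (j : ℕ) :
    ‖(A - B * K) ^ j‖ ≤ κ ^ 2 * (1 - γ) ^ j := by
  obtain ⟨l, Q, hQ, hA, hl, -, hQn, hQi⟩ := h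
  have hγ : 0 ≤ 1 - γ := (norm_nonneg _).trans hl
  have hdet : IsUnit Q.det := (Matrix.isUnit_iff_isUnit_det Q).1 hQ
  have hpow : ((A - B * K) ^ j).map (algebraMap ℝ ℂ) = Q * Matrix.diagonal (l ^ j) * Q⁻¹ := by
    have h0 : ((A - B * K) ^ j).map (algebraMap ℝ ℂ)
        = ((A - B * K).map (algebraMap ℝ ℂ)) ^ j := by
      simpa [RingHom.mapMatrix_apply] using map_pow (algebraMap ℝ ℂ).mapMatrix (A - B * K) j
    rw [h0, hA, ← Matrix.diagonal_pow]
    induction j with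
    | zero => simp [Matrix.mul_nonsing_inv Q hdet]
    | succ j ih =>
      have h0' : ((A - B * K) ^ j).map (algebraMap ℝ ℂ)
          = ((A - B * K).map (algebraMap ℝ ℂ)) ^ j := by
        simpa [RingHom.mapMatrix_apply] using map_pow (algebraMap ℝ ℂ).mapMatrix (A - B * K) j
      rw [pow_succ, ih h0', pow_succ]
      calc _ = Q * Matrix.diagonal l ^ j * (Q⁻¹ * Q) * Matrix.diagonal l * Q⁻¹ := by
            simp only [Matrix.mul_assoc]
        _ = _ := by rw [Matrix.nonsing_inv_mul Q hdet]; simp only [Matrix.mul_assoc, Matrix.one_mul]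
  have hd : ‖(Matrix.diagonal (l ^ j) : Matrix (Fin dx) (Fin dx) ℂ)‖ ≤ (1 - γ) ^ j := by
    rw [Matrix.l2_opNorm_diagonal] at hl ⊢
    refine (pi_norm_le_iff_of_nonneg (pow_nonneg hγ j)).2 fun i => ?_
    rw [Pi.pow_apply, norm_pow]
    exact pow_le_pow_left₀ (norm_nonneg _) ((norm_le_pi_norm l i).trans hl) j
  calc ‖(A - B * K) ^ j‖ ≤ ‖Q * Matrix.diagonal (l ^ j) * Q⁻¹‖ := hpow ▸ norm_le_norm_map_complex _
    _ ≤ ‖Q‖ * ‖(Matrix.diagonal (l ^ j) : Matrix (Fin dx) (Fin dx) ℂ)‖ * ‖Q⁻¹‖ :=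
        (Matrix.l2_opNorm_mul _ _).trans
          (mul_le_mul_of_nonneg_right (Matrix.l2_opNorm_mul _ _) (norm_nonneg _))
    _ ≤ κ * (1 - γ) ^ j * κ := by gcongr
    _ = κ ^ 2 * (1 - γ) ^ j := by ring

theorem DiagStronglyStable.norm_le (h : DiagStronglyStable A B κ γ K) : ‖K‖ ≤ κ := by
  obtain ⟨l, Q, -, -, -, h, -⟩ := h
  exact h

end Stable

theorem sum_range_pow_le {γ : ℝ} (hγ : 0 < γ) (hγ1 : γ < 1) (n : ℕ) :
    ∑ j ∈ Finset.range n, (1 - γ) ^ j ≤ γ⁻¹ := by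
  have h := Summable.sum_le_tsum (Finset.range n) (fun j _ => pow_nonneg (sub_pos.2 hγ1).le j)
    (summable_geometric_of_lt_one (sub_pos.2 hγ1).le (by linarith))
  rwa [tsum_geometric_of_lt_one (sub_pos.2 hγ1).le (by linarith), sub_sub_cancel] at h

/-! ### Integrability of continuous functions of bounded random variables -/

/-- A closed ball is compact here, so a continuous function is bounded on the range of the variable.
Almost all integrability in the proof comes from this; no growth condition is needed. -/
theorem integrable_comp_of_ae_bounded {Ω E F : Type*} [MeasurableSpace Ω] {P : Measure Ω}
    [IsFiniteMeasure P] [NormedAddCommGroup E] [ProperSpace E] [MeasurableSpace E] [BorelSpace E]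
    [NormedAddCommGroup F] {X : Ω → E} (hX : Measurable X) {R : ℝ}
    (hR : ∀ᵐ ω ∂P, ‖X ω‖ ≤ R) {g : E → F} (hg : Continuous g) :
    Integrable (fun ω => g (X ω)) P := by
  obtain ⟨C, hC⟩ := (isCompact_closedBall (0 : E) R).exists_bound_of_continuousOn hg.continuousOn
  refine Integrable.of_bound (hg.comp_aestronglyMeasurable hX.aestronglyMeasurable) C ?_
  filter_upwards [hR] with ω hω
  exact hC _ (by simpa using hω)

/-- Nonnegativity of the variance of `‖X‖`. -/
theorem integral_norm_le_sqrt {Ω E : Type*} [MeasurableSpace Ω] {P : Measure Ω}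
    [IsProbabilityMeasure P] [NormedAddCommGroup E] {X : Ω → E}
    (h1 : Integrable (fun ω => ‖X ω‖) P) (h2 : Integrable (fun ω => ‖X ω‖ ^ 2) P) :
    ∫ ω, ‖X ω‖ ∂P ≤ √(∫ ω, ‖X ω‖ ^ 2 ∂P) := by
  refine Real.le_sqrt_of_sq_le ?_
  set m := ∫ ω, ‖X ω‖ ∂P with hm
  have h : 0 ≤ ∫ ω, (‖X ω‖ ^ 2 - 2 * m * ‖X ω‖ + m ^ 2) ∂P :=
    integral_nonneg fun ω => by
      have := sq_nonneg (‖X ω‖ - m)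
      simp only [Pi.zero_apply]
      nlinarith
  have h3 : Integrable (fun ω => ‖X ω‖ ^ 2 - 2 * m * ‖X ω‖) P := h2.sub (h1.const_mul _)
  rw [integral_add h3 (integrable_const _), integral_sub h2 (h1.const_mul _),
    integral_const_mul, ← hm] at h
  simp only [integral_const, probReal_univ, smul_eq_mul, one_mul] at h
  nlinarith

/-! ### Second moments of linear functions of the disturbances -/

section Noise

variable {dx : ℕ} {ν : Measure (Vec dx)} {σ W : ℝ}

theorem NoiseLaw.bound_nonneg (h : NoiseLaw ν σ W) : 0 ≤ W := by
  have := h.isProb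
  obtain ⟨w, hw⟩ := h.bounded.exists
  exact (norm_nonneg w).trans hw

theorem NoiseLaw.integrable (h : NoiseLaw ν σ W) {F : Type*} [NormedAddCommGroup F]
    {g : Vec dx → F} (hg : Continuous g) : Integrable g ν := by
  have := h.isProb
  exact integrable_comp_of_ae_bounded measurable_id h.bounded hg

theorem NoiseLaw.integral_app (h : NoiseLaw ν σ W) {m : ℕ} (N : Mat m dx) :
    ∫ w, app N w ∂ν = 0 := by
  have := ((Matrix.toEuclideanLin N).toContinuousLinearMap).integral_comp_comm
    (h.integrable continuous_id)
  simp only [id, h.centred, map_zero] at this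
  exact this

theorem NoiseLaw.integral_norm_sq_le (h : NoiseLaw ν σ W) : ∫ w, ‖w‖ ^ 2 ∂ν ≤ W ^ 2 := by
  have := h.isProb
  calc ∫ w, ‖w‖ ^ 2 ∂ν ≤ ∫ _, W ^ 2 ∂ν := by
        refine integral_mono_ae (h.integrable (by fun_prop)) (integrable_const _) ?_
        filter_upwards [h.bounded] with w hw
        gcongr
    _ = W ^ 2 := by simp

/-- The right side is the quadratic form of the covariance at `v`. -/
theorem NoiseLaw.sq_mul_le_integral_sq (h : NoiseLaw ν σ W) (v : Fin dx → ℝ) :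
    σ ^ 2 * ∑ b, v b ^ 2 ≤ ∫ w, (∑ b, v b * w b) ^ 2 ∂ν := by
  have h0 := h.covariance.dotProduct_mulVec_nonneg v
  have h1 : ∫ w, (∑ b, v b * w b) ^ 2 ∂ν = ∑ a, ∑ b, v a * (∫ w, w a * w b ∂ν) * v b := by
    have : ∀ w : Vec dx, (∑ b, v b * w b) ^ 2 = ∑ a, ∑ b, v a * v b * (w a * w b) := fun w => by
      rw [sq, Finset.sum_mul_sum]
      exact Finset.sum_congr rfl fun a _ => Finset.sum_congr rfl fun b _ => by ring
    simp_rw [this]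
    rw [integral_finsetSum _ fun a _ => h.integrable (by fun_prop)]
    refine Finset.sum_congr rfl fun a _ => ?_
    rw [integral_finsetSum _ fun b _ => h.integrable (by fun_prop)]
    refine Finset.sum_congr rfl fun b _ => ?_
    rw [integral_const_mul]
    ring
  have h2 : star v ⬝ᵥ (Matrix.of (fun a b : Fin dx => ∫ w, w a * w b ∂ν)
      - σ ^ 2 • (1 : Mat dx dx)).mulVec v
      = ∑ a, ∑ b, v a * (∫ w, w a * w b ∂ν) * v b - σ ^ 2 * ∑ b, v b ^ 2 := by
    rw [Matrix.sub_mulVec, dotProduct_sub, Matrix.smul_mulVec, Matrix.one_mulVec, dotProduct_smul]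
    congr 1
    · simp only [dotProduct, Matrix.mulVec, Matrix.of_apply, star_trivial, Finset.mul_sum]
      exact Finset.sum_congr rfl fun a _ => Finset.sum_congr rfl fun b _ => by ring
    · simp only [dotProduct, star_trivial, smul_eq_mul]
      congr 1
      exact Finset.sum_congr rfl fun a _ => by ring
  rw [h2] at h0
  rw [h1]
  linarith

theorem NoiseLaw.sq_mul_frobenius_le (h : NoiseLaw ν σ W) {m : ℕ} (N : Mat m dx) :
    σ ^ 2 * ∑ a, ∑ b, N a b ^ 2 ≤ ∫ w, ‖app N w‖ ^ 2 ∂ν := by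
  simp_rw [EuclideanSpace.real_norm_sq_eq, app_apply]
  rw [integral_finsetSum _ fun a _ => h.integrable (by fun_prop), Finset.mul_sum]
  exact Finset.sum_le_sum fun a _ => h.sq_mul_le_integral_sq _

theorem NoiseLaw.integral_norm_app_sq_le (h : NoiseLaw ν σ W) {m : ℕ} (N : Mat m dx) :
    ∫ w, ‖app N w‖ ^ 2 ∂ν ≤ (∑ a, ∑ b, N a b ^ 2) * ∫ w, ‖w‖ ^ 2 ∂ν := by
  rw [← integral_const_mul]
  exact integral_mono (h.integrable ((continuous_app N).norm.pow 2)) (h.integrable (by fun_prop))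
    fun w => norm_app_sq_le_frobenius N w

/-! ### Orthogonality of independent centred disturbances. -/

section Independent

variable {Ω : Type*} [MeasurableSpace Ω] {P : Measure Ω} {ι : Type*} [Fintype ι]
  {X : ι → Ω → Vec dx}

theorem NoiseLaw.ae_bounded_of_map (h : NoiseLaw ν σ W) {Y : Ω → Vec dx} (hY : Measurable Y)
    (hlaw : P.map Y = ν) : ∀ᵐ ω ∂P, ‖Y ω‖ ≤ W := by
  have := h.bounded
  rw [← hlaw] at this
  exact ae_of_ae_map hY.aemeasurable this

/-- A sum of linear images of independent centred disturbances is a sum of orthogonal terms. -/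
theorem NoiseLaw.integral_norm_sum_app_sq [IsProbabilityMeasure P] (h : NoiseLaw ν σ W)
    (hX : ∀ i, Measurable (X i))
    (hlaw : ∀ i, P.map (X i) = ν) (hind : iIndepFun X P) {m : ℕ} (N : ι → Mat m dx) :
    ∫ ω, ‖∑ i, app (N i) (X i ω)‖ ^ 2 ∂P = ∑ i, ∫ w, ‖app (N i) w‖ ^ 2 ∂ν := by
  classical
  have hb : ∀ᵐ ω ∂P, ‖fun i => X i ω‖ ≤ W := by
    have : ∀ i, ∀ᵐ ω ∂P, ‖X i ω‖ ≤ W := fun i => h.ae_bounded_of_map (hX i) (hlaw i)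
    filter_upwards [ae_all_iff.2 this] with ω hω
    exact (pi_norm_le_iff_of_nonneg h.bound_nonneg).2 hω
  have hint : ∀ i j, Integrable (fun ω => inner ℝ (app (N i) (X i ω)) (app (N j) (X j ω))) P :=
    fun i j => integrable_comp_of_ae_bounded (X := fun ω i => X i ω) (measurable_pi_iff.2 hX) hb
      (g := fun ξ : ι → Vec dx => inner ℝ (app (N i) (ξ i)) (app (N j) (ξ j))) (by fun_prop)
  have hsq : ∀ ω, ‖∑ i, app (N i) (X i ω)‖ ^ 2
      = ∑ i, ∑ j, inner ℝ (app (N i) (X i ω)) (app (N j) (X j ω)) := fun ω => by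
    rw [← real_inner_self_eq_norm_sq, sum_inner]
    simp_rw [inner_sum]
  simp_rw [hsq]
  rw [integral_finsetSum _ fun i _ => integrable_finsetSum _ fun j _ => hint i j]
  refine Finset.sum_congr rfl fun i _ => ?_
  rw [integral_finsetSum _ fun j _ => hint i j, Finset.sum_eq_single i]
  · simp_rw [real_inner_self_eq_norm_sq]
    conv_rhs => rw [← hlaw i]
    rw [integral_map (hX i).aemeasurable (f := fun w => ‖app (N i) w‖ ^ 2)
      ((continuous_app (N i)).norm.pow 2).aestronglyMeasurable]
  · intro j _ hji
    have hij := hind.indepFun hji.symm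
    have : ∫ ω, inner ℝ (app (N i) (X i ω)) (app (N j) (X j ω)) ∂P
        = inner ℝ (∫ ω, app (N i) (X i ω) ∂P) (∫ ω, app (N j) (X j ω) ∂P) :=
      hij.integral_bilin_comp_comp (f := app (N i)) (g := app (N j)) (hX i).aemeasurable
      (hX j).aemeasurable (by rw [hlaw]; exact h.integrable (continuous_app _))
      (by rw [hlaw]; exact h.integrable (continuous_app _)) (innerSL ℝ)
    rw [this]
    have h0 : ∫ ω, app (N i) (X i ω) ∂P = 0 := by
      rw [← integral_map (hX i).aemeasurable (f := app (N i))
        (continuous_app (N i)).aestronglyMeasurable, hlaw, h.integral_app]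
    rw [h0, inner_zero_left]
  · simp

end Independent

/-! ### The product law of the surrogate disturbances -/

variable {n : ℕ}

theorem NoiseLaw.ae_pi_bounded (h : NoiseLaw ν σ W) :
    ∀ᵐ ξ ∂(Measure.pi fun _ : Fin n => ν), ‖ξ‖ ≤ W := by
  have := h.isProb
  have h1 : ∀ i : Fin n, ∀ᵐ ξ ∂(Measure.pi fun _ : Fin n => ν), ‖ξ i‖ ≤ W := fun i =>
    h.ae_bounded_of_map (measurable_pi_apply i) (measurePreserving_eval (fun _ => ν) i).map_eq
  filter_upwards [ae_all_iff.2 h1] with ξ hξ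
  exact (pi_norm_le_iff_of_nonneg h.bound_nonneg).2 hξ

theorem NoiseLaw.integrable_pi (h : NoiseLaw ν σ W) {F : Type*} [NormedAddCommGroup F]
    {g : (Fin n → Vec dx) → F} (hg : Continuous g) :
    Integrable g (Measure.pi fun _ : Fin n => ν) := by
  have := h.isProb
  exact integrable_comp_of_ae_bounded measurable_id h.ae_pi_bounded hg

theorem iIndepFun_eval_pi {E : Type*} [MeasurableSpace E] (ρ : Measure E) [IsProbabilityMeasure ρ]
    (n : ℕ) : iIndepFun (fun (i : Fin n) (ξ : Fin n → E) => ξ i) (Measure.pi fun _ : Fin n => ρ) :=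
  iIndepFun_pi (X := fun (_ : Fin n) (x : E) => x) fun _ => aemeasurable_id

/-- The injection `r` selects distinct coordinates, which remain independent; windows of the
disturbance list are of this form. -/
theorem NoiseLaw.integral_pi_norm_sum_app_sq (h : NoiseLaw ν σ W) {ι : Type*} [Fintype ι]
    {r : ι → Fin n} (hr : r.Injective) {m : ℕ} (N : ι → Mat m dx) :
    ∫ ξ, ‖∑ i, app (N i) (ξ (r i))‖ ^ 2 ∂(Measure.pi fun _ : Fin n => ν)
      = ∑ i, ∫ w, ‖app (N i) w‖ ^ 2 ∂ν := by
  have hp := h.isProb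
  have hI := (iIndepFun_eval_pi ν n).precomp hr
  have hm : ∀ i, (Measure.pi fun _ : Fin n => ν).map (fun ξ : Fin n → Vec dx => ξ (r i)) = ν :=
    fun i => (measurePreserving_eval (fun _ => ν) (r i)).map_eq
  exact h.integral_norm_sum_app_sq (X := fun i (ξ : Fin n → Vec dx) => ξ (r i))
    (fun i => measurable_pi_apply _) hm hI N

end Noise

variable {H dx du : ℕ}

/-! ### The surrogate as an affine function of the policy -/

theorem Policy.block_apply (M : Policy H dx du) (i : Fin H) (a : Fin du) (b : Fin dx) :
    M.block i a b = M (i, a, b) := rfl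

@[simp] theorem Policy.block_zero (i : Fin H) : (0 : Policy H dx du).block i = 0 := by
  ext a b; simp [Policy.block_apply]

theorem Policy.block_add (M N : Policy H dx du) (i : Fin H) :
    (M + N).block i = M.block i + N.block i := by
  ext a b; simp [Policy.block_apply]

theorem Policy.block_sub (M N : Policy H dx du) (i : Fin H) :
    (M - N).block i = M.block i - N.block i := by
  ext a b; simp [Policy.block_apply]

theorem Policy.block_smul (r : ℝ) (M : Policy H dx du) (i : Fin H) :
    (r • M).block i = r • M.block i := by
  ext a b; simp [Policy.block_apply]

theorem Policy.norm_sq_eq (M : Policy H dx du) :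
    ‖M‖ ^ 2 = ∑ i, ∑ a, ∑ b, M.block i a b ^ 2 := by
  rw [EuclideanSpace.real_norm_sq_eq, Fintype.sum_prod_type]
  refine Finset.sum_congr rfl fun i _ => ?_
  rw [Fintype.sum_prod_type]
  rfl

/-- The control `∑_k M^[k] ζ_k` that the policy `M` adds to the stabilizing feedback. -/
noncomputable def Policy.act (M : Policy H dx du) (ζ : Fin H → Vec dx) : Vec du :=
  ∑ k, app (M.block k) (ζ k)

@[simp] theorem Policy.zero_act (ζ : Fin H → Vec dx) : (0 : Policy H dx du).act ζ = 0 := by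
  simp [Policy.act]

theorem Policy.add_act (M N : Policy H dx du) (ζ : Fin H → Vec dx) :
    (M + N).act ζ = M.act ζ + N.act ζ := by
  simp [Policy.act, Policy.block_add, add_app, Finset.sum_add_distrib]

theorem Policy.sub_act (M N : Policy H dx du) (ζ : Fin H → Vec dx) :
    (M - N).act ζ = M.act ζ - N.act ζ := by
  simp [Policy.act, Policy.block_sub, sub_app, Finset.sum_sub_distrib]

theorem Policy.smul_act (r : ℝ) (M : Policy H dx du) (ζ : Fin H → Vec dx) :
    (r • M).act ζ = r • M.act ζ := by
  simp [Policy.act, Policy.block_smul, smul_app, Finset.smul_sum]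

@[fun_prop] theorem Policy.continuous_act {X : Type*} [TopologicalSpace X] (M : Policy H dx du)
    {ζ : X → Fin H → Vec dx} (hζ : Continuous ζ) : Continuous fun x => M.act (ζ x) := by
  unfold Policy.act
  fun_prop

/-- The `H` surrogate disturbances preceding `ξ j`. -/
def window (ξ : Fin (2 * H + 1) → Vec dx) (j : Fin (H + 1)) : Fin H → Vec dx :=
  fun k => ξ ⟨k + j + 1, by omega⟩

/-- The `H` most recent surrogate disturbances. -/
def recent (ξ : Fin (2 * H + 1) → Vec dx) : Fin H → Vec dx :=
  fun k => ξ (Fin.castLE (by omega) k)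

@[fun_prop] theorem continuous_window (j : Fin (H + 1)) :
    Continuous fun ξ : Fin (2 * H + 1) → Vec dx => window ξ j := by
  unfold window
  fun_prop

@[fun_prop] theorem continuous_recent :
    Continuous fun ξ : Fin (2 * H + 1) → Vec dx => recent ξ := by
  unfold recent
  fun_prop

/-- Sorting the double sum by the delay `j` shows the surrogate as the closed loop run for `H + 1`
steps from the zero state, with the same policy acting throughout. This is the form compared with
real trajectories. -/
theorem surrogateState_eq (A : Mat dx dx) (B : Mat dx du) (Kst : Mat du dx) (M : Policy H dx du)
    (ξ : Fin (2 * H + 1) → Vec dx) :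
    surrogateState A B Kst M ξ = ∑ j : Fin (H + 1),
      app ((A - B * Kst) ^ (j : ℕ)) (app B (M.act (window ξ j)) + ξ ⟨j, by omega⟩) := by
  simp only [surrogateState, transfer, add_app, sum_app, Finset.sum_add_distrib, app_add]
  rw [add_comm]
  congr 1
  · rw [Finset.sum_comm, Finset.sum_range]
    refine Finset.sum_congr rfl fun j _ => ?_
    rw [Policy.act, app_sum, app_sum]
    -- For fixed `j`, the indices `i` with a nonzero block are exactly `k + j + 1` with `k < H`.
    refine (Fintype.sum_of_injective (fun k : Fin H => (⟨k + j + 1, by omega⟩ : Fin (2 * H + 1)))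
      (fun k k' h => ?_) _ _ (fun i hi => ?_) fun k => ?_).symm
    · simpa [Fin.ext_iff] using h
    · rw [dif_neg, zero_app]
      rintro ⟨h1, h2⟩
      exact hi ⟨⟨i - j - 1, by omega⟩, Fin.ext (by simp; omega)⟩
    · rw [dif_pos ⟨by simp, by simp; omega⟩, mul_app, mul_app]
      have : (⟨(k : ℕ) + j + 1 - j - 1, by omega⟩ : Fin H) = k := Fin.ext (by simp; omega)
      simp only [this]
      rfl
  · refine (Fintype.sum_of_injective (fun j : Fin (H + 1) => (⟨j, by omega⟩ : Fin (2 * H + 1)))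
      (fun k k' h => ?_) _ _ (fun i hi => ?_) fun k => ?_).symm
    · simpa [Fin.ext_iff] using h
    · rw [if_neg, zero_app]
      intro h
      exact hi ⟨⟨i, by omega⟩, rfl⟩
    · rw [if_pos (by simp; omega)]

theorem surrogateAction_eq (A : Mat dx dx) (B : Mat dx du) (Kst : Mat du dx) (M : Policy H dx du)
    (ξ : Fin (2 * H + 1) → Vec dx) :
    surrogateAction A B Kst M ξ = - app Kst (surrogateState A B Kst M ξ) + M.act (recent ξ) := rfl

/-- The state part of the derivative of the surrogate in the direction `N`. -/
noncomputable def responseState (A : Mat dx dx) (B : Mat dx du) (Kst : Mat du dx)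
    (N : Policy H dx du) (ξ : Fin (2 * H + 1) → Vec dx) : Vec dx :=
  ∑ j : Fin (H + 1), app ((A - B * Kst) ^ (j : ℕ)) (app B (N.act (window ξ j)))

/-- The control part of the derivative of the surrogate in the direction `N`. -/
noncomputable def responseAction (A : Mat dx dx) (B : Mat dx du) (Kst : Mat du dx)
    (N : Policy H dx du) (ξ : Fin (2 * H + 1) → Vec dx) : Vec du :=
  - app Kst (responseState A B Kst N ξ) + N.act (recent ξ)

/-- The Jacobian of the surrogate pair, as a linear map. -/
noncomputable def response (A : Mat dx dx) (B : Mat dx du) (Kst : Mat du dx)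
    (ξ : Fin (2 * H + 1) → Vec dx) : Policy H dx du →ₗ[ℝ] WithLp 2 (Vec dx × Vec du) where
  toFun N := WithLp.toLp 2 (responseState A B Kst N ξ, responseAction A B Kst N ξ)
  map_add' M N := by
    have h : responseState A B Kst (M + N) ξ
        = responseState A B Kst M ξ + responseState A B Kst N ξ := by
      simp [responseState, Policy.add_act, app_add, Finset.sum_add_distrib]
    have h' : responseAction A B Kst (M + N) ξ
        = responseAction A B Kst M ξ + responseAction A B Kst N ξ := by
      simp only [responseAction, h, Policy.add_act, app_add]
      abel
    rw [h, h']
    rfl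
  map_smul' r M := by
    have h : responseState A B Kst (r • M) ξ = r • responseState A B Kst M ξ := by
      simp [responseState, Policy.smul_act, app_smul, Finset.smul_sum]
    have h' : responseAction A B Kst (r • M) ξ = r • responseAction A B Kst M ξ := by
      simp only [responseAction, h, Policy.smul_act, app_smul, smul_add, smul_neg]
    rw [h, h']
    rfl

section

variable (A : Mat dx dx) (B : Mat dx du) (Kst : Mat du dx)

theorem response_apply (N : Policy H dx du) (ξ : Fin (2 * H + 1) → Vec dx) :
    response A B Kst ξ N
      = WithLp.toLp 2 (responseState A B Kst N ξ, responseAction A B Kst N ξ) := rfl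

theorem surrogatePair_eq (M : Policy H dx du) (ξ : Fin (2 * H + 1) → Vec dx) :
    surrogatePair A B Kst M ξ = surrogatePair A B Kst 0 ξ + response A B Kst ξ M := by
  have h : surrogateState A B Kst M ξ
      = surrogateState A B Kst 0 ξ + responseState A B Kst M ξ := by
    simp only [surrogateState_eq, responseState, Policy.zero_act, app_zero, zero_add,
      ← Finset.sum_add_distrib, ← app_add]
    exact Finset.sum_congr rfl fun j _ => congrArg _ (add_comm _ _)
  rw [response_apply, surrogatePair, surrogatePair, ← WithLp.toLp_add, Prod.mk_add_mk, ← h,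
    surrogateAction_eq, surrogateAction_eq, h, responseAction, app_add, Policy.zero_act]
  congr 2
  abel

theorem surrogatePair_sub (M N : Policy H dx du) (ξ : Fin (2 * H + 1) → Vec dx) :
    surrogatePair A B Kst M ξ - surrogatePair A B Kst N ξ = response A B Kst ξ (M - N) := by
  rw [surrogatePair_eq, surrogatePair_eq A B Kst N, map_sub]
  abel

theorem jacobianCol_eq (ξ : Fin (2 * H + 1) → Vec dx) (p : Fin H × Fin du × Fin dx) :
    jacobianCol A B Kst ξ p = response A B Kst ξ (EuclideanSpace.single p 1) := by
  rw [jacobianCol, surrogatePair_sub, sub_zero]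

@[fun_prop] theorem continuous_responseState (N : Policy H dx du) :
    Continuous (responseState A B Kst N) := by
  unfold responseState
  fun_prop

@[fun_prop] theorem continuous_responseAction (N : Policy H dx du) :
    Continuous (responseAction A B Kst N) := by
  unfold responseAction
  fun_prop

@[fun_prop] theorem continuous_response (N : Policy H dx du) :
    Continuous fun ξ => response A B Kst ξ N := by
  simp only [response_apply]
  fun_prop

@[fun_prop] theorem continuous_surrogateState (M : Policy H dx du) :
    Continuous (surrogateState A B Kst M) := by
  unfold surrogateState
  fun_prop

@[fun_prop] theorem continuous_surrogatePair (M : Policy H dx du) :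
    Continuous (surrogatePair A B Kst M) := by
  unfold surrogatePair
  simp only [surrogateAction_eq]
  fun_prop

end

/-! ### Energy of a policy -/

/-- The mean square of the control `∑_k N^[k] ζ_k` under independent disturbances of law `ν`. -/
noncomputable def Policy.energy (ν : Measure (Vec dx)) (N : Policy H dx du) : ℝ :=
  ∑ k, ∫ w, ‖app (N.block k) w‖ ^ 2 ∂ν

section

variable {ν : Measure (Vec dx)} {σ W : ℝ}

theorem Policy.energy_nonneg (N : Policy H dx du) : 0 ≤ N.energy ν :=
  Finset.sum_nonneg fun _ _ => integral_nonneg fun _ => sq_nonneg _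

theorem NoiseLaw.energy_le (h : NoiseLaw ν σ W) (N : Policy H dx du) :
    N.energy ν ≤ ‖N‖ ^ 2 * ∫ w, ‖w‖ ^ 2 ∂ν := by
  rw [Policy.norm_sq_eq, Finset.sum_mul]
  exact Finset.sum_le_sum fun k _ => h.integral_norm_app_sq_le _

theorem NoiseLaw.le_energy (h : NoiseLaw ν σ W) (N : Policy H dx du) :
    σ ^ 2 * ‖N‖ ^ 2 ≤ N.energy ν := by
  rw [Policy.norm_sq_eq, Finset.mul_sum]
  exact Finset.sum_le_sum fun k _ => h.sq_mul_frobenius_le _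

/-- Every window consists of `H` distinct disturbances, so its position is irrelevant. -/
theorem NoiseLaw.integral_act_window (h : NoiseLaw ν σ W) (N : Policy H dx du) (j : Fin (H + 1)) :
    ∫ ξ, ‖N.act (window ξ j)‖ ^ 2 ∂(Measure.pi fun _ : Fin (2 * H + 1) => ν) = N.energy ν :=
  h.integral_pi_norm_sum_app_sq
    (r := fun k : Fin H => (⟨k + j + 1, by omega⟩ : Fin (2 * H + 1)))
    (fun k k' hk => by simpa [Fin.ext_iff] using hk) N.block

theorem NoiseLaw.integral_act_recent (h : NoiseLaw ν σ W) (N : Policy H dx du) :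
    ∫ ξ, ‖N.act (recent ξ)‖ ^ 2 ∂(Measure.pi fun _ : Fin (2 * H + 1) => ν) = N.energy ν :=
  h.integral_pi_norm_sum_app_sq
    (r := fun k : Fin H => (Fin.castLE (by omega) k : Fin (2 * H + 1)))
    (fun k k' hk => by simpa [Fin.ext_iff] using hk) N.block

/-- Cauchy–Schwarz with each term split as `√r · (√r b)`. With geometric weights the sum over delays
then costs `γ⁻¹` instead of `H`. -/
theorem norm_sum_sq_le_weighted {ι E : Type*} [NormedAddCommGroup E] (s : Finset ι)
    {v : ι → E} {r b : ι → ℝ} (hr : ∀ i ∈ s, 0 ≤ r i) (h : ∀ i ∈ s, ‖v i‖ ≤ r i * b i) :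
    ‖∑ i ∈ s, v i‖ ^ 2 ≤ (∑ i ∈ s, r i) * ∑ i ∈ s, r i * b i ^ 2 := by
  calc ‖∑ i ∈ s, v i‖ ^ 2 ≤ (∑ i ∈ s, r i * b i) ^ 2 := by
        gcongr
        exact norm_sum_le_of_le s h
    _ ≤ _ := Finset.sum_sq_le_sum_mul_sum_of_sq_le_mul s hr
        (fun i hi => mul_nonneg (hr i hi) (sq_nonneg _)) fun i _ => le_of_eq (by ring)

variable {A : Mat dx dx} {B : Mat dx du} {Kst : Mat du dx} {κ κB γ : ℝ}

theorem NoiseLaw.integral_responseState_le (h : NoiseLaw ν σ W) (hκ : 1 ≤ κ) (hγ : 0 < γ)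
    (hγ1 : γ < 1) (hB : ‖B‖ ≤ κB) (hK : DiagStronglyStable A B κ γ Kst) (N : Policy H dx du) :
    ∫ ξ, ‖responseState A B Kst N ξ‖ ^ 2 ∂(Measure.pi fun _ : Fin (2 * H + 1) => ν)
      ≤ (κ ^ 2 * κB * γ⁻¹) ^ 2 * N.energy ν := by
  have hρ : 0 ≤ 1 - γ := by linarith
  have hκB : 0 ≤ κB := (norm_nonneg _).trans hB
  set r : Fin (H + 1) → ℝ := fun j => κ ^ 2 * (1 - γ) ^ (j : ℕ) * κB with hr
  have hr0 : ∀ j, 0 ≤ r j := fun j => by positivity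
  have hsum : ∑ j, r j ≤ κ ^ 2 * κB * γ⁻¹ := by
    have := sum_range_pow_le hγ hγ1 (H + 1)
    rw [Finset.sum_range] at this
    calc ∑ j, r j = κ ^ 2 * κB * ∑ j : Fin (H + 1), (1 - γ) ^ (j : ℕ) := by
          rw [Finset.mul_sum]
          exact Finset.sum_congr rfl fun j _ => by simp only [hr]; ring
      _ ≤ _ := by gcongr
  have hpt : ∀ ξ, ‖responseState A B Kst N ξ‖ ^ 2
      ≤ (∑ j, r j) * ∑ j, r j * ‖N.act (window ξ j)‖ ^ 2 := fun ξ => by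
    refine norm_sum_sq_le_weighted _ (fun j _ => hr0 j) fun j _ => ?_
    calc _ ≤ ‖(A - B * Kst) ^ (j : ℕ)‖ * (‖B‖ * ‖N.act (window ξ j)‖) :=
          (norm_app_le _ _).trans (by gcongr; exact norm_app_le _ _)
      _ ≤ (κ ^ 2 * (1 - γ) ^ (j : ℕ)) * (κB * ‖N.act (window ξ j)‖) := by
          gcongr
          exact hK.norm_pow_le (by linarith) _
      _ = _ := by simp only [hr]; ring
  calc _ ≤ ∫ ξ, (∑ j, r j) * ∑ j, r j * ‖N.act (window ξ j)‖ ^ 2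
        ∂(Measure.pi fun _ : Fin (2 * H + 1) => ν) :=
        integral_mono (h.integrable_pi (by fun_prop)) (h.integrable_pi (by fun_prop)) hpt
    _ = (∑ j, r j) * ((∑ j, r j) * N.energy ν) := by
        rw [integral_const_mul, integral_finsetSum _ fun j _ => h.integrable_pi (by fun_prop)]
        simp_rw [integral_const_mul, h.integral_act_window, Finset.sum_mul]
    _ = (∑ j, r j) ^ 2 * N.energy ν := by ring
    _ ≤ _ := by
        have := N.energy_nonneg (ν := ν)
        have : 0 ≤ ∑ j, r j := Finset.sum_nonneg fun j _ => hr0 j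
        gcongr

theorem norm_response_sq (N : Policy H dx du) (ξ : Fin (2 * H + 1) → Vec dx) :
    ‖response A B Kst ξ N‖ ^ 2
      = ‖responseState A B Kst N ξ‖ ^ 2 + ‖responseAction A B Kst N ξ‖ ^ 2 :=
  WithLp.prod_norm_sq_eq_of_L2 _

theorem norm_add_sq_le_two_mul {E : Type*} [NormedAddCommGroup E] (x y : E) :
    ‖x + y‖ ^ 2 ≤ 2 * ‖x‖ ^ 2 + 2 * ‖y‖ ^ 2 := by
  have h1 := norm_add_le x y
  have h2 := norm_nonneg (x + y)
  nlinarith [sq_nonneg (‖x‖ - ‖y‖)]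

theorem NoiseLaw.integral_response_le (h : NoiseLaw ν σ W) (hκ : 1 ≤ κ) (hγ : 0 < γ)
    (hγ1 : γ < 1) (hB : ‖B‖ ≤ κB) (hκB : 1 ≤ κB) (hK : DiagStronglyStable A B κ γ Kst)
    (N : Policy H dx du) :
    ∫ ξ, ‖response A B Kst ξ N‖ ^ 2 ∂(Measure.pi fun _ : Fin (2 * H + 1) => ν)
      ≤ (3 * κ ^ 3 * κB * γ⁻¹) ^ 2 * N.energy ν := by
  have hS := h.integral_responseState_le hκ hγ hγ1 hB hK N
  have hE := N.energy_nonneg (ν := ν)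
  have hpt : ∀ ξ, ‖response A B Kst ξ N‖ ^ 2
      ≤ (1 + 2 * κ ^ 2) * ‖responseState A B Kst N ξ‖ ^ 2 + 2 * ‖N.act (recent ξ)‖ ^ 2 := by
    intro ξ
    rw [norm_response_sq]
    have h1 := norm_add_sq_le_two_mul (-app Kst (responseState A B Kst N ξ)) (N.act (recent ξ))
    have h2 : ‖app Kst (responseState A B Kst N ξ)‖ ^ 2
        ≤ κ ^ 2 * ‖responseState A B Kst N ξ‖ ^ 2 := by
      rw [← mul_pow]
      gcongr
      exact (norm_app_le _ _).trans (by gcongr; exact hK.norm_le)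
    rw [norm_neg] at h1
    rw [responseAction]
    linarith
  calc _ ≤ ∫ ξ, ((1 + 2 * κ ^ 2) * ‖responseState A B Kst N ξ‖ ^ 2 + 2 * ‖N.act (recent ξ)‖ ^ 2)
        ∂(Measure.pi fun _ : Fin (2 * H + 1) => ν) :=
        integral_mono (h.integrable_pi (by fun_prop)) (h.integrable_pi (by fun_prop)) hpt
    _ = (1 + 2 * κ ^ 2) * ∫ ξ, ‖responseState A B Kst N ξ‖ ^ 2
        ∂(Measure.pi fun _ : Fin (2 * H + 1) => ν) + 2 * N.energy ν := by
        rw [integral_add (h.integrable_pi (by fun_prop)) (h.integrable_pi (by fun_prop)),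
          integral_const_mul, integral_const_mul, h.integral_act_recent]
    _ ≤ (1 + 2 * κ ^ 2) * ((κ ^ 2 * κB * γ⁻¹) ^ 2 * N.energy ν) + 2 * N.energy ν := by gcongr
    _ = ((1 + 2 * κ ^ 2) * (κ ^ 2 * κB * γ⁻¹) ^ 2 + 2) * N.energy ν := by ring
    _ ≤ _ := by
        gcongr
        have hg : 1 ≤ γ⁻¹ := (one_le_inv₀ hγ).2 hγ1.le
        have h1 : 1 ≤ (κ ^ 3 * κB * γ⁻¹) ^ 2 :=
          one_le_pow₀ (one_le_mul_of_one_le_of_one_le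
            (one_le_mul_of_one_le_of_one_le (one_le_pow₀ hκ) hκB) hg)
        have h2 : (κ ^ 2 * κB * γ⁻¹) ^ 2 ≤ (κ ^ 3 * κB * γ⁻¹) ^ 2 := by
          gcongr
          norm_num
        have h3 : κ ^ 2 * (κ ^ 2 * κB * γ⁻¹) ^ 2 = (κ ^ 3 * κB * γ⁻¹) ^ 2 := by ring
        have h4 : (3 * κ ^ 3 * κB * γ⁻¹) ^ 2 = 9 * (κ ^ 3 * κB * γ⁻¹) ^ 2 := by ring
        rw [h4]
        linarith

/-- The added control is recovered from the surrogate pair as `v + 𝕂 y`, so the Jacobian cannot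
contract it by more than a factor of order `κ`. This is the nondegeneracy of the preconditioner,
free of `σ`. -/
theorem NoiseLaw.energy_le_integral_response (h : NoiseLaw ν σ W) (hκ : 1 ≤ κ)
    (hK : DiagStronglyStable A B κ γ Kst) (N : Policy H dx du) :
    N.energy ν ≤ (2 * κ) ^ 2 *
      ∫ ξ, ‖response A B Kst ξ N‖ ^ 2 ∂(Measure.pi fun _ : Fin (2 * H + 1) => ν) := by
  rw [← h.integral_act_recent, ← integral_const_mul]
  refine integral_mono (h.integrable_pi (by fun_prop)) (h.integrable_pi (by fun_prop)) fun ξ => ?_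
  have h1 := norm_add_sq_le_two_mul (app Kst (responseState A B Kst N ξ))
    (responseAction A B Kst N ξ)
  have h2 : ‖app Kst (responseState A B Kst N ξ)‖ ^ 2
      ≤ κ ^ 2 * ‖responseState A B Kst N ξ‖ ^ 2 := by
    rw [← mul_pow]
    gcongr
    exact (norm_app_le _ _).trans (by gcongr; exact hK.norm_le)
  have h3 : app Kst (responseState A B Kst N ξ) + responseAction A B Kst N ξ
      = N.act (recent ξ) := by
    rw [responseAction]; abel
  rw [h3] at h1
  simp only [norm_response_sq]
  have h4 : 1 ≤ κ ^ 2 := one_le_pow₀ hκ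
  have h5 := sq_nonneg ‖responseState A B Kst N ξ‖
  have h6 := sq_nonneg ‖responseAction A B Kst N ξ‖
  nlinarith [mul_nonneg (sub_nonneg.2 h4) h6, mul_nonneg (sq_nonneg κ) h5,
    mul_nonneg (sq_nonneg κ) h6]

end

/-! ### First-order properties of the costs -/

/-- Divide the strong convexity inequality on the segment from `x` to `y` by the parameter `s` and
let `s` decrease to `0`. -/
theorem _root_.StrongConvexOn.add_fderiv_add_le {E : Type*} [NormedAddCommGroup E]
    [NormedSpace ℝ E] {f : E → ℝ} {m : ℝ} (hf : StrongConvexOn Set.univ m f) {x : E}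
    (hd : DifferentiableAt ℝ f x) (y : E) :
    f x + fderiv ℝ f x (y - x) + m / 2 * ‖y - x‖ ^ 2 ≤ f y := by
  have hder : HasDerivAt (fun s : ℝ => f (x + s • (y - x))) (fderiv ℝ f x (y - x)) 0 := by
    have h1 : HasDerivAt (fun s : ℝ => x + s • (y - x)) (y - x) 0 := by
      simpa using ((hasDerivAt_id (0 : ℝ)).smul_const (y - x)).const_add x
    have h2 : HasFDerivAt f (fderiv ℝ f x) (x + (0 : ℝ) • (y - x)) := by
      simpa using hd.hasFDerivAt
    exact h2.comp_hasDerivAt 0 h1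
  have hlim := hder.tendsto_slope_zero_right
  have hlim2 : Filter.Tendsto (fun s : ℝ => f y - f x - (1 - s) * (m / 2 * ‖x - y‖ ^ 2))
      (nhdsWithin 0 (Set.Ioi 0)) (nhds (f y - f x - (1 - 0) * (m / 2 * ‖x - y‖ ^ 2))) := by
    refine Filter.Tendsto.mono_left ?_ nhdsWithin_le_nhds
    exact Continuous.tendsto (by fun_prop) 0
  have hle := le_of_tendsto_of_tendsto hlim hlim2 (by
    filter_upwards [Ioo_mem_nhdsGT (zero_lt_one' ℝ)] with s hs
    have h := hf.2 (Set.mem_univ x) (Set.mem_univ y) (sub_nonneg.2 hs.2.le) hs.1.le (by ring)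
    have hx : (1 - s) • x + s • y = x + s • (y - x) := by
      rw [sub_smul, one_smul, smul_sub]; abel
    rw [hx] at h
    simp only [zero_add, zero_smul, add_zero, smul_eq_mul] at h ⊢
    rw [inv_mul_le_iff₀ hs.1]
    linarith)
  rw [norm_sub_rev] at hle
  linarith

section

variable {c : Vec dx → Vec du → ℝ} {α G : ℝ}

/-- The cost as a function of the stacked state-control pair. -/
def pairCost (c : Vec dx → Vec du → ℝ) (z : WithLp 2 (Vec dx × Vec du)) : ℝ := c z.fst z.snd

theorem CostClass.gradBound_nonneg (h : CostClass c α G) : 0 ≤ G := by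
  have := (h.grad_bound 1 0 0 (by simp) (by simp)).1
  rw [mul_one] at this
  exact (norm_nonneg _).trans this

theorem CostClass.differentiable_pairCost (h : CostClass c α G) :
    Differentiable ℝ (pairCost c) := h.differentiable

theorem norm_gradient_eq {E : Type*} [NormedAddCommGroup E] [InnerProductSpace ℝ E]
    [CompleteSpace E] (f : E → ℝ) (x : E) : ‖gradient f x‖ = ‖fderiv ℝ f x‖ := by
  rw [gradient, LinearIsometryEquiv.norm_map]

theorem CostClass.abs_fderiv_le (h : CostClass c α G) {D : ℝ} {z : WithLp 2 (Vec dx × Vec du)}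
    (hx : ‖z.fst‖ ≤ D) (hu : ‖z.snd‖ ≤ D) (v : WithLp 2 (Vec dx × Vec du)) :
    |fderiv ℝ (pairCost c) z v| ≤ G * D * (‖v.fst‖ + ‖v.snd‖) := by
  set e := (WithLp.prodContinuousLinearEquiv 2 ℝ (Vec dx) (Vec du)).symm.toContinuousLinearMap
  have hz : HasFDerivAt (pairCost c) (fderiv ℝ (pairCost c) z) z :=
    (h.differentiable_pairCost z).hasFDerivAt
  have h1 : HasFDerivAt (fun x => c x z.snd)
      ((fderiv ℝ (pairCost c) z).comp (e.comp (ContinuousLinearMap.inl ℝ (Vec dx) (Vec du))))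
      z.fst := by
    have := (e.hasFDerivAt.comp z.fst (hasFDerivAt_prodMk_left (𝕜 := ℝ) z.fst z.snd))
    exact HasFDerivAt.comp (g := pairCost c) z.fst hz this
  have h2 : HasFDerivAt (fun u => c z.fst u)
      ((fderiv ℝ (pairCost c) z).comp (e.comp (ContinuousLinearMap.inr ℝ (Vec dx) (Vec du))))
      z.snd := by
    have := (e.hasFDerivAt.comp z.snd (hasFDerivAt_prodMk_right (𝕜 := ℝ) z.fst z.snd))
    exact HasFDerivAt.comp (g := pairCost c) z.snd hz this
  obtain ⟨g1, g2⟩ := h.grad_bound D z.fst z.snd hx hu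
  rw [norm_gradient_eq, h1.fderiv] at g1
  rw [norm_gradient_eq, h2.fderiv] at g2
  have hv : v = e (ContinuousLinearMap.inl ℝ (Vec dx) (Vec du) v.fst)
      + e (ContinuousLinearMap.inr ℝ (Vec dx) (Vec du) v.snd) := by
    rw [← map_add]
    simp [e]
    rfl
  rw [hv, map_add, ← hv, mul_add]
  refine (abs_add_le _ _).trans (add_le_add ?_ ?_)
  · exact (ContinuousLinearMap.le_opNorm ((fderiv ℝ (pairCost c) z).comp
      (e.comp (ContinuousLinearMap.inl ℝ (Vec dx) (Vec du)))) v.fst).trans (by gcongr)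
  · exact (ContinuousLinearMap.le_opNorm ((fderiv ℝ (pairCost c) z).comp
      (e.comp (ContinuousLinearMap.inr ℝ (Vec dx) (Vec du)))) v.snd).trans (by gcongr)

theorem CostClass.add_fderiv_add_le (h : CostClass c α G) (z z' : WithLp 2 (Vec dx × Vec du)) :
    pairCost c z + fderiv ℝ (pairCost c) z (z' - z) + α / 2 * ‖z' - z‖ ^ 2 ≤ pairCost c z' :=
  h.strongConvex.add_fderiv_add_le (h.differentiable_pairCost z) z'

/-- The tangent at `(x, u)` lies below the cost, so only this point needs to be bounded; `(x', u')`
is arbitrary. -/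
theorem CostClass.sub_le (h : CostClass c α G) (hα : 0 ≤ α) {D : ℝ} {x : Vec dx} {u : Vec du}
    (hx : ‖x‖ ≤ D) (hu : ‖u‖ ≤ D) (x' : Vec dx) (u' : Vec du) :
    c x u - c x' u' ≤ G * D * (‖x - x'‖ + ‖u - u'‖) := by
  have h1 := h.add_fderiv_add_le (WithLp.toLp 2 (x, u)) (WithLp.toLp 2 (x', u'))
  have h2 := h.abs_fderiv_le (z := WithLp.toLp 2 (x, u)) hx hu
    (WithLp.toLp 2 (x', u') - WithLp.toLp 2 (x, u))
  have h3 := neg_abs_le (fderiv ℝ (pairCost c) (WithLp.toLp 2 (x, u))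
    (WithLp.toLp 2 (x', u') - WithLp.toLp 2 (x, u)))
  have h4 : 0 ≤ α / 2 * ‖(WithLp.toLp 2 (x', u') - WithLp.toLp 2 (x, u) :
    WithLp 2 (Vec dx × Vec du))‖ ^ 2 := by positivity
  have h5 : ‖x - x'‖ + ‖u - u'‖
      = ‖(WithLp.toLp 2 (x', u') - WithLp.toLp 2 (x, u) : WithLp 2 (Vec dx × Vec du)).fst‖
      + ‖(WithLp.toLp 2 (x', u') - WithLp.toLp 2 (x, u) : WithLp 2 (Vec dx × Vec du)).snd‖ := by
    rw [norm_sub_rev x, norm_sub_rev u]; rfl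
  rw [h5]
  have h6 : pairCost c (WithLp.toLp 2 (x, u)) = c x u := rfl
  have h7 : pairCost c (WithLp.toLp 2 (x', u')) = c x' u' := rfl
  linarith

theorem continuous_of_differentiable {E : Type*} [NormedAddCommGroup E] [NormedSpace ℝ E]
    {f : E → ℝ} (h : Differentiable ℝ f) : Continuous f := h.continuous

theorem CostClass.continuous_pairCost (h : CostClass c α G) : Continuous (pairCost c) :=
  continuous_of_differentiable h.differentiable_pairCost

theorem CostClass.continuous (h : CostClass c α G) :
    Continuous fun z : Vec dx × Vec du => c z.1 z.2 := by
  exact h.continuous_pairCost.comp (WithLp.prod_continuous_toLp 2 (Vec dx) (Vec du))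

end

/-! ### Size of states and controls -/

section Size

variable {A : Mat dx dx} {B : Mat dx du} {K : Mat du dx} {κ κB γ W : ℝ}

/-- A common bound on all states and controls. -/
noncomputable def sizeBound (κ κB γ W : ℝ) : ℝ := 4 * κ ^ 6 * κB ^ 2 * γ⁻¹ ^ 2 * W

theorem DiagStronglyStable.norm_sum_app_pow_le (hK : DiagStronglyStable A B κ γ K) (hκ : 1 ≤ κ)
    (hγ : 0 < γ) (hγ1 : γ < 1) {n : ℕ} {b : ℕ → Vec dx} {R : ℝ} (hR : 0 ≤ R)
    (hb : ∀ j < n, ‖b j‖ ≤ R) :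
    ‖∑ j ∈ Finset.range n, app ((A - B * K) ^ j) (b j)‖ ≤ κ ^ 2 * γ⁻¹ * R := by
  have hρ : 0 ≤ 1 - γ := by linarith
  calc _ ≤ ∑ j ∈ Finset.range n, κ ^ 2 * (1 - γ) ^ j * R := by
        refine norm_sum_le_of_le _ fun j hj => (norm_app_le _ _).trans ?_
        exact mul_le_mul (hK.norm_pow_le (by linarith) j) (hb j (Finset.mem_range.1 hj))
          (norm_nonneg _) (by positivity)
    _ = κ ^ 2 * (∑ j ∈ Finset.range n, (1 - γ) ^ j) * R := by
        rw [Finset.mul_sum, Finset.sum_mul]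
    _ ≤ _ := by
        gcongr
        exact sum_range_pow_le hγ hγ1 n

theorem Policy.norm_act_le {M : Policy H dx du} (hM : M ∈ policySet H dx du κ κB γ)
    (hκ : 1 ≤ κ) (hκB : 1 ≤ κB) (hγ : 0 < γ) (hγ1 : γ < 1) (hW : 0 ≤ W) {ζ : Fin H → Vec dx}
    (hζ : ∀ k, ‖ζ k‖ ≤ W) : ‖M.act ζ‖ ≤ κ ^ 3 * κB * γ⁻¹ * W := by
  have hρ : 0 ≤ 1 - γ := by linarith
  have hsum := sum_range_pow_le hγ hγ1 H
  rw [Finset.sum_range] at hsum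
  calc ‖M.act ζ‖ ≤ ∑ k : Fin H, κ ^ 3 * κB * (1 - γ) ^ (k : ℕ) * W := by
        refine norm_sum_le_of_le _ fun k _ => (norm_app_le _ _).trans ?_
        refine mul_le_mul ((hM k).trans ?_) (hζ k) (norm_nonneg _) (by positivity)
        gcongr ?_ * ?_
        exact pow_le_pow_of_le_one hρ (by linarith) (by omega)
    _ = κ ^ 3 * κB * (∑ k : Fin H, (1 - γ) ^ (k : ℕ)) * W := by
        rw [Finset.mul_sum, Finset.sum_mul]
    _ ≤ _ := by gcongr

/-- A closed-loop state and control driven by bounded disturbances and a bounded extra control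
respect `sizeBound`. -/
theorem DiagStronglyStable.norm_le_sizeBound (hK : DiagStronglyStable A B κ γ K) (hκ : 1 ≤ κ)
    (hκB : 1 ≤ κB) (hB : ‖B‖ ≤ κB) (hγ : 0 < γ) (hγ1 : γ < 1) (hW : 0 ≤ W) {n : ℕ}
    {v : ℕ → Vec du} {ζ : ℕ → Vec dx} (hv : ∀ j < n, ‖v j‖ ≤ κ ^ 3 * κB * γ⁻¹ * W)
    (hζ : ∀ j < n, ‖ζ j‖ ≤ W) {v' : Vec du} (hv' : ‖v'‖ ≤ κ ^ 3 * κB * γ⁻¹ * W) {x : Vec dx}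
    (hx : x = ∑ j ∈ Finset.range n, app ((A - B * K) ^ j) (app B (v j) + ζ j)) :
    ‖x‖ ≤ sizeBound κ κB γ W ∧ ‖- app K x + v'‖ ≤ sizeBound κ κB γ W := by
  have hg : 1 ≤ γ⁻¹ := (one_le_inv₀ hγ).2 hγ1.le
  -- Each input has norm at most `κ_B · κ³ κ_B γ⁻¹ W + W`. The geometric sum multiplies this by `κ²
  -- γ⁻¹` and the feedback by another `κ`, whence the exponents in `sizeBound`.
  have hR : ∀ j < n, ‖app B (v j) + ζ j‖ ≤ 2 * κ ^ 3 * κB ^ 2 * γ⁻¹ * W := fun j hj => by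
    have h1 : ‖app B (v j)‖ ≤ κB * (κ ^ 3 * κB * γ⁻¹ * W) :=
      (norm_app_le _ _).trans (mul_le_mul hB (hv j hj) (norm_nonneg _) (by linarith))
    have h2 : 1 * W ≤ κ ^ 3 * κB ^ 2 * γ⁻¹ * W := by
      gcongr
      exact one_le_mul_of_one_le_of_one_le (one_le_mul_of_one_le_of_one_le (one_le_pow₀ hκ)
        (one_le_pow₀ hκB)) hg
    have h3 := norm_add_le (app B (v j)) (ζ j)
    have h4 := hζ j hj
    linarith
  have hx1 : ‖x‖ ≤ 2 * κ ^ 5 * κB ^ 2 * γ⁻¹ ^ 2 * W := by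
    rw [hx]
    refine (hK.norm_sum_app_pow_le hκ hγ hγ1 (by positivity) hR).trans (le_of_eq (by ring))
  have hx2 : 2 * κ ^ 5 * κB ^ 2 * γ⁻¹ ^ 2 * W ≤ 2 * κ ^ 6 * κB ^ 2 * γ⁻¹ ^ 2 * W := by
    gcongr
    norm_num
  have hpos : 0 ≤ κ ^ 6 * κB ^ 2 * γ⁻¹ ^ 2 * W := by positivity
  have hv2 : κ ^ 3 * κB * γ⁻¹ * W ≤ κ ^ 6 * κB ^ 2 * γ⁻¹ ^ 2 * W := by
    gcongr ?_ * ?_ * ?_ * ?_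
    · exact pow_le_pow_right₀ hκ (by norm_num)
    · exact le_self_pow₀ hκB (by norm_num)
    · exact le_self_pow₀ hg (by norm_num)
  have hKx : ‖app K x‖ ≤ κ * (2 * κ ^ 5 * κB ^ 2 * γ⁻¹ ^ 2 * W) :=
    (norm_app_le _ _).trans (mul_le_mul hK.norm_le hx1 (norm_nonneg _) (by linarith))
  have h3 := norm_add_le (- app K x) v'
  rw [norm_neg] at h3
  unfold sizeBound
  constructor <;> linarith

theorem DiagStronglyStable.surrogate_le_sizeBound (hK : DiagStronglyStable A B κ γ K) (hκ : 1 ≤ κ)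
    (hκB : 1 ≤ κB) (hB : ‖B‖ ≤ κB) (hγ : 0 < γ) (hγ1 : γ < 1) (hW : 0 ≤ W)
    {M : Policy H dx du} (hM : M ∈ policySet H dx du κ κB γ) {ξ : Fin (2 * H + 1) → Vec dx}
    (hξ : ‖ξ‖ ≤ W) :
    ‖surrogateState A B K M ξ‖ ≤ sizeBound κ κB γ W ∧
      ‖surrogateAction A B K M ξ‖ ≤ sizeBound κ κB γ W := by
  have hξ' : ∀ i, ‖ξ i‖ ≤ W := fun i => (norm_le_pi_norm ξ i).trans hξ
  have hact : ∀ ζ : Fin H → Vec dx, (∀ k, ‖ζ k‖ ≤ W) → ‖M.act ζ‖ ≤ κ ^ 3 * κB * γ⁻¹ * W :=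
    fun ζ hζ => Policy.norm_act_le hM hκ hκB hγ hγ1 hW hζ
  refine hK.norm_le_sizeBound hκ hκB hB hγ hγ1 hW (n := H + 1)
    (v := fun j => if h : j < H + 1 then M.act (window ξ ⟨j, h⟩) else 0)
    (ζ := fun j => if h : j < H + 1 then ξ ⟨j, by omega⟩ else 0) (fun j hj => ?_) (fun j hj => ?_)
    (v' := M.act (recent ξ)) (hact _ fun k => hξ' _) ?_
  · simp only [hj, dif_pos]
    exact hact _ fun k => hξ' _
  · simp only [hj, dif_pos]
    exact hξ' _
  · rw [surrogateState_eq, Finset.sum_range]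
    refine Finset.sum_congr rfl fun j _ => ?_
    rw [dif_pos j.2, dif_pos j.2]

end Size

/-! ### The surrogate cost -/

section SurrogateCost

variable {ν : Measure (Vec dx)} {σ W : ℝ} {A : Mat dx dx} {B : Mat dx du} {Kst : Mat du dx}
  {c : Vec dx → Vec du → ℝ} {α G : ℝ}

theorem surrogateCost_eq (M : Policy H dx du) : surrogateCost ν A B Kst c M
    = ∫ ξ, pairCost c (surrogatePair A B Kst M ξ) ∂(Measure.pi fun _ : Fin (2 * H + 1) => ν) :=
  rfl

/-- The sum of the norms of the columns of the Jacobian bounds its operator norm. -/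
theorem norm_response_le (N : Policy H dx du) (ξ : Fin (2 * H + 1) → Vec dx) :
    ‖response A B Kst ξ N‖ ≤ (∑ p, ‖response A B Kst ξ (EuclideanSpace.single p 1)‖) * ‖N‖ := by
  have hN : N = ∑ p, N p • EuclideanSpace.single p (1 : ℝ) := by
    ext q
    simp [Pi.single_apply]
  conv_lhs => rw [hN]
  rw [map_sum, Finset.sum_mul]
  refine norm_sum_le_of_le _ fun p _ => ?_
  rw [map_smul, norm_smul, mul_comm]
  gcongr
  exact PiLp.norm_apply_le N p

/-- The Jacobian of the surrogate pair, as a continuous linear map. -/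
noncomputable def responseCLM (A : Mat dx dx) (B : Mat dx du) (Kst : Mat du dx)
    (ξ : Fin (2 * H + 1) → Vec dx) : Policy H dx du →L[ℝ] WithLp 2 (Vec dx × Vec du) :=
  (response A B Kst ξ).mkContinuous _ fun N => norm_response_le N ξ

theorem responseCLM_apply (N : Policy H dx du) (ξ : Fin (2 * H + 1) → Vec dx) :
    responseCLM A B Kst ξ N = response A B Kst ξ N := rfl

theorem norm_fst_le_norm {E F : Type*} [NormedAddCommGroup E] [NormedAddCommGroup F]
    (z : WithLp 2 (E × F)) : ‖z.fst‖ ≤ ‖z‖ := by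
  have := WithLp.prod_norm_sq_eq_of_L2 z
  exact le_of_sq_le_sq (by nlinarith [sq_nonneg ‖z.snd‖]) (norm_nonneg _)

theorem norm_snd_le_norm {E F : Type*} [NormedAddCommGroup E] [NormedAddCommGroup F]
    (z : WithLp 2 (E × F)) : ‖z.snd‖ ≤ ‖z‖ := by
  have := WithLp.prod_norm_sq_eq_of_L2 z
  exact le_of_sq_le_sq (by nlinarith [sq_nonneg ‖z.fst‖]) (norm_nonneg _)

/-- The derivative of the cost is not assumed continuous, but a directional derivative is a
pointwise limit of continuous difference quotients with step `1 / n`. -/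
theorem CostClass.measurable_fderiv_comp (hc : CostClass c α G) {X : Type*} [TopologicalSpace X]
    [MeasurableSpace X] [BorelSpace X] {z v : X → WithLp 2 (Vec dx × Vec du)} (hz : Continuous z)
    (hv : Continuous v) : Measurable fun ξ => fderiv ℝ (pairCost c) (z ξ) (v ξ) := by
  have hC := hc.continuous_pairCost
  refine measurable_of_tendsto_metrizable (f := fun (n : ℕ) ξ =>
    (n : ℝ) • (pairCost c (z ξ + (n : ℝ)⁻¹ • v ξ) - pairCost c (z ξ))) (fun n => ?_) ?_
  · refine Continuous.measurable ?_
    fun_prop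
  · rw [tendsto_pi_nhds]
    intro ξ
    exact ((hc.differentiable_pairCost (z ξ)).hasFDerivAt.lim_real (v ξ)).comp
      tendsto_natCast_atTop_atTop

/-- Differentiation of the surrogate cost under the expectation. -/
theorem NoiseLaw.hasFDerivAt_surrogateCost (h : NoiseLaw ν σ W) (hc : CostClass c α G)
    (M : Policy H dx du) :
    Integrable (fun ξ => (fderiv ℝ (pairCost c) (surrogatePair A B Kst M ξ)) ∘L
        responseCLM A B Kst ξ)
        (Measure.pi fun _ : Fin (2 * H + 1) => ν) ∧
    HasFDerivAt (surrogateCost ν A B Kst c)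
      (∫ ξ, (fderiv ℝ (pairCost c) (surrogatePair A B Kst M ξ)) ∘L
        responseCLM A B Kst ξ
        ∂(Measure.pi fun _ : Fin (2 * H + 1) => ν)) M := by
  -- `b ξ` dominates the norm of the Jacobian and `R ξ` that of the surrogate pair over the unit
  -- ball around `M`. Both are continuous in `ξ`, so the resulting bound on the derivative is
  -- integrable.
  set b : (Fin (2 * H + 1) → Vec dx) → ℝ := fun ξ =>
    ∑ p : Fin H × Fin du × Fin dx, ‖response A B Kst ξ (EuclideanSpace.single p 1)‖ with hb
  set R : (Fin (2 * H + 1) → Vec dx) → ℝ := fun ξ =>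
    ‖surrogatePair A B Kst (0 : Policy H dx du) ξ‖ + b ξ * (‖M‖ + 1) with hR
  have hb0 : ∀ ξ, 0 ≤ b ξ := fun ξ => Finset.sum_nonneg fun _ _ => norm_nonneg _
  have hR0 : ∀ ξ, 0 ≤ R ξ := fun ξ => by have := hb0 ξ; positivity
  have hG := hc.gradBound_nonneg
  have hbound : ∀ ξ, ∀ N ∈ Metric.ball M 1,
      ‖(fderiv ℝ (pairCost c) (surrogatePair A B Kst N ξ)) ∘L
        responseCLM A B Kst ξ‖ ≤ G * R ξ * (2 * b ξ) := by
    intro ξ N hN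
    have hN' : ‖N‖ ≤ ‖M‖ + 1 := by
      rw [mem_ball_iff_norm] at hN
      linarith [norm_le_norm_add_norm_sub M N, norm_sub_rev N M]
    have hz : ‖surrogatePair A B Kst N ξ‖ ≤ R ξ := by
      rw [surrogatePair_eq]
      refine (norm_add_le _ _).trans (add_le_add le_rfl ((norm_response_le N ξ).trans ?_))
      exact mul_le_mul_of_nonneg_left hN' (hb0 ξ)
    refine ContinuousLinearMap.opNorm_le_bound _
      (mul_nonneg (mul_nonneg hG (hR0 ξ)) (by linarith [hb0 ξ])) fun V => ?_
    have h1 := hc.abs_fderiv_le ((norm_fst_le_norm _).trans hz)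
      ((norm_snd_le_norm _).trans hz) (response A B Kst ξ V)
    have h2 := norm_response_le (A := A) (B := B) (Kst := Kst) V ξ
    have h3 := norm_fst_le_norm (response A B Kst ξ V)
    have h4 := norm_snd_le_norm (response A B Kst ξ V)
    calc _ ≤ G * R ξ * (‖(response A B Kst ξ V).fst‖ + ‖(response A B Kst ξ V).snd‖) := h1
      _ ≤ G * R ξ * (2 * (b ξ * ‖V‖)) := by
          refine mul_le_mul_of_nonneg_left ?_ (mul_nonneg hG (hR0 ξ))
          simp only [hb]
          linarith
      _ = _ := by ring
  have hcont : Continuous fun ξ => G * R ξ * (2 * b ξ) := by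
    simp only [hR, hb]
    fun_prop
  have hmeas : AEStronglyMeasurable (fun ξ =>
      (fderiv ℝ (pairCost c) (surrogatePair A B Kst M ξ)) ∘L
        responseCLM A B Kst ξ)
      (Measure.pi fun _ : Fin (2 * H + 1) => ν) := by
    -- In coordinates, measurability of the operator-valued integrand reduces to that of directional
    -- derivatives.
    have heq : (fun ξ => (fderiv ℝ (pairCost c) (surrogatePair A B Kst M ξ)) ∘L
        responseCLM A B Kst ξ)
        = fun ξ => ∑ p : Fin H × Fin du × Fin dx,
          (fderiv ℝ (pairCost c) (surrogatePair A B Kst M ξ)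
            (response A B Kst ξ (EuclideanSpace.single p 1))) •
              (EuclideanSpace.proj p : Policy H dx du →L[ℝ] ℝ) := by
      funext ξ
      ext V
      have hV : V = ∑ p, V p • EuclideanSpace.single p (1 : ℝ) := by
        ext q
        simp [Pi.single_apply]
      conv_lhs => rw [hV]
      simp [map_sum, mul_comm, responseCLM_apply]
    rw [heq]
    refine Finset.aestronglyMeasurable_fun_sum _ fun p _ => ?_
    exact (hc.measurable_fderiv_comp (by fun_prop)
      (by fun_prop)).aestronglyMeasurable.smul_const _
  have hint := h.integrable_pi hcont
  refine ⟨hint.mono' hmeas (Filter.Eventually.of_forall fun ξ =>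
    hbound ξ M (Metric.mem_ball_self one_pos)), ?_⟩
  refine hasFDerivAt_integral_of_dominated_of_fderiv_le
    (F := fun M ξ => pairCost c (surrogatePair A B Kst M ξ))
    (F' := fun M ξ => (fderiv ℝ (pairCost c) (surrogatePair A B Kst M ξ)) ∘L
        responseCLM A B Kst ξ) (Metric.ball_mem_nhds M one_pos)
    (Filter.Eventually.of_forall fun N => ?_) ?_ hmeas
    (Filter.Eventually.of_forall hbound) hint (Filter.Eventually.of_forall fun ξ N _ => ?_)
  · exact (hc.continuous_pairCost.comp (continuous_surrogatePair A B Kst N)).aestronglyMeasurable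
  · exact h.integrable_pi (hc.continuous_pairCost.comp (continuous_surrogatePair A B Kst M))
  · have h1 : HasFDerivAt (fun N : Policy H dx du => surrogatePair A B Kst N ξ)
        (responseCLM A B Kst ξ) N := by
      have h2 : (fun N : Policy H dx du => surrogatePair A B Kst N ξ)
          = fun N => surrogatePair A B Kst 0 ξ + (responseCLM A B Kst ξ) N :=
        funext fun N => surrogatePair_eq A B Kst N ξ
      rw [h2]
      exact (ContinuousLinearMap.hasFDerivAt _).const_add _
    exact (hc.differentiable_pairCost _).hasFDerivAt.comp N h1

theorem NoiseLaw.integrable_fderiv_response (h : NoiseLaw ν σ W) (hc : CostClass c α G)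
    (M N : Policy H dx du) :
    Integrable (fun ξ => fderiv ℝ (pairCost c) (surrogatePair A B Kst M ξ) (response A B Kst ξ N))
      (Measure.pi fun _ : Fin (2 * H + 1) => ν) :=
  (h.hasFDerivAt_surrogateCost (A := A) (B := B) (Kst := Kst) hc M).1.apply_continuousLinearMap N

theorem NoiseLaw.inner_gradient_surrogateCost (h : NoiseLaw ν σ W) (hc : CostClass c α G)
    (M N : Policy H dx du) :
    inner ℝ (gradient (surrogateCost ν A B Kst c) M) N
      = ∫ ξ, fderiv ℝ (pairCost c) (surrogatePair A B Kst M ξ) (response A B Kst ξ N)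
        ∂(Measure.pi fun _ : Fin (2 * H + 1) => ν) := by
  obtain ⟨h1, h2⟩ := h.hasFDerivAt_surrogateCost (A := A) (B := B) (Kst := Kst) hc M
  rw [gradient, InnerProductSpace.toDual_symm_apply, h2.fderiv,
    ContinuousLinearMap.integral_apply h1]
  rfl

theorem NoiseLaw.integrable_pairCost (h : NoiseLaw ν σ W) (hc : CostClass c α G)
    (M : Policy H dx du) :
    Integrable (fun ξ => pairCost c (surrogatePair A B Kst M ξ))
      (Measure.pi fun _ : Fin (2 * H + 1) => ν) :=
  h.integrable_pi (hc.continuous_pairCost.comp (continuous_surrogatePair A B Kst M))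

/-- The surrogate cost is strongly convex in the norm of the preconditioner. -/
theorem NoiseLaw.add_inner_gradient_add_le (h : NoiseLaw ν σ W) (hc : CostClass c α G)
    (M N : Policy H dx du) :
    surrogateCost ν A B Kst c M + inner ℝ (gradient (surrogateCost ν A B Kst c) M) (N - M)
      + α / 2 * ∫ ξ, ‖response A B Kst ξ (N - M)‖ ^ 2 ∂(Measure.pi fun _ : Fin (2 * H + 1) => ν)
      ≤ surrogateCost ν A B Kst c N := by
  have h0 := h.integrable_pairCost (A := A) (B := B) (Kst := Kst) hc M
  have h1 := h.integrable_fderiv_response (A := A) (B := B) (Kst := Kst) hc M (N - M)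
  have h2 : Integrable (fun ξ => α / 2 * ‖response A B Kst ξ (N - M)‖ ^ 2)
      (Measure.pi fun _ : Fin (2 * H + 1) => ν) := h.integrable_pi (by fun_prop)
  have h01 : Integrable (fun ξ => pairCost c (surrogatePair A B Kst M ξ) +
      fderiv ℝ (pairCost c) (surrogatePair A B Kst M ξ) (response A B Kst ξ (N - M)))
      (Measure.pi fun _ : Fin (2 * H + 1) => ν) := h0.add h1
  rw [h.inner_gradient_surrogateCost hc, surrogateCost_eq, surrogateCost_eq, ← integral_const_mul,
    ← integral_add h0 h1, ← integral_add h01 h2]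
  refine integral_mono (h01.add h2) (h.integrable_pairCost hc N) fun ξ => ?_
  have := hc.add_fderiv_add_le (surrogatePair A B Kst M ξ) (surrogatePair A B Kst N ξ)
  rwa [surrogatePair_sub] at this

/-- The derivative of the surrogate cost is bounded in the norm of the preconditioner. -/
theorem NoiseLaw.abs_inner_gradient_le (h : NoiseLaw ν σ W) (hc : CostClass c α G) {κ κB γ : ℝ}
    (hK : DiagStronglyStable A B κ γ Kst) (hκ : 1 ≤ κ) (hκB : 1 ≤ κB) (hB : ‖B‖ ≤ κB)
    (hγ : 0 < γ) (hγ1 : γ < 1) {M : Policy H dx du} (hM : M ∈ policySet H dx du κ κB γ)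
    (N : Policy H dx du) :
    |inner ℝ (gradient (surrogateCost ν A B Kst c) M) N| ≤ 2 * G * sizeBound κ κB γ W *
      √(∫ ξ, ‖response A B Kst ξ N‖ ^ 2 ∂(Measure.pi fun _ : Fin (2 * H + 1) => ν)) := by
  have hp := h.isProb
  have hG := hc.gradBound_nonneg
  have hW := h.bound_nonneg
  have hD : 0 ≤ sizeBound κ κB γ W := by unfold sizeBound; positivity
  rw [h.inner_gradient_surrogateCost hc]
  calc _ ≤ ∫ ξ, |fderiv ℝ (pairCost c) (surrogatePair A B Kst M ξ) (response A B Kst ξ N)|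
        ∂(Measure.pi fun _ : Fin (2 * H + 1) => ν) := abs_integral_le_integral_abs
    _ ≤ ∫ ξ, 2 * G * sizeBound κ κB γ W * ‖response A B Kst ξ N‖
        ∂(Measure.pi fun _ : Fin (2 * H + 1) => ν) := by
        refine integral_mono_ae (h.integrable_fderiv_response hc M N).abs
          (h.integrable_pi (by fun_prop)) ?_
        filter_upwards [h.ae_pi_bounded] with ξ hξ
        obtain ⟨h1, h2⟩ := hK.surrogate_le_sizeBound hκ hκB hB hγ hγ1 hW hM hξ
        refine (hc.abs_fderiv_le (z := surrogatePair A B Kst M ξ) h1 h2 _).trans ?_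
        have h3 := norm_fst_le_norm (response A B Kst ξ N)
        have h4 := norm_snd_le_norm (response A B Kst ξ N)
        calc _ ≤ G * sizeBound κ κB γ W * (2 * ‖response A B Kst ξ N‖) := by
              gcongr
              linarith
          _ = _ := by ring
    _ = 2 * G * sizeBound κ κB γ W * ∫ ξ, ‖response A B Kst ξ N‖
        ∂(Measure.pi fun _ : Fin (2 * H + 1) => ν) := integral_const_mul _ _
    _ ≤ _ := by
        gcongr
        exact integral_norm_le_sqrt (h.integrable_pi (by fun_prop)) (h.integrable_pi (by fun_prop))

end SurrogateCost

/-! ### Weighted norms and projections -/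

section Weighted

variable {ι : Type*} [Fintype ι] {S : Matrix ι ι ℝ}

/-- The bilinear form `uᵀ S v`. -/
def weightedInner (S : Matrix ι ι ℝ) (u v : EuclideanSpace ℝ ι) : ℝ :=
  dotProduct u.ofLp (S.mulVec v.ofLp)

theorem weightedInner_comm (hS : S.IsSymm) (u v : EuclideanSpace ℝ ι) :
    weightedInner S u v = weightedInner S v u := by
  unfold weightedInner
  rw [Matrix.dotProduct_mulVec, ← Matrix.mulVec_transpose, hS.eq, dotProduct_comm]

theorem weightedSq_add_smul (hS : S.IsSymm) (u v : EuclideanSpace ℝ ι) (r : ℝ) :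
    weightedSq S (u + r • v)
      = weightedSq S u + 2 * r * weightedInner S u v + r ^ 2 * weightedSq S v := by
  have h := weightedInner_comm hS u v
  unfold weightedInner at h
  unfold weightedInner weightedSq
  simp only [WithLp.ofLp_add, WithLp.ofLp_smul, Matrix.mulVec_add, Matrix.mulVec_smul,
    dotProduct_add, add_dotProduct, smul_dotProduct, dotProduct_smul, smul_eq_mul, ← h]
  ring

theorem weightedSq_smul (r : ℝ) (v : EuclideanSpace ℝ ι) :
    weightedSq S (r • v) = r ^ 2 * weightedSq S v := by
  unfold weightedSq
  simp only [WithLp.ofLp_smul, Matrix.mulVec_smul, smul_dotProduct, dotProduct_smul, smul_eq_mul]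
  ring

theorem weightedSq_sub_comm (u v : EuclideanSpace ℝ ι) :
    weightedSq S (u - v) = weightedSq S (v - u) := by
  rw [← neg_sub, ← neg_one_smul ℝ, weightedSq_smul]
  ring

/-- Cauchy–Schwarz for a semidefinite form: the quadratic `r ↦ ‖u + r v‖²_S` is nonnegative, so its
discriminant is at most zero. -/
theorem abs_weightedInner_le (hS : S.IsSymm) (hpos : ∀ v, 0 ≤ weightedSq S v)
    (u v : EuclideanSpace ℝ ι) :
    |weightedInner S u v| ≤ √(weightedSq S u) * √(weightedSq S v) := by
  have h := discrim_le_zero (a := weightedSq S v) (b := 2 * weightedInner S u v)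
    (c := weightedSq S u) fun r => by
      have h1 := hpos (u + r • v)
      rw [weightedSq_add_smul hS] at h1
      linarith
  rw [← Real.sqrt_mul (hpos u)]
  refine Real.abs_le_sqrt ?_
  rw [discrim] at h
  linarith

/-- The Pythagorean inequality for projections onto convex sets. -/
theorem IsProjection.weightedSq_add_le (hS : S.IsSymm) {C : Set (EuclideanSpace ℝ ι)}
    (hC : Convex ℝ C) {p q r : EuclideanSpace ℝ ι} (hq : IsProjection S C p q) (hr : r ∈ C) :
    weightedSq S (r - q) + weightedSq S (q - p) ≤ weightedSq S (r - p) := by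
  have hexp : ∀ θ : ℝ, weightedSq S (q - p + θ • (r - q))
      = weightedSq S (q - p) + 2 * θ * weightedInner S (q - p) (r - q)
        + θ ^ 2 * weightedSq S (r - q) := weightedSq_add_smul hS _ _
  -- Minimality of `q` against the points of the segment towards `r`, divided by `θ`; the limit `θ →
  -- 0` leaves the sign of the cross term.
  have hmin : ∀ θ : ℝ, 0 < θ → θ ≤ 1 →
      0 ≤ 2 * weightedInner S (q - p) (r - q) + θ * weightedSq S (r - q) := by
    intro θ h0 h1
    have hmem : q + θ • (r - q) ∈ C := hC.add_smul_sub_mem hq.1 hr ⟨h0.le, h1⟩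
    have h2 := hq.2 _ hmem
    rw [show q + θ • (r - q) - p = q - p + θ • (r - q) by abel, hexp] at h2
    have h3 : 0 ≤ θ * (2 * weightedInner S (q - p) (r - q) + θ * weightedSq S (r - q)) := by
      nlinarith
    exact nonneg_of_mul_nonneg_right h3 h0
  have hinner : 0 ≤ weightedInner S (q - p) (r - q) := by
    have hlim : Filter.Tendsto
        (fun θ : ℝ => 2 * weightedInner S (q - p) (r - q) + θ * weightedSq S (r - q))
        (nhdsWithin 0 (Set.Ioi 0))
        (nhds (2 * weightedInner S (q - p) (r - q) + 0 * weightedSq S (r - q))) :=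
      (Continuous.tendsto (by fun_prop) 0).mono_left nhdsWithin_le_nhds
    have := ge_of_tendsto hlim (by
      filter_upwards [Ioo_mem_nhdsGT (zero_lt_one' ℝ)] with θ hθ
      exact hmin θ hθ.1 hθ.2.le)
    linarith
  have h1 := hexp 1
  rw [show q - p + (1 : ℝ) • (r - q) = r - p by rw [one_smul]; abel] at h1
  linarith

end Weighted

theorem convex_policySet (κ κB γ : ℝ) : Convex ℝ (policySet H dx du κ κB γ) := by
  intro M hM N hN a b ha hb hab i
  rw [Policy.block_add, Policy.block_smul, Policy.block_smul]
  calc _ ≤ ‖a • M.block i‖ + ‖b • N.block i‖ := norm_add_le _ _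
    _ = a * ‖M.block i‖ + b * ‖N.block i‖ := by
        rw [norm_smul, norm_smul, Real.norm_of_nonneg ha, Real.norm_of_nonneg hb]
    _ ≤ a * (κ ^ 3 * κB * (1 - γ) ^ ((i : ℕ) + 1))
        + b * (κ ^ 3 * κB * (1 - γ) ^ ((i : ℕ) + 1)) := by
        gcongr
        · exact hM i
        · exact hN i
    _ = _ := by rw [← add_mul, hab, one_mul]

/-! ### The preconditioner -/

/-- The standing assumptions on the system, the stabilizing controller and the noise. -/
structure Setting (A : Mat dx dx) (B : Mat dx du) (Kst : Mat du dx) (κ κB γ : ℝ)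
    (ν : Measure (Vec dx)) (σ W : ℝ) : Prop where
  one_le_κ : 1 ≤ κ
  γ_pos : 0 < γ
  γ_lt_one : γ < 1
  σ_pos : 0 < σ
  norm_B_le : ‖B‖ ≤ κB
  two_le : 2 ≤ κB * (1 - γ)
  stable : DiagStronglyStable A B κ γ Kst
  noise : NoiseLaw ν σ W

section Gram

variable {A : Mat dx dx} {B : Mat dx du} {Kst : Mat du dx} {κ κB γ : ℝ} {ν : Measure (Vec dx)}
  {σ W : ℝ} {c : Vec dx → Vec du → ℝ} {α G : ℝ}

theorem Setting.two_le_κB (h : Setting A B Kst κ κB γ ν σ W) : 2 ≤ κB := by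
  have h1 := h.two_le
  have h2 := h.γ_pos
  have h3 : 0 ≤ κB := (norm_nonneg _).trans h.norm_B_le
  nlinarith

theorem Setting.one_le_κB (h : Setting A B Kst κ κB γ ν σ W) : 1 ≤ κB := by
  linarith [h.two_le_κB]

theorem Setting.one_le_inv_γ (h : Setting A B Kst κ κB γ ν σ W) : 1 ≤ γ⁻¹ :=
  (one_le_inv₀ h.γ_pos).2 h.γ_lt_one.le

theorem Setting.sizeBound_nonneg (h : Setting A B Kst κ κB γ ν σ W) :
    0 ≤ sizeBound κ κB γ W := by
  have := h.noise.bound_nonneg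
  have := h.one_le_κ
  unfold sizeBound
  positivity

theorem gram_isSymm : (gram H ν A B Kst).IsSymm := by
  ext p q
  simp only [Matrix.transpose_apply, gram, Matrix.of_apply]
  exact integral_congr_ae (Filter.Eventually.of_forall fun ξ => real_inner_comm _ _)

/-- The norm of the preconditioner is the mean square of the Jacobian. -/
theorem NoiseLaw.weightedSq_gram (h : NoiseLaw ν σ W) (N : Policy H dx du) :
    weightedSq (gram H ν A B Kst) N
      = ∫ ξ, ‖response A B Kst ξ N‖ ^ 2 ∂(Measure.pi fun _ : Fin (2 * H + 1) => ν) := by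
  have hN : N = ∑ p, N p • EuclideanSpace.single p (1 : ℝ) := by
    ext q
    simp [Pi.single_apply]
  have hpt : ∀ ξ, ‖response A B Kst ξ N‖ ^ 2
      = ∑ p, ∑ q, N p * N q * inner ℝ (jacobianCol A B Kst ξ p) (jacobianCol A B Kst ξ q) := by
    intro ξ
    conv_lhs => rw [hN]
    rw [← real_inner_self_eq_norm_sq, map_sum, sum_inner]
    refine Finset.sum_congr rfl fun p _ => ?_
    rw [inner_sum]
    refine Finset.sum_congr rfl fun q _ => ?_
    rw [map_smul, map_smul, real_inner_smul_left, real_inner_smul_right, jacobianCol_eq,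
      jacobianCol_eq]
    ring
  simp_rw [hpt]
  have hint : ∀ p q : Fin H × Fin du × Fin dx, Integrable (fun ξ => N p * N q *
      inner ℝ (jacobianCol A B Kst ξ p) (jacobianCol A B Kst ξ q))
      (Measure.pi fun _ : Fin (2 * H + 1) => ν) := fun p q => by
    simp only [jacobianCol_eq]
    exact h.integrable_pi (by fun_prop)
  rw [integral_finsetSum _ fun p _ => integrable_finsetSum _ fun q _ => hint p q]
  unfold weightedSq dotProduct Matrix.mulVec
  refine Finset.sum_congr rfl fun p _ => ?_
  rw [integral_finsetSum _ fun q _ => hint p q, dotProduct, Finset.mul_sum]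
  refine Finset.sum_congr rfl fun q _ => ?_
  rw [integral_const_mul, gram, Matrix.of_apply]
  ring

theorem NoiseLaw.weightedSq_gram_nonneg (h : NoiseLaw ν σ W) (N : Policy H dx du) :
    0 ≤ weightedSq (gram H ν A B Kst) N := by
  rw [h.weightedSq_gram]
  exact integral_nonneg fun _ => sq_nonneg _

theorem Setting.sqrt_energy_le (h : Setting A B Kst κ κB γ ν σ W) (N : Policy H dx du) :
    √(N.energy ν) ≤ 2 * κ * √(weightedSq (gram H ν A B Kst) N) := by
  have hκ := h.one_le_κ
  have h1 := h.noise.energy_le_integral_response hκ h.stable N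
  rw [← h.noise.weightedSq_gram] at h1
  calc _ ≤ √((2 * κ) ^ 2 * weightedSq (gram H ν A B Kst) N) := Real.sqrt_le_sqrt h1
    _ = _ := by rw [Real.sqrt_mul (sq_nonneg _), Real.sqrt_sq (by linarith)]

theorem Setting.sqrt_weightedSq_le (h : Setting A B Kst κ κB γ ν σ W) (N : Policy H dx du) :
    √(weightedSq (gram H ν A B Kst) N)
      ≤ 3 * κ ^ 3 * κB * γ⁻¹ * √(∫ w, ‖w‖ ^ 2 ∂ν) * ‖N‖ := by
  have hκ := h.one_le_κ
  have hg := h.one_le_inv_γ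
  have hκB := h.one_le_κB
  have h1 := h.noise.integral_response_le hκ h.γ_pos h.γ_lt_one h.norm_B_le hκB h.stable N
  rw [← h.noise.weightedSq_gram] at h1
  have h2 := h.noise.energy_le N
  have h3 : weightedSq (gram H ν A B Kst) N
      ≤ (3 * κ ^ 3 * κB * γ⁻¹) ^ 2 * (‖N‖ ^ 2 * ∫ w, ‖w‖ ^ 2 ∂ν) := h1.trans (by gcongr)
  calc _ ≤ √((3 * κ ^ 3 * κB * γ⁻¹) ^ 2 * (‖N‖ ^ 2 * ∫ w, ‖w‖ ^ 2 ∂ν)) := Real.sqrt_le_sqrt h3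
    _ = _ := by
      rw [Real.sqrt_mul (sq_nonneg _), Real.sqrt_mul (sq_nonneg _), Real.sqrt_sq (by positivity),
        Real.sqrt_sq (norm_nonneg _)]
      ring

theorem NoiseLaw.sqrt_integral_norm_sq_le (h : NoiseLaw ν σ W) : √(∫ w, ‖w‖ ^ 2 ∂ν) ≤ W :=
  Real.sqrt_le_iff.2 ⟨h.bound_nonneg, h.integral_norm_sq_le⟩

theorem Setting.sqrt_weightedSq_le_bound (h : Setting A B Kst κ κB γ ν σ W)
    (N : Policy H dx du) :
    √(weightedSq (gram H ν A B Kst) N) ≤ 3 * κ ^ 3 * κB * γ⁻¹ * W * ‖N‖ := by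
  have hκ := h.one_le_κ
  have hg := h.one_le_inv_γ
  have hκB := h.one_le_κB
  refine (h.sqrt_weightedSq_le N).trans ?_
  gcongr
  exact h.noise.sqrt_integral_norm_sq_le

theorem Setting.mul_norm_le (h : Setting A B Kst κ κB γ ν σ W) (N : Policy H dx du) :
    σ * ‖N‖ ≤ 2 * κ * √(weightedSq (gram H ν A B Kst) N) := by
  have h1 := h.noise.le_energy N
  rw [← mul_pow] at h1
  exact (Real.le_sqrt_of_sq_le h1).trans (h.sqrt_energy_le N)

/-- Noise in all directions (`σ > 0`) makes the form definite, so the inverse in `naturalGradient`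
is a genuine one. -/
theorem Setting.isUnit_gram (h : Setting A B Kst κ κB γ ν σ W) :
    IsUnit (gram H ν A B Kst) := by
  rw [← Matrix.mulVec_injective_iff_isUnit]
  refine (injective_iff_map_eq_zero (Matrix.mulVecLin (gram H ν A B Kst))).2 fun v hv => ?_
  have h0 : weightedSq (gram H ν A B Kst) (WithLp.toLp 2 v) = 0 := by
    rw [Matrix.mulVecLin_apply] at hv
    rw [weightedSq]
    simp [hv]
  have h1 := h.mul_norm_le (WithLp.toLp 2 v)
  rw [h0, Real.sqrt_zero, mul_zero] at h1
  have h2 : ‖(WithLp.toLp 2 v : Policy H dx du)‖ ≤ 0 := by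
    by_contra hcon
    have := mul_pos h.σ_pos (not_le.1 hcon)
    linarith
  have h3 : (WithLp.toLp 2 v : Policy H dx du) = 0 := norm_le_zero_iff.1 h2
  simpa using congrArg WithLp.ofLp h3

/-- The natural gradient represents the derivative in the inner product of the preconditioner. -/
theorem Setting.weightedInner_naturalGradient (h : Setting A B Kst κ κB γ ν σ W)
    (M N : Policy H dx du) :
    weightedInner (gram H ν A B Kst) N (naturalGradient ν A B Kst c M)
      = inner ℝ (gradient (surrogateCost ν A B Kst c) M) N := by
  have hu : IsUnit (gram H ν A B Kst).det := (Matrix.isUnit_iff_isUnit_det _).1 h.isUnit_gram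
  unfold weightedInner naturalGradient
  rw [Matrix.toLpLin_apply, Matrix.mulVec_mulVec, Matrix.mul_nonsing_inv _ hu, Matrix.one_mulVec]
  rw [PiLp.inner_apply]
  exact Finset.sum_congr rfl fun p _ => rfl

/-- Duality: the derivative evaluated at the natural gradient `n` itself is `‖n‖²_P`, and it is at
most a constant times `‖n‖_P`. -/
theorem Setting.sqrt_weightedSq_naturalGradient_le (h : Setting A B Kst κ κB γ ν σ W)
    (hc : CostClass c α G) {M : Policy H dx du} (hM : M ∈ policySet H dx du κ κB γ) :
    √(weightedSq (gram H ν A B Kst) (naturalGradient ν A B Kst c M))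
      ≤ 2 * G * sizeBound κ κB γ W := by
  set n := naturalGradient ν A B Kst c M with hn
  have h1 := h.noise.abs_inner_gradient_le hc h.stable h.one_le_κ h.one_le_κB h.norm_B_le h.γ_pos
    h.γ_lt_one hM n
  rw [← h.noise.weightedSq_gram, ← h.weightedInner_naturalGradient] at h1
  have h2 : weightedInner (gram H ν A B Kst) n (naturalGradient ν A B Kst c M)
      = √(weightedSq (gram H ν A B Kst) n) * √(weightedSq (gram H ν A B Kst) n) :=
    (Real.mul_self_sqrt (h.noise.weightedSq_gram_nonneg n)).symm
  rw [h2, abs_of_nonneg (by positivity)] at h1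
  rcases (Real.sqrt_nonneg (weightedSq (gram H ν A B Kst) n)).eq_or_lt with h0 | h0
  · rw [← h0]
    have := hc.gradBound_nonneg
    have := h.sizeBound_nonneg
    positivity
  · exact le_of_mul_le_mul_right h1 h0

/-! ### Upper and lower control of the natural gradient by `muInv`. -/

section MuInv

variable {cs : ℕ → Vec dx → Vec du → ℝ} {T : ℕ}

/-- The supremum defining `muInv` is meaningful only over a bounded set. The bound exhibited for
this purpose involves `σ⁻¹`, but it is not used quantitatively. -/
theorem Setting.norm_naturalGradient_le_muInv (h : Setting A B Kst κ κB γ ν σ W)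
    (hc : ∀ t < T, CostClass (cs t) α G) {t : ℕ} (ht : t < T) {M : Policy H dx du}
    (hM : M ∈ policySet H dx du κ κB γ) :
    ‖naturalGradient ν A B Kst (cs t) M‖ ≤ muInv H ν A B Kst cs κ κB γ T := by
  refine le_csSup ⟨2 * κ * (2 * G * sizeBound κ κB γ W) / σ, ?_⟩ ⟨t, ht, M, hM, rfl⟩
  rintro r ⟨s, hs, N, hN, rfl⟩
  rw [le_div_iff₀ h.σ_pos, mul_comm]
  refine (h.mul_norm_le _).trans ?_
  have := h.one_le_κ
  gcongr
  exact h.sqrt_weightedSq_naturalGradient_le (hc s hs) hN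

theorem muInv_nonneg : 0 ≤ muInv H ν A B Kst cs κ κB γ T := by
  refine Real.sSup_nonneg ?_
  rintro r ⟨s, hs, N, hN, rfl⟩
  exact norm_nonneg _

theorem zero_mem_policySet (hκ : 0 ≤ κ) (hκB : 0 ≤ κB) (hγ : γ ≤ 1) :
    (0 : Policy H dx du) ∈ policySet H dx du κ κB γ := fun i => by
  have : 0 ≤ 1 - γ := by linarith
  rw [Policy.block_zero, norm_zero]
  positivity

/-- The natural gradient cannot be small on all of the policy set. -/
theorem Setting.le_muInv (h : Setting A B Kst κ κB γ ν σ W)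
    (hc : ∀ t < T, CostClass (cs t) α G) (hT : 0 < T) (hH : 0 < H) (hdx : 0 < dx) (hdu : 0 < du) :
    α ≤ 12 * κ ^ 4 * κB * γ⁻¹ * dx * muInv H ν A B Kst cs κ κB γ T := by
  have hκ := h.one_le_κ
  have hκB := h.one_le_κB
  have hg := h.one_le_inv_γ
  have hmu := muInv_nonneg (H := H) (ν := ν) (A := A) (B := B) (Kst := Kst) (cs := cs) (κ := κ)
    (κB := κB) (γ := γ) (T := T)
  have hdx1 : (1 : ℝ) ≤ dx := by exact_mod_cast hdx
  set τ := ∫ w, ‖w‖ ^ 2 ∂ν with hτ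
  -- a coordinate that carries a fair share of the noise
  obtain ⟨b, hb⟩ : ∃ b : Fin dx, τ ≤ dx * ∫ w, w b ^ 2 ∂ν := by
    have hsum : τ = ∑ b : Fin dx, ∫ w, w b ^ 2 ∂ν := by
      rw [hτ, ← integral_finsetSum _ fun b _ => h.noise.integrable (by fun_prop)]
      simp_rw [EuclideanSpace.real_norm_sq_eq]
    have : Nonempty (Fin dx) := ⟨⟨0, hdx⟩⟩
    obtain ⟨b, -, hb⟩ := Finset.exists_max_image Finset.univ
      (fun b : Fin dx => ∫ w, w b ^ 2 ∂ν) Finset.univ_nonempty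
    refine ⟨b, ?_⟩
    rw [hsum]
    simpa using Finset.sum_le_card_nsmul Finset.univ _ _ hb
  have hw : σ ^ 2 ≤ ∫ w, w b ^ 2 ∂ν := by
    simpa [Pi.single_apply] using h.noise.sq_mul_le_integral_sq (Pi.single b 1)
  have hτ0 : 0 < τ := by
    have h1 : τ ≥ ∫ w, w b ^ 2 ∂ν := by
      refine integral_mono (h.noise.integrable (by fun_prop)) (h.noise.integrable (by fun_prop))
        fun w => ?_
      simp only [EuclideanSpace.real_norm_sq_eq]
      exact Finset.single_le_sum (f := fun b => w b ^ 2) (fun _ _ => sq_nonneg _)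
        (Finset.mem_univ b)
    have := pow_pos h.σ_pos 2
    linarith
  -- A single unit entry in the first block, reading the coordinate `b`. It belongs to `𝓜` because
  -- `κ³ κ_B (1 - γ) ≥ 1`.
  set Δ : Policy H dx du := EuclideanSpace.single (⟨0, hH⟩, ⟨0, hdu⟩, b) 1 with hΔ
  have hΔapp : ∀ (k : Fin H) (w : Vec dx), ‖app (Δ.block k) w‖ ^ 2
      = if k = ⟨0, hH⟩ then w b ^ 2 else 0 := by
    intro k w
    rw [EuclideanSpace.real_norm_sq_eq, Finset.sum_eq_single ⟨0, hdu⟩]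
    · rw [app_apply, Finset.sum_eq_single b]
      · by_cases hk : k = ⟨0, hH⟩
        · simp [hΔ, Policy.block_apply, hk]
        · simp [hΔ, Policy.block_apply, hk]
      · intro b' _ hb'
        simp [hΔ, Policy.block_apply, hb']
      · simp
    · intro a _ ha
      rw [app_apply, Finset.sum_eq_zero, zero_pow two_ne_zero]
      intro b' _
      simp [hΔ, Policy.block_apply, ha]
    · simp
  have hΔmem : Δ ∈ policySet H dx du κ κB γ := by
    intro k
    have hρ : 0 ≤ 1 - γ := by linarith [h.γ_lt_one]
    have hnn : 0 ≤ κ ^ 3 * κB * (1 - γ) ^ ((k : ℕ) + 1) := by positivity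
    refine opNorm_le_of_app _ hnn fun w => ?_
    refine le_of_sq_le_sq ?_ (by positivity)
    rw [hΔapp]
    split_ifs with hk
    · have h1 : w b ^ 2 ≤ ‖w‖ ^ 2 := by
        rw [EuclideanSpace.real_norm_sq_eq]
        exact Finset.single_le_sum (f := fun b => w b ^ 2) (fun _ _ => sq_nonneg _)
          (Finset.mem_univ b)
      have h2 : 1 ≤ κ ^ 3 * κB * (1 - γ) ^ ((k : ℕ) + 1) := by
        have h3 : 1 ≤ κ ^ 3 := one_le_pow₀ hκ
        have h4 := h.two_le
        subst hk
        simp only [zero_add, pow_one]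
        nlinarith
      refine h1.trans (pow_le_pow_left₀ (norm_nonneg _) ?_ 2)
      exact le_mul_of_one_le_left (norm_nonneg _) h2
    · positivity
  have hΔenergy : τ ≤ dx * Δ.energy ν := by
    rw [Policy.energy]
    simp_rw [hΔapp]
    rw [Finset.sum_eq_single ⟨0, hH⟩]
    · simpa using hb
    · intro k _ hk
      simp [hk]
    · simp
  set q := √(weightedSq (gram H ν A B Kst) Δ) with hq
  -- This lower bound on `q = ‖Δ‖_P` eliminates the factor `√τ` of the gradient bound below, so that
  -- neither `W` nor `σ` remains in the constant.
  have hqlow : √τ ≤ dx * (2 * κ * q) := by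
    calc √τ ≤ √(dx ^ 2 * Δ.energy ν) := by
          refine Real.sqrt_le_sqrt (hΔenergy.trans ?_)
          have := Δ.energy_nonneg (ν := ν)
          gcongr
          exact le_self_pow₀ hdx1 (by norm_num)
      _ = dx * √(Δ.energy ν) := by rw [Real.sqrt_mul (by positivity), Real.sqrt_sq (by positivity)]
      _ ≤ _ := by
          gcongr
          exact h.sqrt_energy_le Δ
  have hq0 : 0 < q := by
    have h1 : 0 < √τ := Real.sqrt_pos.2 hτ0
    by_contra hcon
    have h2 : q ≤ 0 := not_lt.1 hcon
    have h3 : (dx : ℝ) * (2 * κ * q) ≤ 0 :=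
      mul_nonpos_of_nonneg_of_nonpos (by positivity)
        (mul_nonpos_of_nonneg_of_nonpos (by positivity) h2)
    linarith
  have hgrad : ∀ M ∈ policySet H dx du κ κB γ,
      |inner ℝ (gradient (surrogateCost ν A B Kst (cs 0)) M) Δ|
        ≤ q * (3 * κ ^ 3 * κB * γ⁻¹ * √τ * muInv H ν A B Kst cs κ κB γ T) := by
    intro M hM
    rw [← h.weightedInner_naturalGradient]
    refine (abs_weightedInner_le gram_isSymm h.noise.weightedSq_gram_nonneg _ _).trans ?_
    refine mul_le_mul_of_nonneg_left ((h.sqrt_weightedSq_le _).trans ?_) hq0.le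
    refine mul_le_mul_of_nonneg_left (h.norm_naturalGradient_le_muInv hc hT hM) ?_
    positivity
  have h0mem : (0 : Policy H dx du) ∈ policySet H dx du κ κB γ :=
    zero_mem_policySet (by linarith) (by linarith) h.γ_lt_one.le
  -- Adding the strong convexity inequalities in both directions gives `α ‖Δ‖²_P ≤ ⟨∇f(Δ) - ∇f(0),
  -- Δ⟩`.
  have hs1 := h.noise.add_inner_gradient_add_le (A := A) (B := B) (Kst := Kst) (hc 0 hT) 0 Δ
  have hs2 := h.noise.add_inner_gradient_add_le (A := A) (B := B) (Kst := Kst) (hc 0 hT) Δ 0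
  rw [← h.noise.weightedSq_gram, sub_zero] at hs1
  rw [← h.noise.weightedSq_gram, weightedSq_sub_comm, sub_zero, zero_sub, inner_neg_right] at hs2
  have hqq : weightedSq (gram H ν A B Kst) Δ = q * q :=
    (Real.mul_self_sqrt (h.noise.weightedSq_gram_nonneg Δ)).symm
  rw [hqq] at hs1 hs2
  have hg0 := (abs_le.1 (hgrad 0 h0mem)).1
  have hg1 := (abs_le.1 (hgrad Δ hΔmem)).2
  have hfin : q * (α * q) ≤ q * (2 * (3 * κ ^ 3 * κB * γ⁻¹ * √τ
      * muInv H ν A B Kst cs κ κB γ T)) := by linarith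
  have hfin2 := le_of_mul_le_mul_left hfin hq0
  have hfin3 : α * q ≤ (12 * κ ^ 4 * κB * γ⁻¹ * dx * muInv H ν A B Kst cs κ κB γ T) * q := by
    refine hfin2.trans ?_
    calc _ ≤ 2 * (3 * κ ^ 3 * κB * γ⁻¹ * (dx * (2 * κ * q))
          * muInv H ν A B Kst cs κ κB γ T) := by gcongr
      _ = _ := by ring
  exact le_of_mul_le_mul_right hfin3 hq0

end MuInv

end Gram

/-! ### Regret of the natural gradient iteration -/

theorem sum_range_inv_succ_le (T : ℕ) :
    ∑ t ∈ Finset.range T, ((t : ℝ) + 1)⁻¹ ≤ 1 + Real.log T := by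
  have h := harmonic_le_one_add_log T
  rw [harmonic] at h
  push_cast at h
  exact h

section Run

variable {A : Mat dx dx} {B : Mat dx du} {Kst : Mat du dx} {κ κB γ : ℝ} {ν : Measure (Vec dx)}
  {σ W : ℝ} {c : ℕ → Vec dx → Vec du → ℝ} {α G a : ℝ} {T : ℕ} {η : ℕ → ℝ}
  {M : ℕ → Policy H dx du}

theorem IsNaturalGradientRun.mem (hrun : IsNaturalGradientRun ν A B Kst c κ κB γ T η M) {t : ℕ}
    (ht : t ≤ T) : M t ∈ policySet H dx du κ κB γ := by
  cases t with
  | zero => exact hrun.1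
  | succ t => exact (hrun.2 t ht).1

/-- The Pythagorean inequality with `r = M t`, itself a point of `𝓜`: projecting does not lengthen
the step. -/
theorem IsNaturalGradientRun.weightedSq_step_le
    (hrun : IsNaturalGradientRun ν A B Kst c κ κB γ T η M) (hν : NoiseLaw ν σ W) {t : ℕ}
    (ht : t < T) : weightedSq (gram H ν A B Kst) (M (t + 1) - M t)
      ≤ η t ^ 2 * weightedSq (gram H ν A B Kst) (naturalGradient ν A B Kst (c t) (M t)) := by
  have h1 := (hrun.2 t ht).weightedSq_add_le gram_isSymm (convex_policySet κ κB γ)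
    (hrun.mem ht.le)
  have h2 := hν.weightedSq_gram_nonneg (A := A) (B := B) (Kst := Kst)
    (M (t + 1) - (M t - η t • naturalGradient ν A B Kst (c t) (M t)))
  rw [sub_sub_cancel, weightedSq_smul] at h1
  rw [weightedSq_sub_comm]
  linarith

theorem Setting.sqrt_step_le (h : Setting A B Kst κ κB γ ν σ W)
    (hc : ∀ t < T, CostClass (c t) α G) (hη : ∀ t, 0 ≤ η t)
    (hrun : IsNaturalGradientRun ν A B Kst c κ κB γ T η M) {t : ℕ} (ht : t < T) :
    √(weightedSq (gram H ν A B Kst) (M (t + 1) - M t))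
      ≤ η t * (3 * κ ^ 3 * κB * γ⁻¹ * W * muInv H ν A B Kst c κ κB γ T) := by
  have hκ := h.one_le_κ
  have hκB := h.one_le_κB
  have hg := h.one_le_inv_γ
  have hW := h.noise.bound_nonneg
  calc _ ≤ √(η t ^ 2 * weightedSq (gram H ν A B Kst) (naturalGradient ν A B Kst (c t) (M t))) :=
        Real.sqrt_le_sqrt (hrun.weightedSq_step_le h.noise ht)
    _ = η t * √(weightedSq (gram H ν A B Kst) (naturalGradient ν A B Kst (c t) (M t))) := by
        rw [Real.sqrt_mul (sq_nonneg _), Real.sqrt_sq (hη t)]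
    _ ≤ _ := by
        refine mul_le_mul_of_nonneg_left ((h.sqrt_weightedSq_le_bound _).trans ?_) (hη t)
        exact mul_le_mul_of_nonneg_left (h.norm_naturalGradient_le_muInv hc ht (hrun.mem ht.le))
          (by positivity)

/-- One step of the telescoping argument behind the logarithmic regret. -/
theorem Setting.two_mul_sub_le (h : Setting A B Kst κ κB γ ν σ W)
    (hc : ∀ t < T, CostClass (c t) α G) (hα : 0 < α) (ha : 1 ≤ a)
    (hrun : IsNaturalGradientRun ν A B Kst c κ κB γ T (fun t => a / (α * ((t : ℝ) + 1))) M)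
    {N : Policy H dx du} (hN : N ∈ policySet H dx du κ κB γ) {t : ℕ} (ht : t < T) :
    2 * (surrogateCost ν A B Kst (c t) (M t) - surrogateCost ν A B Kst (c t) N)
      ≤ a / (α * ((t : ℝ) + 1))
          * weightedSq (gram H ν A B Kst) (naturalGradient ν A B Kst (c t) (M t))
        + α / a * t * weightedSq (gram H ν A B Kst) (M t - N)
        - α / a * ((t : ℝ) + 1) * weightedSq (gram H ν A B Kst) (M (t + 1) - N) := by
  set η : ℝ := a / (α * ((t : ℝ) + 1)) with hη
  set n := naturalGradient ν A B Kst (c t) (M t) with hn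
  have hη0 : 0 < η := by positivity
  have h1 := (hrun.2 t ht).weightedSq_add_le gram_isSymm (convex_policySet κ κB γ) hN
  have h2 := h.noise.weightedSq_gram_nonneg (A := A) (B := B) (Kst := Kst)
    (M (t + 1) - (M t - η • n))
  have h3 : weightedSq (gram H ν A B Kst) (N - (M t - η • n))
      = weightedSq (gram H ν A B Kst) (N - M t)
        + 2 * η * weightedInner (gram H ν A B Kst) (N - M t) n
        + η ^ 2 * weightedSq (gram H ν A B Kst) n := by
    rw [← weightedSq_add_smul gram_isSymm]
    congr 1
    abel
  have h4 := h.noise.add_inner_gradient_add_le (A := A) (B := B) (Kst := Kst) (hc t ht) (M t) N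
  rw [← h.noise.weightedSq_gram, ← h.weightedInner_naturalGradient] at h4
  have h5 := h.noise.weightedSq_gram_nonneg (A := A) (B := B) (Kst := Kst) (N - M t)
  simp only [← hη, ← hn] at h1
  rw [weightedSq_sub_comm (M t), weightedSq_sub_comm (M (t + 1))]
  set q := weightedSq (gram H ν A B Kst) (N - M t)
  set q' := weightedSq (gram H ν A B Kst) (N - M (t + 1))
  set I := weightedInner (gram H ν A B Kst) (N - M t) n
  set w := weightedSq (gram H ν A B Kst) n
  have h6 : q' ≤ q + 2 * η * I + η ^ 2 * w := by linarith
  -- `1 / η_t` grows by `α / a` per round. Since `a ≥ 1`, this is at most `α` and is paid for by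
  -- strong convexity.
  have hη' : α / a * ((t : ℝ) + 1) = η⁻¹ := by rw [hη]; field_simp
  have h7 : η⁻¹ * q' ≤ η⁻¹ * q + 2 * I + η * w := by
    calc η⁻¹ * q' ≤ η⁻¹ * (q + 2 * η * I + η ^ 2 * w) := by gcongr
      _ = _ := by field_simp
  have h8 : η⁻¹ * q = α / a * t * q + α / a * q := by rw [← hη']; ring
  have h9 : α / a * q ≤ α * q := by
    gcongr
    exact div_le_self hα.le ha
  rw [hη']
  linarith

theorem Setting.regret_le (h : Setting A B Kst κ κB γ ν σ W)
    (hc : ∀ t < T, CostClass (c t) α G) (hT : 0 < T) (hα : 0 < α) (ha : 1 ≤ a)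
    (hrun : IsNaturalGradientRun ν A B Kst c κ κB γ T (fun t => a / (α * ((t : ℝ) + 1))) M)
    {N : Policy H dx du} (hN : N ∈ policySet H dx du κ κB γ) :
    ∑ t ∈ Finset.range T,
        (surrogateCost ν A B Kst (c t) (M t) - surrogateCost ν A B Kst (c t) N)
      ≤ a / α * (G * sizeBound κ κB γ W) *
        (3 * κ ^ 3 * κB * γ⁻¹ * W * muInv H ν A B Kst c κ κB γ T) * (1 + Real.log T) := by
  have hκ := h.one_le_κ
  have hκB := h.one_le_κB
  have hg := h.one_le_inv_γ
  have hW := h.noise.bound_nonneg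
  -- The weight of the distance to `N` is `α n / a`, which vanishes at `n = 0`; hence the starting
  -- policy and the diameter of `𝓜` do not enter.
  have htel : ∀ n ≤ T, 2 * ∑ t ∈ Finset.range n,
        (surrogateCost ν A B Kst (c t) (M t) - surrogateCost ν A B Kst (c t) N)
      ≤ ∑ t ∈ Finset.range n, a / (α * ((t : ℝ) + 1))
          * weightedSq (gram H ν A B Kst) (naturalGradient ν A B Kst (c t) (M t))
        - α / a * n * weightedSq (gram H ν A B Kst) (M n - N) := by
    intro n
    induction n with
    | zero => simp
    | succ n ih =>
      intro hn
      rw [Finset.sum_range_succ, Finset.sum_range_succ, mul_add]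
      have h1 := ih (by omega)
      have h2 := h.two_mul_sub_le hc hα ha hrun hN (t := n) (by omega)
      push_cast
      linarith
  have h1 := htel T le_rfl
  have h2 : 0 ≤ α / a * T * weightedSq (gram H ν A B Kst) (M T - N) := by
    have := h.noise.weightedSq_gram_nonneg (A := A) (B := B) (Kst := Kst) (M T - N)
    positivity
  set Λ := 3 * κ ^ 3 * κB * γ⁻¹ * W * muInv H ν A B Kst c κ κB γ T with hΛ
  have h3 : ∑ t ∈ Finset.range T, a / (α * ((t : ℝ) + 1))
          * weightedSq (gram H ν A B Kst) (naturalGradient ν A B Kst (c t) (M t))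
      ≤ ∑ t ∈ Finset.range T, a / α * (2 * G * sizeBound κ κB γ W) * Λ * ((t : ℝ) + 1)⁻¹ := by
    refine Finset.sum_le_sum fun t ht => ?_
    have ht' := Finset.mem_range.1 ht
    have hM := hrun.mem ht'.le
    have h4 := h.sqrt_weightedSq_naturalGradient_le (hc t ht') hM
    have h5 := (h.sqrt_weightedSq_le_bound (naturalGradient ν A B Kst (c t) (M t))).trans
      (mul_le_mul_of_nonneg_left (h.norm_naturalGradient_le_muInv hc ht' hM) (by positivity))
    -- The two factors `‖n_t‖_P` are bounded differently, by duality and by `μ⁻¹`, to keep the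
    -- regret linear in `μ⁻¹`.
    have h6 : weightedSq (gram H ν A B Kst) (naturalGradient ν A B Kst (c t) (M t))
        ≤ 2 * G * sizeBound κ κB γ W * Λ := by
      rw [← Real.mul_self_sqrt (h.noise.weightedSq_gram_nonneg _)]
      exact mul_le_mul h4 h5 (Real.sqrt_nonneg _) ((Real.sqrt_nonneg _).trans h4)
    calc _ ≤ a / (α * ((t : ℝ) + 1)) * (2 * G * sizeBound κ κB γ W * Λ) := by gcongr
      _ = _ := by rw [div_mul_eq_div_div]; ring
  rw [← Finset.mul_sum] at h3
  have hG := (hc 0 hT).gradBound_nonneg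
  have hD := h.sizeBound_nonneg
  have hΛ0 : 0 ≤ Λ := by
    have := muInv_nonneg (H := H) (ν := ν) (A := A) (B := B) (Kst := Kst) (cs := c) (κ := κ)
      (κB := κB) (γ := γ) (T := T)
    positivity
  have h7 : a / α * (2 * G * sizeBound κ κB γ W) * Λ * ∑ t ∈ Finset.range T, ((t : ℝ) + 1)⁻¹
      ≤ a / α * (2 * G * sizeBound κ κB γ W) * Λ * (1 + Real.log T) := by
    gcongr
    exact sum_range_inv_succ_le T
  linarith

end Run

/-! ### Closed-loop trajectories -/

/-- `x` is the closed loop of the feedback `-K x` with the extra control `v` and disturbances `w`,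
started at `0`. -/
structure IsClosedLoop (A : Mat dx dx) (B : Mat dx du) (K : Mat du dx) (w : ℕ → Vec dx)
    (x : ℕ → Vec dx) (v : ℕ → Vec du) : Prop where
  zero : x 0 = 0
  succ : ∀ t, x (t + 1) = app (A - B * K) (x t) + app B (v t) + w t

/-- The `H` disturbances before round `t`, extended by zero. -/
def past (H : ℕ) (w : ℕ → Vec dx) (t : ℕ) : Fin H → Vec dx :=
  fun i => if (i : ℕ) + 1 ≤ t then w (t - (i + 1)) else 0

/-- The `2 H + 1` disturbances before round `t`, listed backwards. -/
def lagged (H : ℕ) (w : ℕ → Vec dx) (t : ℕ) : Fin (2 * H + 1) → Vec dx :=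
  fun i => w (t - 1 - i)

section Path

variable {A : Mat dx dx} {B : Mat dx du} {K : Mat du dx} {w x : ℕ → Vec dx} {v : ℕ → Vec du}

theorem IsClosedLoop.unroll (h : IsClosedLoop A B K w x v) (n t : ℕ) :
    x (t + n) = ∑ j ∈ Finset.range n, app ((A - B * K) ^ j)
      (app B (v (t + n - 1 - j)) + w (t + n - 1 - j)) + app ((A - B * K) ^ n) (x t) := by
  induction n with
  | zero => simp
  | succ n ih =>
    rw [← add_assoc, h.succ, ih, Finset.sum_range_succ', app_add, app_sum, ← mul_app, ← pow_succ']
    simp only [pow_zero, one_app, Nat.sub_zero, Nat.add_sub_cancel]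
    have : ∀ j ∈ Finset.range n, app (A - B * K) (app ((A - B * K) ^ j)
        (app B (v (t + n - 1 - j)) + w (t + n - 1 - j)))
        = app ((A - B * K) ^ (j + 1)) (app B (v (t + n - (j + 1))) + w (t + n - (j + 1))) := by
      intro j _
      rw [← mul_app, ← pow_succ', show t + n - 1 - j = t + n - (j + 1) by omega]
    rw [Finset.sum_congr rfl this]
    abel

theorem IsClosedLoop.eq_sum (h : IsClosedLoop A B K w x v) (t : ℕ) :
    x t = ∑ j ∈ Finset.range t, app ((A - B * K) ^ j)
      (app B (v (t - 1 - j)) + w (t - 1 - j)) := by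
  have := h.unroll t 0
  rwa [h.zero, app_zero, add_zero, zero_add] at this

theorem norm_past_le {W : ℝ} (hw : ∀ s, ‖w s‖ ≤ W) (t : ℕ) (k : Fin H) : ‖past H w t k‖ ≤ W := by
  unfold past
  split_ifs
  · exact hw _
  · rw [norm_zero]
    exact (norm_nonneg _).trans (hw 0)

/-- From round `2 H + 1` on, all lags lie at nonnegative times: neither truncated subtraction nor
the zero extension in `past` plays a role. -/
theorem window_lagged {t : ℕ} (ht : 2 * H + 1 ≤ t) (j : Fin (H + 1)) :
    window (lagged H w t) j = past H w (t - 1 - j) := by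
  funext k
  unfold window lagged past
  rw [if_pos (by omega)]
  congr 1
  simp only
  omega

theorem recent_lagged {t : ℕ} (ht : 2 * H + 1 ≤ t) : recent (lagged H w t) = past H w t := by
  funext k
  unfold recent lagged past
  rw [if_pos (by omega)]
  congr 1
  simp only [Fin.val_castLE]
  omega

theorem surrogateState_lagged {t : ℕ} (ht : 2 * H + 1 ≤ t) (N : Policy H dx du) :
    surrogateState A B K N (lagged H w t) = ∑ j ∈ Finset.range (H + 1), app ((A - B * K) ^ j)
      (app B (N.act (past H w (t - 1 - j))) + w (t - 1 - j)) := by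
  rw [surrogateState_eq, Finset.sum_range]
  refine Finset.sum_congr rfl fun j _ => ?_
  rw [window_lagged ht]
  rfl

variable {κ κB γ : ℝ}

/-- The distance between the trajectory and the surrogate of a fixed policy, in terms of the
deviations of the extra controls. -/
theorem IsClosedLoop.norm_sub_surrogate_le (h : IsClosedLoop A B K w x v)
    (hK : DiagStronglyStable A B κ γ K) (hκ : 1 ≤ κ) (hB : ‖B‖ ≤ κB) (hγ : 0 < γ) (hγ1 : γ < 1)
    {t : ℕ} (ht : 2 * H + 1 ≤ t) (N : Policy H dx du) :
    ‖x t - surrogateState A B K N (lagged H w t)‖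
        + ‖(- app K (x t) + v t) - surrogateAction A B K N (lagged H w t)‖
      ≤ 2 * κ ^ 3 * κB * ∑ j ∈ Finset.range (H + 1),
          (1 - γ) ^ j * ‖v (t - 1 - j) - N.act (past H w (t - 1 - j))‖
        + 2 * κ ^ 3 * (1 - γ) ^ H * ‖x (t - 1 - H)‖ + ‖v t - N.act (past H w t)‖ := by
  have hρ : 0 ≤ 1 - γ := by linarith
  have hκB : 0 ≤ κB := (norm_nonneg _).trans hB
  set S := ∑ j ∈ Finset.range (H + 1),
    (1 - γ) ^ j * ‖v (t - 1 - j) - N.act (past H w (t - 1 - j))‖ with hS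
  have hS0 : 0 ≤ S := Finset.sum_nonneg fun j _ => by positivity
  have hx : ‖x t - surrogateState A B K N (lagged H w t)‖
      ≤ κ ^ 2 * κB * S + κ ^ 2 * (1 - γ) ^ H * ‖x (t - 1 - H)‖ := by
    -- Unrolling `H + 1` steps matches the surrogate term by term and leaves the contribution of the
    -- old state `x (t - 1 - H)`.
    have h1 := h.unroll (H + 1) (t - 1 - H)
    rw [show t - 1 - H + (H + 1) = t by omega] at h1
    rw [h1, surrogateState_lagged ht, add_sub_right_comm, ← Finset.sum_sub_distrib]
    refine (norm_add_le _ _).trans (add_le_add ?_ ?_)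
    · rw [hS, Finset.mul_sum]
      refine norm_sum_le_of_le _ fun j _ => ?_
      rw [← app_sub, add_sub_add_right_eq_sub, ← app_sub]
      calc _ ≤ ‖(A - B * K) ^ j‖ * (‖B‖ * ‖v (t - 1 - j) - N.act (past H w (t - 1 - j))‖) :=
            (norm_app_le _ _).trans (by gcongr; exact norm_app_le _ _)
        _ ≤ (κ ^ 2 * (1 - γ) ^ j) * (κB * ‖v (t - 1 - j) - N.act (past H w (t - 1 - j))‖) := by
            gcongr
            exact hK.norm_pow_le (by linarith) _
        _ = _ := by ring
    · refine (norm_app_le _ _).trans ?_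
      gcongr
      refine (hK.norm_pow_le (by linarith) _).trans ?_
      gcongr ?_ * ?_
      exact pow_le_pow_of_le_one hρ (by linarith) (by omega)
  have hu : ‖(- app K (x t) + v t) - surrogateAction A B K N (lagged H w t)‖
      ≤ κ * ‖x t - surrogateState A B K N (lagged H w t)‖ + ‖v t - N.act (past H w t)‖ := by
    rw [surrogateAction_eq, recent_lagged ht, show (- app K (x t) + v t) -
      (- app K (surrogateState A B K N (lagged H w t)) + N.act (past H w t))
      = - app K (x t - surrogateState A B K N (lagged H w t)) + (v t - N.act (past H w t)) by
        rw [app_sub]; abel]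
    refine (norm_add_le _ _).trans (add_le_add ?_ le_rfl)
    rw [norm_neg]
    exact (norm_app_le _ _).trans (by gcongr; exact hK.norm_le)
  have hpos : 0 ≤ κ ^ 2 * κB * S + κ ^ 2 * (1 - γ) ^ H * ‖x (t - 1 - H)‖ := by positivity
  calc _ ≤ (1 + κ) * ‖x t - surrogateState A B K N (lagged H w t)‖
        + ‖v t - N.act (past H w t)‖ := by linarith
    _ ≤ (2 * κ) * (κ ^ 2 * κB * S + κ ^ 2 * (1 - γ) ^ H * ‖x (t - 1 - H)‖)
        + ‖v t - N.act (past H w t)‖ := by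
        gcongr
        linarith
    _ = _ := by ring

/-! #### The learner -/

theorem policyController_apply (M : ℕ → Policy H dx du) (t : ℕ) (y : Vec dx) :
    policyController K M t y w = - app K y + (M t).act (past H w t) := by
  unfold policyController Policy.act past
  congr 1
  refine Finset.sum_congr rfl fun i _ => ?_
  split_ifs <;> simp

theorem isClosedLoop_policyController (M : ℕ → Policy H dx du) :
    IsClosedLoop A B K w (state A B (policyController K M) w)
      (fun t => (M t).act (past H w t)) where
  zero := rfl
  succ t := by
    rw [state, policyController_apply, sub_app, mul_app, app_add, app_neg]
    abel

/-! #### The comparator -/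

/-- Written as the feedback `K` with extra control `(K - K') x`, the comparator falls under the same
deviation estimate as the learner. -/
theorem isClosedLoop_linearController (K' : Mat du dx) :
    IsClosedLoop A B K w (state A B (linearController K') w)
      (fun t => app (K - K') (state A B (linearController K') w t)) where
  zero := rfl
  succ t := by
    rw [state, linearController, sub_app, mul_app, sub_app, app_sub, app_neg]
    abel

theorem isClosedLoop_linearController_self :
    IsClosedLoop A B K w (state A B (linearController K) w) 0 where
  zero := rfl
  succ t := by
    rw [state, linearController, sub_app, mul_app, app_neg, Pi.zero_apply, app_zero]
    abel

/-- The disturbance-action policy imitating the linear controller `K'`. -/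
noncomputable def comparator (H : ℕ) (A : Mat dx dx) (B : Mat dx du) (K K' : Mat du dx) :
    Policy H dx du :=
  WithLp.toLp 2 fun p => ((K - K') * (A - B * K') ^ (p.1 : ℕ)) p.2.1 p.2.2

theorem comparator_block (K' : Mat du dx) (i : Fin H) :
    (comparator H A B K K').block i = (K - K') * (A - B * K') ^ (i : ℕ) := rfl

/-- The blocks have norm at most `2 κ³ (1 - γ)^i`; the assumption `2 ≤ κ_B (1 - γ)` trades the
constant for the missing power of `1 - γ`. -/
theorem comparator_mem_policySet (hK : DiagStronglyStable A B κ γ K) {K' : Mat du dx}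
    (hK' : DiagStronglyStable A B κ γ K') (hκ : 1 ≤ κ) (hγ1 : γ < 1) (h2 : 2 ≤ κB * (1 - γ)) :
    comparator H A B K K' ∈ policySet H dx du κ κB γ := by
  intro i
  have hρ : 0 ≤ 1 - γ := by linarith
  rw [comparator_block]
  calc _ ≤ ‖K - K'‖ * ‖(A - B * K') ^ (i : ℕ)‖ := Matrix.l2_opNorm_mul _ _
    _ ≤ (κ + κ) * (κ ^ 2 * (1 - γ) ^ (i : ℕ)) := by
        gcongr
        · exact (norm_sub_le _ _).trans (add_le_add hK.norm_le hK'.norm_le)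
        · exact hK'.norm_pow_le (by linarith) _
    _ = 2 * (κ ^ 3 * (1 - γ) ^ (i : ℕ)) := by ring
    _ ≤ (κB * (1 - γ)) * (κ ^ 3 * (1 - γ) ^ (i : ℕ)) := by gcongr
    _ = _ := by ring

/-- The policy reproduces `K - K'` applied to the last `H` terms of the unrolled state, so only the
image of the state `H` rounds earlier is left. -/
theorem norm_comparator_deviation_le (hK : DiagStronglyStable A B κ γ K) {K' : Mat du dx}
    (hK' : DiagStronglyStable A B κ γ K') (hκ : 1 ≤ κ) (hγ1 : γ < 1) {s : ℕ} (hs : H ≤ s) {D : ℝ}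
    (hD : ‖state A B (linearController K') w (s - H)‖ ≤ D) :
    ‖app (K - K') (state A B (linearController K') w s)
        - (comparator H A B K K').act (past H w s)‖ ≤ 2 * κ ^ 3 * (1 - γ) ^ H * D := by
  have hρ : 0 ≤ 1 - γ := by linarith
  have h1 := (isClosedLoop_linearController_self (A := A) (B := B) (K := K') (w := w)).unroll
    H (s - H)
  rw [Nat.sub_add_cancel hs] at h1
  have h2 : (comparator H A B K K').act (past H w s) = app (K - K')
      (∑ j ∈ Finset.range H, app ((A - B * K') ^ j)
        (app B ((0 : ℕ → Vec du) (s - 1 - j)) + w (s - 1 - j))) := by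
    rw [Policy.act, app_sum, Finset.sum_range]
    refine Finset.sum_congr rfl fun j _ => ?_
    rw [comparator_block, mul_app, past, if_pos (by omega), Pi.zero_apply, app_zero, zero_add,
      show s - ((j : ℕ) + 1) = s - 1 - j by omega]
  rw [h2, h1, ← app_sub, add_sub_cancel_left]
  calc _ ≤ ‖K - K'‖ * (‖(A - B * K') ^ H‖ * ‖state A B (linearController K') w (s - H)‖) :=
        (norm_app_le _ _).trans (by gcongr; exact norm_app_le _ _)
    _ ≤ (κ + κ) * ((κ ^ 2 * (1 - γ) ^ H) * D) := by
        gcongr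
        · exact (norm_sub_le _ _).trans (add_le_add hK.norm_le hK'.norm_le)
        · exact hK'.norm_pow_le (by linarith) _
    _ = _ := by ring

end Path

/-! #### Sizes along trajectories -/

section TrajectorySize

variable {A : Mat dx dx} {B : Mat dx du} {Kst : Mat du dx} {κ κB γ : ℝ} {ν : Measure (Vec dx)}
  {σ W : ℝ} {w : ℕ → Vec dx}

theorem Setting.policy_trajectory_le (h : Setting A B Kst κ κB γ ν σ W) (hw : ∀ s, ‖w s‖ ≤ W)
    {M : ℕ → Policy H dx du} {t : ℕ} (hM : ∀ s ≤ t, M s ∈ policySet H dx du κ κB γ) :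
    ‖state A B (policyController Kst M) w t‖ ≤ sizeBound κ κB γ W ∧
      ‖policyController Kst M t (state A B (policyController Kst M) w t) w‖
        ≤ sizeBound κ κB γ W := by
  rw [policyController_apply]
  have hact : ∀ s ≤ t, ‖(M s).act (past H w s)‖ ≤ κ ^ 3 * κB * γ⁻¹ * W := fun s hs =>
    Policy.norm_act_le (hM s hs) h.one_le_κ h.one_le_κB h.γ_pos h.γ_lt_one h.noise.bound_nonneg
      (norm_past_le hw s)
  exact h.stable.norm_le_sizeBound h.one_le_κ h.one_le_κB h.norm_B_le h.γ_pos h.γ_lt_one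
    h.noise.bound_nonneg (fun j hj => hact (t - 1 - j) (by omega)) (fun j _ => hw (t - 1 - j))
    (hact t le_rfl) ((isClosedLoop_policyController M).eq_sum t)

theorem Setting.linear_trajectory_le (h : Setting A B Kst κ κB γ ν σ W) (hw : ∀ s, ‖w s‖ ≤ W)
    {K : Mat du dx} (hK : DiagStronglyStable A B κ γ K) (t : ℕ) :
    ‖state A B (linearController K) w t‖ ≤ sizeBound κ κB γ W ∧
      ‖linearController K t (state A B (linearController K) w t) w‖ ≤ sizeBound κ κB γ W := by
  have hκ := h.one_le_κ
  have hκB := h.one_le_κB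
  have hg := h.one_le_inv_γ
  have hW := h.noise.bound_nonneg
  have h0 : ‖(0 : Vec du)‖ ≤ κ ^ 3 * κB * γ⁻¹ * W := by
    rw [norm_zero]
    positivity
  have := hK.norm_le_sizeBound h.one_le_κ h.one_le_κB h.norm_B_le h.γ_pos h.γ_lt_one
    h.noise.bound_nonneg (fun j _ => h0) (fun j _ => hw (t - 1 - j)) h0
    ((isClosedLoop_linearController_self (K := K)).eq_sum t)
  rwa [add_zero] at this

end TrajectorySize

/-! ### Random trajectories -/

/-- For the early rounds: their surrogate regret is part of the telescoped sum, may be negative, and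
has to be compensated. -/
theorem Setting.surrogateCost_sub_le {A : Mat dx dx} {B : Mat dx du} {Kst : Mat du dx}
    {κ κB γ : ℝ} {ν : Measure (Vec dx)} {σ W : ℝ} {c : Vec dx → Vec du → ℝ} {α G : ℝ}
    (h : Setting A B Kst κ κB γ ν σ W) (hc : CostClass c α G) (hα : 0 < α)
    {N N' : Policy H dx du} (hN : N ∈ policySet H dx du κ κB γ)
    (hN' : N' ∈ policySet H dx du κ κB γ) :
    surrogateCost ν A B Kst c N - surrogateCost ν A B Kst c N'
      ≤ 4 * (G * sizeBound κ κB γ W ^ 2) := by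
  have hp := h.noise.isProb
  have hG := hc.gradBound_nonneg
  have hD := h.sizeBound_nonneg
  have h1 := h.noise.integrable_pairCost (A := A) (B := B) (Kst := Kst) hc N
  have h2 := h.noise.integrable_pairCost (A := A) (B := B) (Kst := Kst) hc N'
  rw [surrogateCost_eq, surrogateCost_eq, ← integral_sub h1 h2]
  calc _ ≤ ∫ _, 4 * (G * sizeBound κ κB γ W ^ 2) ∂(Measure.pi fun _ : Fin (2 * H + 1) => ν) := by
        refine integral_mono_ae (h1.sub h2) (integrable_const _) ?_
        filter_upwards [h.noise.ae_pi_bounded] with ξ hξ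
        obtain ⟨hy, hv⟩ := h.stable.surrogate_le_sizeBound h.one_le_κ h.one_le_κB h.norm_B_le
          h.γ_pos h.γ_lt_one h.noise.bound_nonneg hN hξ
        obtain ⟨hy', hv'⟩ := h.stable.surrogate_le_sizeBound h.one_le_κ h.one_le_κB h.norm_B_le
          h.γ_pos h.γ_lt_one h.noise.bound_nonneg hN' hξ
        refine (hc.sub_le hα.le hy hv _ _).trans ?_
        calc _ ≤ G * sizeBound κ κB γ W * ((sizeBound κ κB γ W + sizeBound κ κB γ W)
              + (sizeBound κ κB γ W + sizeBound κ κB γ W)) := by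
              gcongr
              · exact (norm_sub_le _ _).trans (add_le_add hy hy')
              · exact (norm_sub_le _ _).trans (add_le_add hv hv')
          _ = _ := by ring
    _ = _ := by simp

section Random

variable {Ω : Type*} [MeasurableSpace Ω] {P : Measure Ω} {w : ℕ → Ω → Vec dx}
  {A : Mat dx dx} {B : Mat dx du} {Kst K : Mat du dx} {κ κB γ : ℝ} {ν : Measure (Vec dx)}
  {σ W : ℝ} {M : ℕ → Policy H dx du}

theorem measurable_past (hw : ∀ t, Measurable (w t)) (t : ℕ) :
    Measurable fun ω => past H (fun s => w s ω) t := by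
  refine measurable_pi_iff.2 fun i => ?_
  unfold past
  split_ifs
  · exact hw _
  · exact measurable_const

theorem measurable_act_past (hw : ∀ t, Measurable (w t)) (N : Policy H dx du) (t : ℕ) :
    Measurable fun ω => N.act (past H (fun s => w s ω) t) :=
  (N.continuous_act continuous_id).measurable.comp (measurable_past hw t)

theorem measurable_lagged (hw : ∀ t, Measurable (w t)) (t : ℕ) :
    Measurable fun ω => lagged H (fun s => w s ω) t :=
  measurable_pi_iff.2 fun _ => hw _

theorem measurable_state_policyController (hw : ∀ t, Measurable (w t)) (t : ℕ) :
    Measurable fun ω => state A B (policyController Kst M) (fun s => w s ω) t := by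
  induction t with
  | zero => exact measurable_const
  | succ t ih =>
    have h1 := measurable_act_past hw (M t) t
    have h2 := hw t
    simp only [state, policyController_apply]
    fun_prop

theorem measurable_policyController (hw : ∀ t, Measurable (w t)) (t : ℕ) :
    Measurable fun ω => policyController Kst M t
      (state A B (policyController Kst M) (fun s => w s ω) t) (fun s => w s ω) := by
  have h1 := measurable_act_past hw (M t) t
  have h2 := measurable_state_policyController (A := A) (B := B) (Kst := Kst) (M := M) hw t
  simp only [policyController_apply]
  fun_prop

theorem measurable_state_linearController (hw : ∀ t, Measurable (w t)) (t : ℕ) :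
    Measurable fun ω => state A B (linearController K) (fun s => w s ω) t := by
  induction t with
  | zero => exact measurable_const
  | succ t ih =>
    have h2 := hw t
    simp only [state, linearController]
    fun_prop

theorem NoiseLaw.ae_forall_bounded (h : NoiseLaw ν σ W) (hw : ∀ t, Measurable (w t))
    (hlaw : ∀ t, P.map (w t) = ν) : ∀ᵐ ω ∂P, ∀ s, ‖w s ω‖ ≤ W :=
  ae_all_iff.2 fun s => h.ae_bounded_of_map (hw s) (hlaw s)

theorem map_lagged_eq_pi (hw : ∀ t, Measurable (w t)) (hlaw : ∀ t, P.map (w t) = ν)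
    (hind : iIndepFun w P) {t : ℕ} (ht : 2 * H + 1 ≤ t) :
    P.map (fun ω => lagged H (fun s => w s ω) t) = Measure.pi fun _ : Fin (2 * H + 1) => ν := by
  have hinj : Function.Injective fun i : Fin (2 * H + 1) => t - 1 - (i : ℕ) := by
    intro i j hij
    simp only at hij
    exact Fin.ext (by omega)
  have h1 := hind.precomp hinj
  have h2 := h1.map_fun_eq_pi_map (fun i => (hw _).aemeasurable)
  simp only [hlaw] at h2
  exact h2

/-- Realizing the surrogate with the disturbances of the actual trajectory puts both on one
probability space, where they can be compared path by path. -/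
theorem surrogateCost_eq_integral_lagged {c : Vec dx → Vec du → ℝ} {α G : ℝ}
    (hc : CostClass c α G) (hw : ∀ t, Measurable (w t)) (hlaw : ∀ t, P.map (w t) = ν)
    (hind : iIndepFun w P) {t : ℕ} (ht : 2 * H + 1 ≤ t) (N : Policy H dx du) :
    surrogateCost ν A B Kst c N
      = ∫ ω, c (surrogateState A B Kst N (lagged H (fun s => w s ω) t))
          (surrogateAction A B Kst N (lagged H (fun s => w s ω) t)) ∂P := by
  rw [surrogateCost_eq, ← map_lagged_eq_pi hw hlaw hind ht,
    integral_map (measurable_lagged hw t).aemeasurable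
      (f := fun ξ => pairCost c (surrogatePair A B Kst N ξ))
      (hc.continuous_pairCost.comp (continuous_surrogatePair A B Kst N)).aestronglyMeasurable]
  rfl

theorem Setting.ae_policy_trajectory_le (h : Setting A B Kst κ κB γ ν σ W)
    (hw : ∀ t, Measurable (w t)) (hlaw : ∀ t, P.map (w t) = ν) {t : ℕ}
    (hM : ∀ s ≤ t, M s ∈ policySet H dx du κ κB γ) :
    ∀ᵐ ω ∂P, ‖state A B (policyController Kst M) (fun s => w s ω) t‖ ≤ sizeBound κ κB γ W ∧
      ‖policyController Kst M t (state A B (policyController Kst M) (fun s => w s ω) t)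
        (fun s => w s ω)‖ ≤ sizeBound κ κB γ W := by
  filter_upwards [h.noise.ae_forall_bounded hw hlaw] with ω hω
  exact h.policy_trajectory_le hω hM

theorem Setting.ae_linear_trajectory_le (h : Setting A B Kst κ κB γ ν σ W)
    (hw : ∀ t, Measurable (w t)) (hlaw : ∀ t, P.map (w t) = ν)
    (hK : DiagStronglyStable A B κ γ K) (t : ℕ) :
    ∀ᵐ ω ∂P, ‖state A B (linearController K) (fun s => w s ω) t‖ ≤ sizeBound κ κB γ W ∧
      ‖linearController K t (state A B (linearController K) (fun s => w s ω) t)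
        (fun s => w s ω)‖ ≤ sizeBound κ κB γ W := by
  filter_upwards [h.noise.ae_forall_bounded hw hlaw] with ω hω
  exact h.linear_trajectory_le hω hK t

variable [IsProbabilityMeasure P]

theorem NoiseLaw.integrable_act_past (h : NoiseLaw ν σ W) (hw : ∀ t, Measurable (w t))
    (hlaw : ∀ t, P.map (w t) = ν) (N : Policy H dx du) (t : ℕ) {F : Type*}
    [NormedAddCommGroup F] {g : Vec du → F} (hg : Continuous g) :
    Integrable (fun ω => g (N.act (past H (fun s => w s ω) t))) P := by
  refine integrable_comp_of_ae_bounded (g := fun ζ => g (N.act ζ)) (measurable_past hw t)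
    (R := W) ?_ (hg.comp (N.continuous_act continuous_id))
  filter_upwards [h.ae_forall_bounded hw hlaw] with ω hω
  exact (pi_norm_le_iff_of_nonneg h.bound_nonneg).2 (norm_past_le hω t)

/-- For `t ≥ H` the disturbances read are distinct and none is replaced by zero, so the second
moment is exactly the energy. -/
theorem NoiseLaw.integral_norm_act_past_le (h : NoiseLaw ν σ W) (hw : ∀ t, Measurable (w t))
    (hlaw : ∀ t, P.map (w t) = ν) (hind : iIndepFun w P) {t : ℕ} (ht : H ≤ t)
    (N : Policy H dx du) :
    ∫ ω, ‖N.act (past H (fun s => w s ω) t)‖ ∂P ≤ √(N.energy ν) := by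
  refine (integral_norm_le_sqrt (h.integrable_act_past hw hlaw N t continuous_norm)
    (h.integrable_act_past hw hlaw N t (continuous_norm.pow 2))).trans (le_of_eq ?_)
  have hinj : Function.Injective fun i : Fin H => t - ((i : ℕ) + 1) := by
    intro i j hij
    simp only at hij
    exact Fin.ext (by omega)
  rw [Policy.energy, ← h.integral_norm_sum_app_sq (X := fun i : Fin H => w (t - ((i : ℕ) + 1)))
    (fun i => hw _) (fun i => hlaw _) (hind.precomp hinj) N.block]
  congr 2
  funext ω
  rw [Policy.act]
  congr 2
  refine Finset.sum_congr rfl fun i _ => ?_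
  rw [past, if_pos (by omega)]

/-- The mean distance between a trajectory and the surrogate of a fixed policy. -/
theorem Setting.exists_deviation_bound (h : Setting A B Kst κ κB γ ν σ W)
    (hw : ∀ t, Measurable (w t)) (hlaw : ∀ t, P.map (w t) = ν)
    {x : ℕ → Ω → Vec dx} {v : ℕ → Ω → Vec du}
    (hloop : ∀ ω, IsClosedLoop A B Kst (fun s => w s ω) (fun s => x s ω) (fun s => v s ω))
    {t : ℕ} (ht : 2 * H + 1 ≤ t) {D : ℝ} (hD : ∀ᵐ ω ∂P, ‖x (t - 1 - H) ω‖ ≤ D)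
    (hv : ∀ s ≤ t, Integrable (v s) P) (N : Policy H dx du) {ε : ℝ}
    (hε : ∀ s, t - 1 - H ≤ s → s ≤ t →
      ∫ ω, ‖v s ω - N.act (past H (fun s => w s ω) s)‖ ∂P ≤ ε) :
    ∃ b : Ω → ℝ, Integrable b P ∧
      ∫ ω, b ω ∂P ≤ 3 * κ ^ 3 * κB * γ⁻¹ * ε + 2 * κ ^ 3 * (1 - γ) ^ H * D ∧
      ∀ᵐ ω ∂P, ‖x t ω - surrogateState A B Kst N (lagged H (fun s => w s ω) t)‖
        + ‖(- app Kst (x t ω) + v t ω)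
            - surrogateAction A B Kst N (lagged H (fun s => w s ω) t)‖ ≤ b ω := by
  have hκ := h.one_le_κ
  have hκB := h.one_le_κB
  have hg := h.one_le_inv_γ
  have hρ : 0 ≤ 1 - γ := by linarith [h.γ_lt_one]
  set e : ℕ → Ω → ℝ := fun s ω => ‖v s ω - N.act (past H (fun s => w s ω) s)‖ with he
  have heint : ∀ s ≤ t, Integrable (e s) P := fun s hs =>
    ((hv s hs).sub (h.noise.integrable_act_past hw hlaw N s continuous_id)).norm
  have hε0 : 0 ≤ ε := (integral_nonneg fun _ => norm_nonneg _).trans (hε t (by omega) le_rfl)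
  have hsum : Integrable (fun ω => ∑ j ∈ Finset.range (H + 1), (1 - γ) ^ j * e (t - 1 - j) ω) P :=
    integrable_finsetSum _ fun j _ => (heint _ (by omega)).const_mul _
  have hsum' : Integrable (fun ω => 2 * κ ^ 3 * κB * ∑ j ∈ Finset.range (H + 1),
      (1 - γ) ^ j * e (t - 1 - j) ω + 2 * κ ^ 3 * (1 - γ) ^ H * D) P :=
    (hsum.const_mul _).add (integrable_const _)
  -- The pathwise bound with the old state replaced by its bound `D`. An integrable majorant
  -- suffices to bound the cost differences later.
  refine ⟨fun ω => 2 * κ ^ 3 * κB * ∑ j ∈ Finset.range (H + 1), (1 - γ) ^ j * e (t - 1 - j) ω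
    + 2 * κ ^ 3 * (1 - γ) ^ H * D + e t ω, hsum'.add (heint t le_rfl), ?_, ?_⟩
  · rw [integral_add hsum' (heint t le_rfl), integral_add (hsum.const_mul _) (integrable_const _),
      integral_const_mul, integral_finsetSum _ fun j _ => (heint _ (by omega)).const_mul _]
    simp_rw [integral_const_mul]
    have h1 : ∑ j ∈ Finset.range (H + 1), (1 - γ) ^ j * ∫ ω, e (t - 1 - j) ω ∂P ≤ γ⁻¹ * ε := by
      calc _ ≤ ∑ j ∈ Finset.range (H + 1), (1 - γ) ^ j * ε := by
            refine Finset.sum_le_sum fun j hj => ?_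
            have := Finset.mem_range.1 hj
            gcongr
            exact hε _ (by omega) (by omega)
        _ ≤ _ := by
            rw [← Finset.sum_mul]
            gcongr
            exact sum_range_pow_le h.γ_pos h.γ_lt_one _
    have h2 := hε t (by omega) le_rfl
    have h3 : 1 * ε ≤ (κ ^ 3 * κB * γ⁻¹) * ε := by
      gcongr
      exact one_le_mul_of_one_le_of_one_le
        (one_le_mul_of_one_le_of_one_le (one_le_pow₀ hκ) hκB) hg
    have h4 : 2 * κ ^ 3 * κB * ∑ j ∈ Finset.range (H + 1), (1 - γ) ^ j * ∫ ω, e (t - 1 - j) ω ∂P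
        ≤ 2 * κ ^ 3 * κB * (γ⁻¹ * ε) := by gcongr
    simp only [integral_const, probReal_univ, smul_eq_mul, one_mul]
    linarith
  · filter_upwards [hD] with ω hω
    refine ((hloop ω).norm_sub_surrogate_le h.stable hκ h.norm_B_le h.γ_pos h.γ_lt_one ht
      N).trans ?_
    gcongr

/-! ### Integrability of the costs and a crude bound valid in every round. -/

section Rounds

variable {c : Vec dx → Vec du → ℝ} {α G : ℝ}

theorem CostClass.integrable_comp (hc : CostClass c α G) {x : Ω → Vec dx} {u : Ω → Vec du}
    (hx : Measurable x) (hu : Measurable u) {D : ℝ} (hD : ∀ᵐ ω ∂P, ‖x ω‖ ≤ D ∧ ‖u ω‖ ≤ D) :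
    Integrable (fun ω => c (x ω) (u ω)) P := by
  refine integrable_comp_of_ae_bounded (X := fun ω => (x ω, u ω)) (hx.prodMk hu) (R := D) ?_
    hc.continuous
  filter_upwards [hD] with ω hω
  exact max_le hω.1 hω.2

theorem Setting.integrable_policy_cost (h : Setting A B Kst κ κB γ ν σ W)
    (hc : CostClass c α G) (hw : ∀ t, Measurable (w t)) (hlaw : ∀ t, P.map (w t) = ν) {t : ℕ}
    (hM : ∀ s ≤ t, M s ∈ policySet H dx du κ κB γ) :
    Integrable (fun ω => c (state A B (policyController Kst M) (fun s => w s ω) t)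
      (policyController Kst M t (state A B (policyController Kst M) (fun s => w s ω) t)
        (fun s => w s ω))) P :=
  hc.integrable_comp (measurable_state_policyController hw t) (measurable_policyController hw t)
    (h.ae_policy_trajectory_le hw hlaw hM)

theorem Setting.integrable_linear_cost (h : Setting A B Kst κ κB γ ν σ W)
    (hc : CostClass c α G) (hw : ∀ t, Measurable (w t)) (hlaw : ∀ t, P.map (w t) = ν)
    (hK : DiagStronglyStable A B κ γ K) (t : ℕ) :
    Integrable (fun ω => c (state A B (linearController K) (fun s => w s ω) t)
      (linearController K t (state A B (linearController K) (fun s => w s ω) t)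
        (fun s => w s ω))) P := by
  refine hc.integrable_comp (measurable_state_linearController hw t) ?_
    (h.ae_linear_trajectory_le hw hlaw hK t)
  have := measurable_state_linearController (A := A) (B := B) (K := K) hw t
  unfold linearController at this ⊢
  fun_prop

/-- In any round, the learner loses at most a constant against the comparator. -/
theorem Setting.policy_sub_linear_le (h : Setting A B Kst κ κB γ ν σ W)
    (hc : CostClass c α G) (hα : 0 < α) (hw : ∀ t, Measurable (w t))
    (hlaw : ∀ t, P.map (w t) = ν) {t : ℕ} (hM : ∀ s ≤ t, M s ∈ policySet H dx du κ κB γ)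
    (hK : DiagStronglyStable A B κ γ K) :
    ∫ ω, c (state A B (policyController Kst M) (fun s => w s ω) t)
        (policyController Kst M t (state A B (policyController Kst M) (fun s => w s ω) t)
          (fun s => w s ω)) ∂P
      - ∫ ω, c (state A B (linearController K) (fun s => w s ω) t)
          (linearController K t (state A B (linearController K) (fun s => w s ω) t)
            (fun s => w s ω)) ∂P
      ≤ 4 * (G * sizeBound κ κB γ W ^ 2) := by
  have hG := hc.gradBound_nonneg
  have hD := h.sizeBound_nonneg
  have h1 := h.integrable_policy_cost hc hw hlaw hM
  have h2 := h.integrable_linear_cost hc hw hlaw hK t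
  rw [← integral_sub h1 h2]
  calc _ ≤ ∫ _, 4 * (G * sizeBound κ κB γ W ^ 2) ∂P := by
        refine integral_mono_ae (h1.sub h2) (integrable_const _) ?_
        filter_upwards [h.ae_policy_trajectory_le hw hlaw hM,
          h.ae_linear_trajectory_le hw hlaw hK t] with ω hω hω'
        refine (hc.sub_le hα.le hω.1 hω.2 _ _).trans ?_
        calc _ ≤ G * sizeBound κ κB γ W * ((sizeBound κ κB γ W + sizeBound κ κB γ W)
              + (sizeBound κ κB γ W + sizeBound κ κB γ W)) := by
              gcongr
              · exact (norm_sub_le _ _).trans (add_le_add hω.1 hω'.1)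
              · exact (norm_sub_le _ _).trans (add_le_add hω.2 hω'.2)
          _ = _ := by ring
    _ = _ := by simp

end Rounds

end Random

/-! ### True against surrogate costs once the memory is filled. -/

section LateRounds

variable {Ω : Type*} [MeasurableSpace Ω] {P : Measure Ω} [IsProbabilityMeasure P]
  {w : ℕ → Ω → Vec dx} {A : Mat dx dx} {B : Mat dx du} {Kst K : Mat du dx} {κ κB γ : ℝ}
  {ν : Measure (Vec dx)} {σ W : ℝ} {M : ℕ → Policy H dx du} {α G : ℝ}

theorem Setting.integrable_surrogate_lagged (h : Setting A B Kst κ κB γ ν σ W)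
    {c : Vec dx → Vec du → ℝ} (hc : CostClass c α G) (hw : ∀ t, Measurable (w t))
    (hlaw : ∀ t, P.map (w t) = ν) (N : Policy H dx du) (t : ℕ) :
    Integrable (fun ω => c (surrogateState A B Kst N (lagged H (fun s => w s ω) t))
      (surrogateAction A B Kst N (lagged H (fun s => w s ω) t))) P := by
  refine integrable_comp_of_ae_bounded (g := fun ξ => pairCost c (surrogatePair A B Kst N ξ))
    (measurable_lagged hw t) (R := W) ?_
    (hc.continuous_pairCost.comp (continuous_surrogatePair A B Kst N))
  filter_upwards [h.noise.ae_forall_bounded hw hlaw] with ω hω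
  exact (pi_norm_le_iff_of_nonneg h.noise.bound_nonneg).2 fun i => hω _

/-- Once the memory is filled, the expected cost of the comparator is close to the surrogate cost
of the policy imitating it. -/
theorem Setting.surrogateCost_sub_linear_le (h : Setting A B Kst κ κB γ ν σ W)
    {c : Vec dx → Vec du → ℝ} (hc : CostClass c α G) (hα : 0 < α) (hw : ∀ t, Measurable (w t))
    (hlaw : ∀ t, P.map (w t) = ν) (hind : iIndepFun w P)
    (hK : DiagStronglyStable A B κ γ K) {t : ℕ} (ht : 2 * H + 1 ≤ t) :
    surrogateCost ν A B Kst c (comparator H A B Kst K)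
      - ∫ ω, c (state A B (linearController K) (fun s => w s ω) t)
          (linearController K t (state A B (linearController K) (fun s => w s ω) t)
            (fun s => w s ω)) ∂P
      ≤ 8 * κ ^ 6 * κB * γ⁻¹ * (1 - γ) ^ H * (G * sizeBound κ κB γ W ^ 2) := by
  have hκ := h.one_le_κ
  have hκB := h.one_le_κB
  have hg := h.one_le_inv_γ
  have hρ : 0 ≤ 1 - γ := by linarith [h.γ_lt_one]
  have hG := hc.gradBound_nonneg
  have hD := h.sizeBound_nonneg
  set D := sizeBound κ κB γ W with hDdef
  set N := comparator H A B Kst K with hN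
  have hmem : N ∈ policySet H dx du κ κB γ :=
    comparator_mem_policySet h.stable hK hκ h.γ_lt_one h.two_le
  have hxmeas := measurable_state_linearController (A := A) (B := B) (K := K) hw
  have hxint : ∀ s, Integrable (fun ω => app (Kst - K)
      (state A B (linearController K) (fun s => w s ω) s)) P := fun s => by
    refine integrable_comp_of_ae_bounded (hxmeas s) (R := D) ?_ (continuous_app (Kst - K))
    filter_upwards [h.ae_linear_trajectory_le hw hlaw hK s] with ω hω
    exact hω.1
  obtain ⟨b, hb, hbint, hbdev⟩ := h.exists_deviation_bound hw hlaw
    (x := fun s ω => state A B (linearController K) (fun s => w s ω) s)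
    (v := fun s ω => app (Kst - K) (state A B (linearController K) (fun s => w s ω) s))
    (fun ω => isClosedLoop_linearController K) ht (D := D)
    (by filter_upwards [h.ae_linear_trajectory_le hw hlaw hK (t - 1 - H)] with ω hω; exact hω.1)
    -- Here `s ≥ t - 1 - H ≥ H`, so the state `H` rounds before `s` is available.
    (fun s _ => hxint s) N (ε := 2 * κ ^ 3 * (1 - γ) ^ H * D) (by
      intro s hs hst
      calc _ ≤ ∫ _, 2 * κ ^ 3 * (1 - γ) ^ H * D ∂P := by
            refine integral_mono_ae (((hxint s).sub
              (h.noise.integrable_act_past hw hlaw N s continuous_id)).norm)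
              (integrable_const _) ?_
            filter_upwards [h.ae_linear_trajectory_le hw hlaw hK (s - H)] with ω hω
            exact norm_comparator_deviation_le h.stable hK hκ h.γ_lt_one (by omega) hω.1
        _ = _ := by simp)
  have h1 := h.integrable_surrogate_lagged hc hw hlaw N t
  have h2 := h.integrable_linear_cost hc hw hlaw hK t
  rw [surrogateCost_eq_integral_lagged hc hw hlaw hind ht N, ← integral_sub h1 h2]
  calc _ ≤ ∫ ω, G * D * b ω ∂P := by
        refine integral_mono_ae (h1.sub h2) (hb.const_mul _) ?_
        filter_upwards [h.noise.ae_forall_bounded hw hlaw, hbdev] with ω hω hdev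
        have hξ : ‖lagged H (fun s => w s ω) t‖ ≤ W :=
          (pi_norm_le_iff_of_nonneg h.noise.bound_nonneg).2 fun i => hω _
        obtain ⟨hy, hv⟩ := h.stable.surrogate_le_sizeBound hκ hκB h.norm_B_le h.γ_pos h.γ_lt_one
          h.noise.bound_nonneg hmem hξ
        refine (hc.sub_le hα.le hy hv _ _).trans ?_
        refine mul_le_mul_of_nonneg_left (le_trans (le_of_eq ?_) hdev) (mul_nonneg hG hD)
        rw [norm_sub_rev, norm_sub_rev (surrogateAction A B Kst N _)]
        congr 3
        rw [linearController, sub_app]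
        abel
    _ = G * D * ∫ ω, b ω ∂P := integral_const_mul _ _
    _ ≤ G * D * (3 * κ ^ 3 * κB * γ⁻¹ * (2 * κ ^ 3 * (1 - γ) ^ H * D)
        + 2 * κ ^ 3 * (1 - γ) ^ H * D) := by gcongr
    _ = (6 * (κ ^ 6 * κB * γ⁻¹) + 2 * κ ^ 3) * ((1 - γ) ^ H * (G * D ^ 2)) := by ring
    _ ≤ (6 * (κ ^ 6 * κB * γ⁻¹) + 2 * (κ ^ 6 * κB * γ⁻¹)) * ((1 - γ) ^ H * (G * D ^ 2)) := by
        gcongr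
        calc κ ^ 3 = κ ^ 3 * 1 * 1 := by ring
          _ ≤ κ ^ 6 * κB * γ⁻¹ := by
            gcongr
            norm_num
    _ = _ := by ring

/-- The policies of a run move slowly, so that the controls of the last rounds are close to those
of the current policy. -/
theorem Setting.integral_policy_deviation_le (h : Setting A B Kst κ κB γ ν σ W)
    {T : ℕ} {c : ℕ → Vec dx → Vec du → ℝ} {a : ℝ} (hc : ∀ t < T, CostClass (c t) α G)
    (hα : 0 < α) (ha : 1 ≤ a)
    (hrun : IsNaturalGradientRun ν A B Kst c κ κB γ T (fun t => a / (α * ((t : ℝ) + 1))) M)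
    (hw : ∀ t, Measurable (w t)) (hlaw : ∀ t, P.map (w t) = ν) (hind : iIndepFun w P) {s t : ℕ}
    (hs : t - 1 - H ≤ s) (hst : s ≤ t) (ht : 2 * H + 1 ≤ t) (htT : t < T) :
    ∫ ω, ‖(M s).act (past H (fun s => w s ω) s) - (M t).act (past H (fun s => w s ω) s)‖ ∂P
      ≤ 4 * κ * (H + 1) * (a / α) *
        (3 * κ ^ 3 * κB * γ⁻¹ * W * muInv H ν A B Kst c κ κB γ T) * ((t : ℝ) + 1)⁻¹ := by
  have hκ := h.one_le_κ
  have hκB := h.one_le_κB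
  have hg := h.one_le_inv_γ
  have hW := h.noise.bound_nonneg
  set Λ := 3 * κ ^ 3 * κB * γ⁻¹ * W * muInv H ν A B Kst c κ κB γ T with hΛ
  have hΛ0 : 0 ≤ Λ := by
    have := muInv_nonneg (H := H) (ν := ν) (A := A) (B := B) (Kst := Kst) (cs := c) (κ := κ)
      (κB := κB) (γ := γ) (T := T)
    positivity
  have htel : M t - M s = ∑ r ∈ Finset.Ico s t, (M (r + 1) - M r) :=
    (Finset.sum_Ico_sub M hst).symm
  have hact : ∀ (J : Finset ℕ) (f : ℕ → Policy H dx du) (ζ : Fin H → Vec dx),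
      (∑ r ∈ J, f r).act ζ = ∑ r ∈ J, (f r).act ζ := by
    intro J f ζ
    induction J using Finset.cons_induction with
    | empty => simp
    | cons r J hr ih => rw [Finset.sum_cons, Finset.sum_cons, Policy.add_act, ih]
  have hint : ∀ r, Integrable (fun ω => ‖(M (r + 1) - M r).act (past H (fun s => w s ω) s)‖) P :=
    fun r => h.noise.integrable_act_past hw hlaw _ s continuous_norm
  calc _ ≤ ∫ ω, ∑ r ∈ Finset.Ico s t,
        ‖(M (r + 1) - M r).act (past H (fun s => w s ω) s)‖ ∂P := by
        refine integral_mono_of_nonneg (Filter.Eventually.of_forall fun _ => norm_nonneg _)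
          (integrable_finsetSum _ fun r _ => hint r) (Filter.Eventually.of_forall fun ω => ?_)
        simp only
        rw [norm_sub_rev, ← Policy.sub_act, htel, hact]
        exact norm_sum_le _ _
    _ = ∑ r ∈ Finset.Ico s t, ∫ ω, ‖(M (r + 1) - M r).act (past H (fun s => w s ω) s)‖ ∂P :=
        integral_finsetSum _ fun r _ => hint r
    _ ≤ ∑ r ∈ Finset.Ico s t, 4 * κ * (a / α) * Λ * ((t : ℝ) + 1)⁻¹ := by
        refine Finset.sum_le_sum fun r hr => ?_
        obtain ⟨hr1, hr2⟩ := Finset.mem_Ico.1 hr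
        have h1 := h.noise.integral_norm_act_past_le hw hlaw hind (t := s) (by omega)
          (M (r + 1) - M r)
        have h2 := h.sqrt_energy_le (M (r + 1) - M r)
        have h3 := h.sqrt_step_le hc (fun t => by positivity) hrun (t := r) (by omega)
        -- `r ≥ t - 1 - H` and `t ≥ 2 H + 1` give `2 (r + 1) ≥ t + 1`: step sizes inside the window
        -- differ by a factor of at most `2`.
        have h4 : ((r : ℝ) + 1)⁻¹ ≤ 2 * ((t : ℝ) + 1)⁻¹ := by
          rw [← div_eq_mul_inv, inv_le_comm₀ (by positivity) (by positivity), inv_div]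
          have : t + 1 ≤ (r + 1) * 2 := by omega
          have : (t : ℝ) + 1 ≤ (r + 1) * 2 := by exact_mod_cast this
          linarith
        calc _ ≤ 2 * κ * (a / (α * ((r : ℝ) + 1)) * Λ) :=
              (h1.trans h2).trans (mul_le_mul_of_nonneg_left h3 (by positivity))
          _ = 2 * κ * (a / α) * Λ * ((r : ℝ) + 1)⁻¹ := by rw [div_mul_eq_div_div]; ring
          _ ≤ 2 * κ * (a / α) * Λ * (2 * ((t : ℝ) + 1)⁻¹) := by gcongr
          _ = _ := by ring
    _ = (t - s : ℕ) * (4 * κ * (a / α) * Λ * ((t : ℝ) + 1)⁻¹) := by simp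
    _ ≤ (H + 1) * (4 * κ * (a / α) * Λ * ((t : ℝ) + 1)⁻¹) := by
        gcongr
        have : t - s ≤ H + 1 := by omega
        exact_mod_cast this
    _ = _ := by ring

/-- Once the memory is filled, the expected cost of the learner is close to the surrogate cost of
its current policy. -/
theorem Setting.policy_sub_surrogateCost_le (h : Setting A B Kst κ κB γ ν σ W)
    {T : ℕ} {c : ℕ → Vec dx → Vec du → ℝ} {a : ℝ} (hc : ∀ t < T, CostClass (c t) α G)
    (hα : 0 < α) (ha : 1 ≤ a)
    (hrun : IsNaturalGradientRun ν A B Kst c κ κB γ T (fun t => a / (α * ((t : ℝ) + 1))) M)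
    (hw : ∀ t, Measurable (w t)) (hlaw : ∀ t, P.map (w t) = ν) (hind : iIndepFun w P) {t : ℕ}
    (ht : 2 * H + 1 ≤ t) (htT : t < T) :
    ∫ ω, c t (state A B (policyController Kst M) (fun s => w s ω) t)
        (policyController Kst M t (state A B (policyController Kst M) (fun s => w s ω) t)
          (fun s => w s ω)) ∂P
      - surrogateCost ν A B Kst (c t) (M t)
      ≤ G * sizeBound κ κB γ W * (36 * κ ^ 7 * κB ^ 2 * γ⁻¹ ^ 2 * (H + 1) * (a / α) *
          (W * muInv H ν A B Kst c κ κB γ T)) * ((t : ℝ) + 1)⁻¹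
        + 2 * κ ^ 3 * (1 - γ) ^ H * (G * sizeBound κ κB γ W ^ 2) := by
  have hκ := h.one_le_κ
  have hκB := h.one_le_κB
  have hg := h.one_le_inv_γ
  have hρ : 0 ≤ 1 - γ := by linarith [h.γ_lt_one]
  have hG := (hc t htT).gradBound_nonneg
  have hD := h.sizeBound_nonneg
  set D := sizeBound κ κB γ W with hDdef
  have hM : ∀ s ≤ t, M s ∈ policySet H dx du κ κB γ := fun s hs => hrun.mem (by omega)
  obtain ⟨b, hb, hbint, hbdev⟩ := h.exists_deviation_bound hw hlaw
    (x := fun s ω => state A B (policyController Kst M) (fun s => w s ω) s)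
    (v := fun s ω => (M s).act (past H (fun s => w s ω) s))
    (fun ω => isClosedLoop_policyController M) ht (D := D)
    (by
      filter_upwards [h.ae_policy_trajectory_le hw hlaw (t := t - 1 - H)
        fun s hs => hM s (by omega)] with ω hω
      exact hω.1)
    (fun s _ => h.noise.integrable_act_past hw hlaw (M s) s continuous_id) (M t)
    fun s hs hst => h.integral_policy_deviation_le hc hα ha hrun hw hlaw hind hs hst ht htT
  have h1 := h.integrable_policy_cost (hc t htT) hw hlaw hM
  have h2 := h.integrable_surrogate_lagged (hc t htT) hw hlaw (M t) t
  rw [surrogateCost_eq_integral_lagged (hc t htT) hw hlaw hind ht (M t), ← integral_sub h1 h2]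
  calc _ ≤ ∫ ω, G * D * b ω ∂P := by
        refine integral_mono_ae (h1.sub h2) (hb.const_mul _) ?_
        filter_upwards [h.ae_policy_trajectory_le hw hlaw hM, hbdev] with ω hω hdev
        refine ((hc t htT).sub_le hα.le hω.1 hω.2 _ _).trans ?_
        refine mul_le_mul_of_nonneg_left (le_trans (le_of_eq ?_) hdev) (mul_nonneg hG hD)
        rw [policyController_apply]
    _ = G * D * ∫ ω, b ω ∂P := integral_const_mul _ _
    _ ≤ G * D * (3 * κ ^ 3 * κB * γ⁻¹ * (4 * κ * (H + 1) * (a / α) *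
        (3 * κ ^ 3 * κB * γ⁻¹ * W * muInv H ν A B Kst c κ κB γ T) * ((t : ℝ) + 1)⁻¹)
        + 2 * κ ^ 3 * (1 - γ) ^ H * D) := by gcongr
    _ = _ := by ring

end LateRounds

/-! ### The memory length -/

section Memory

variable {κ γ : ℝ} {T : ℕ}

theorem half_le_log (hT : 2 ≤ T) : 1 / 2 ≤ Real.log T := by
  have h1 : Real.log 2 ≤ Real.log T := Real.log_le_log (by norm_num) (by exact_mod_cast hT)
  linarith [Real.log_two_gt_d9]

theorem memory_pos (hκ : 1 ≤ κ) (hγ : 0 < γ) (hT : 2 ≤ T) : 0 < memory κ γ T := by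
  have hT' : (2 : ℝ) ≤ T := by exact_mod_cast hT
  have hκ2 : 1 ≤ κ ^ 2 := one_le_pow₀ hκ
  exact Nat.ceil_pos.2 (mul_pos (inv_pos.2 hγ) (Real.log_pos (by nlinarith)))

theorem memory_le (hκ : 1 ≤ κ) (hγ : 0 < γ) (hγ1 : γ < 1) (hT : 2 ≤ T) :
    (memory κ γ T : ℝ) ≤ 7 * γ⁻¹ * κ * Real.log T := by
  have hL := half_le_log hT
  have hg : 1 ≤ γ⁻¹ := (one_le_inv₀ hγ).2 hγ1.le
  have hT0 : (T : ℝ) ≠ 0 := by positivity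
  have hlog : Real.log (T * κ ^ 2) = Real.log T + 2 * Real.log κ := by
    rw [Real.log_mul hT0 (by positivity), Real.log_pow]
    norm_num
  have hlogκ : Real.log κ ≤ κ := (Real.log_le_self (by linarith))
  have hnn : 0 ≤ γ⁻¹ * Real.log (T * κ ^ 2) := by
    rw [hlog]
    have := Real.log_nonneg hκ
    positivity
  have h1 : (memory κ γ T : ℝ) ≤ γ⁻¹ * Real.log (T * κ ^ 2) + 1 := (Nat.ceil_lt_add_one hnn).le
  -- With `L = log T ≥ 1 / 2`: `L ≤ κ L`, `2 log κ ≤ 2 κ ≤ 4 κ L` and `1 ≤ 2 κ L`, in total `7 κ L`.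
  have h2 : Real.log (T * κ ^ 2) + 1 ≤ 7 * κ * Real.log T := by
    rw [hlog]
    nlinarith
  calc (memory κ γ T : ℝ) ≤ γ⁻¹ * Real.log (T * κ ^ 2) + γ⁻¹ * 1 := by linarith
    _ = γ⁻¹ * (Real.log (T * κ ^ 2) + 1) := by ring
    _ ≤ γ⁻¹ * (7 * κ * Real.log T) := by gcongr
    _ = _ := by ring

/-- `1 - γ ≤ exp (-γ)` and `γ H ≥ log T`; the factor `κ²` inside the logarithm only lengthens the
memory. -/
theorem pow_memory_le (hκ : 1 ≤ κ) (hγ : 0 < γ) (hγ1 : γ < 1) (hT : 2 ≤ T) :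
    (1 - γ) ^ memory κ γ T ≤ (T : ℝ)⁻¹ := by
  have hT0 : (0 : ℝ) < T := by positivity
  have hκ2 : 1 ≤ κ ^ 2 := one_le_pow₀ hκ
  calc (1 - γ) ^ memory κ γ T ≤ Real.exp (-γ) ^ memory κ γ T := by
        gcongr
        linarith [Real.add_one_le_exp (-γ)]
    _ = Real.exp (-(γ * memory κ γ T)) := by rw [← Real.exp_nat_mul]; congr 1; ring
    _ ≤ Real.exp (-Real.log T) := by
        refine Real.exp_le_exp.2 (neg_le_neg ?_)
        have h1 : γ⁻¹ * Real.log (T * κ ^ 2) ≤ memory κ γ T := Nat.le_ceil _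
        have h2 : Real.log T ≤ Real.log (T * κ ^ 2) :=
          Real.log_le_log hT0 (le_mul_of_one_le_right hT0.le hκ2)
        have h3 : γ * (γ⁻¹ * Real.log (T * κ ^ 2)) ≤ γ * memory κ γ T := by gcongr
        rw [mul_inv_cancel_left₀ hγ.ne'] at h3
        linarith
    _ = (T : ℝ)⁻¹ := by rw [Real.exp_neg, Real.exp_log hT0]

end Memory

/-! ### The regret bound -/

section Bound

variable {Ω : Type*} [MeasurableSpace Ω] {P : Measure Ω} [IsProbabilityMeasure P]
  {w : ℕ → Ω → Vec dx} {A : Mat dx dx} {B : Mat dx du} {Kst K : Mat du dx} {κ κB γ : ℝ}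
  {ν : Measure (Vec dx)} {σ W : ℝ} {M : ℕ → Policy H dx du} {α G : ℝ} {T : ℕ}
  {c : ℕ → Vec dx → Vec du → ℝ} {a : ℝ}

/-- The regret for an arbitrary memory length that makes the truncation error at most `1 / T`. -/
theorem Setting.totalCost_sub_le (h : Setting A B Kst κ κB γ ν σ W)
    (hc : ∀ t < T, CostClass (c t) α G) (hα : 0 < α) (ha : 1 ≤ a) (hT : 0 < T)
    (hH : (1 - γ) ^ H ≤ (T : ℝ)⁻¹)
    (hrun : IsNaturalGradientRun ν A B Kst c κ κB γ T (fun t => a / (α * ((t : ℝ) + 1))) M)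
    (hw : ∀ t, Measurable (w t)) (hlaw : ∀ t, P.map (w t) = ν) (hind : iIndepFun w P)
    (hK : DiagStronglyStable A B κ γ K) :
    totalCost P w A B c T (policyController Kst M) - totalCost P w A B c T (linearController K)
      ≤ a / α * (G * sizeBound κ κB γ W) *
          (3 * κ ^ 3 * κB * γ⁻¹ * W * muInv H ν A B Kst c κ κB γ T) * (1 + Real.log T)
        + (2 * H + 1) * (8 * (G * sizeBound κ κB γ W ^ 2))
        + G * sizeBound κ κB γ W * (36 * κ ^ 7 * κB ^ 2 * γ⁻¹ ^ 2 * (H + 1) * (a / α) *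
          (W * muInv H ν A B Kst c κ κB γ T)) * (1 + Real.log T)
        + 10 * κ ^ 6 * κB * γ⁻¹ * (G * sizeBound κ κB γ W ^ 2) := by
  have hκ := h.one_le_κ
  have hκB := h.one_le_κB
  have hg := h.one_le_inv_γ
  have hW := h.noise.bound_nonneg
  have hG := (hc 0 hT).gradBound_nonneg
  have hD := h.sizeBound_nonneg
  have hρ : 0 ≤ 1 - γ := by linarith [h.γ_lt_one]
  have hmu := muInv_nonneg (H := H) (ν := ν) (A := A) (B := B) (Kst := Kst) (cs := c) (κ := κ)
    (κB := κB) (γ := γ) (T := T)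
  have hTpos : (0 : ℝ) < T := by exact_mod_cast hT
  set N := comparator H A B Kst K with hN
  have hNmem : N ∈ policySet H dx du κ κB γ :=
    comparator_mem_policySet h.stable hK hκ h.γ_lt_one h.two_le
  have hM : ∀ t < T, ∀ s ≤ t, M s ∈ policySet H dx du κ κB γ :=
    fun t ht s hs => hrun.mem (by omega)
  set D2 := G * sizeBound κ κB γ W ^ 2 with hD2
  have hD20 : 0 ≤ D2 := by positivity
  set X := G * sizeBound κ κB γ W * (36 * κ ^ 7 * κB ^ 2 * γ⁻¹ ^ 2 * (H + 1) * (a / α) *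
          (W * muInv H ν A B Kst c κ κB γ T)) with hX
  have hX0 : 0 ≤ X := by positivity
  have hreg := h.regret_le hc hT hα ha hrun hNmem
  unfold totalCost
  rw [integral_finsetSum _ fun t ht => h.integrable_policy_cost (hc t (Finset.mem_range.1 ht)) hw
      hlaw (hM t (Finset.mem_range.1 ht)),
    integral_finsetSum _ fun t ht => h.integrable_linear_cost (hc t (Finset.mem_range.1 ht)) hw
      hlaw hK t, ← Finset.sum_sub_distrib]
  have hround : ∀ t ∈ Finset.range T,
      (∫ ω, c t (state A B (policyController Kst M) (fun s => w s ω) t)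
        (policyController Kst M t (state A B (policyController Kst M) (fun s => w s ω) t)
          (fun s => w s ω)) ∂P
      - ∫ ω, c t (state A B (linearController K) (fun s => w s ω) t)
          (linearController K t (state A B (linearController K) (fun s => w s ω) t)
            (fun s => w s ω)) ∂P)
      ≤ (surrogateCost ν A B Kst (c t) (M t) - surrogateCost ν A B Kst (c t) N)
        + (if t < 2 * H + 1 then 8 * D2 else 0) + X * ((t : ℝ) + 1)⁻¹
        + 10 * κ ^ 6 * κB * γ⁻¹ * D2 * (T : ℝ)⁻¹ := by
    intro t ht
    have htT := Finset.mem_range.1 ht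
    have hXt : 0 ≤ X * ((t : ℝ) + 1)⁻¹ := by positivity
    have hZt : 0 ≤ 10 * κ ^ 6 * κB * γ⁻¹ * D2 * (T : ℝ)⁻¹ := by positivity
    split_ifs with hearly
    -- An early round costs `4 D2` in true cost and another `4 D2` to compensate its surrogate
    -- regret, which stays in the sum.
    · have h1 := h.policy_sub_linear_le (hc t htT) hα hw hlaw (hM t htT) hK
      have h2 := h.surrogateCost_sub_le (hc t htT) hα hNmem (hM t htT t le_rfl)
      linarith
    · have h1 := h.policy_sub_surrogateCost_le hc hα ha hrun hw hlaw hind (not_lt.1 hearly) htT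
      have h2 := h.surrogateCost_sub_linear_le (c := c t) (hc t htT) hα hw hlaw hind hK
        (not_lt.1 hearly)
      have h3 : κ ^ 3 ≤ κ ^ 6 * κB * γ⁻¹ := by
        calc κ ^ 3 = κ ^ 3 * 1 * 1 := by ring
          _ ≤ κ ^ 6 * κB * γ⁻¹ := by
            gcongr
            norm_num
      have h4 : 2 * κ ^ 3 * (1 - γ) ^ H * D2 + 8 * κ ^ 6 * κB * γ⁻¹ * (1 - γ) ^ H * D2
          ≤ 10 * κ ^ 6 * κB * γ⁻¹ * D2 * (T : ℝ)⁻¹ := by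
        calc _ = (2 * κ ^ 3 + 8 * (κ ^ 6 * κB * γ⁻¹)) * D2 * (1 - γ) ^ H := by ring
          _ ≤ (2 * (κ ^ 6 * κB * γ⁻¹) + 8 * (κ ^ 6 * κB * γ⁻¹)) * D2 * (T : ℝ)⁻¹ := by gcongr
          _ = _ := by ring
      linarith
  refine (Finset.sum_le_sum hround).trans ?_
  rw [Finset.sum_add_distrib, Finset.sum_add_distrib, Finset.sum_add_distrib, ← Finset.mul_sum,
    Finset.sum_const, Finset.card_range, nsmul_eq_mul]
  have hearly : ∑ t ∈ Finset.range T, (if t < 2 * H + 1 then 8 * D2 else 0)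
      ≤ (2 * H + 1) * (8 * D2) := by
    rw [← Finset.sum_filter, Finset.sum_const, nsmul_eq_mul]
    gcongr
    have h1 : (Finset.range T).filter (· < 2 * H + 1) ⊆ Finset.range (2 * H + 1) := fun t ht =>
      Finset.mem_range.2 (Finset.mem_filter.1 ht).2
    have h2 := Finset.card_le_card h1
    rw [Finset.card_range] at h2
    exact_mod_cast h2
  have hharm : X * ∑ t ∈ Finset.range T, ((t : ℝ) + 1)⁻¹ ≤ X * (1 + Real.log T) := by
    gcongr
    exact sum_range_inv_succ_le T
  have hlast : (T : ℝ) * (10 * κ ^ 6 * κB * γ⁻¹ * D2 * (T : ℝ)⁻¹) = 10 * κ ^ 6 * κB * γ⁻¹ * D2 := by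
    field_simp
  linarith

end Bound

/-- The constants of the four error terms, collected into one monomial. -/
theorem collect_error_terms {g κB κ d L Y a h μ D2 r : ℝ} (hg : 1 ≤ g) (hκB : 1 ≤ κB)
    (hκ : 1 ≤ κ) (hd : 1 ≤ d) (hL : 1 / 2 ≤ L) (hY : 0 ≤ Y) (ha : 1 ≤ a) (hh0 : 0 ≤ h)
    (hh : h ≤ 7 * g * κ * L) (hD2 : D2 ≤ 192 * κ ^ 16 * κB ^ 5 * g ^ 5 * d * Y)
    (hμ : μ = 12 * κ ^ 9 * κB ^ 3 * g ^ 3 * (a * Y))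
    (hr : r = 144 * κ ^ 13 * κB ^ 4 * g ^ 4 * (h + 1) * (a * Y)) :
    μ * (1 + L) + (2 * h + 1) * (8 * D2) + r * (1 + L) + 10 * κ ^ 6 * κB * g * D2
      ≤ a * (2000000 * g ^ 6 * κB ^ 6 * κ ^ 22 * d) * Y * L ^ 7 := by
  set Z := g ^ 6 * κB ^ 6 * κ ^ 22 * d with hZ
  have hmono : ∀ i j k : ℕ, i ≤ 22 → j ≤ 6 → k ≤ 6 → κ ^ i * κB ^ j * g ^ k * d ≤ Z := by
    intro i j k hi hj hk
    calc κ ^ i * κB ^ j * g ^ k * d ≤ κ ^ 22 * κB ^ 6 * g ^ 6 * d := by gcongr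
      _ = Z := by rw [hZ]; ring
  have hmono1 : ∀ i j k : ℕ, i ≤ 22 → j ≤ 6 → k ≤ 6 → κ ^ i * κB ^ j * g ^ k ≤ Z := by
    intro i j k hi hj hk
    exact (le_mul_of_one_le_right (by positivity) hd).trans (hmono i j k hi hj hk)
  have hL0 : 0 ≤ L := by linarith
  have hgκ : 1 ≤ g * κ := one_le_mul_of_one_le_of_one_le hg hκ
  have hgκL : L ≤ g * κ * L := le_mul_of_one_le_left hL0 hgκ
  have hh1 : h + 1 ≤ 9 * (g * κ * L) := by linarith
  have hh2 : 2 * h + 1 ≤ 16 * (g * κ * L) := by linarith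
  have hL1 : 1 + L ≤ 3 * L := by linarith
  have haY : 0 ≤ a * Y := by positivity
  have hYaY : Y ≤ a * Y := le_mul_of_one_le_left hY ha
  have hZ0 : 0 ≤ Z := by positivity
  have t1 : μ * (1 + L) ≤ 36 * (Z * (a * Y)) * L := by
    calc μ * (1 + L) = 12 * ((κ ^ 9 * κB ^ 3 * g ^ 3) * (a * Y)) * (1 + L) := by rw [hμ]; ring
      _ ≤ 12 * (Z * (a * Y)) * (3 * L) := by
          gcongr
          exact hmono1 9 3 3 (by norm_num) (by norm_num) (by norm_num)
      _ = _ := by ring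
  have t2 : r * (1 + L) ≤ 3888 * (Z * (a * Y)) * L ^ 2 := by
    calc r * (1 + L) ≤ 144 * κ ^ 13 * κB ^ 4 * g ^ 4 * (9 * (g * κ * L)) * (a * Y) * (3 * L) := by
          rw [hr]
          gcongr
      _ = 3888 * ((κ ^ 14 * κB ^ 4 * g ^ 5) * (a * Y)) * L ^ 2 := by ring
      _ ≤ _ := by
          gcongr
          exact hmono1 14 4 5 (by norm_num) (by norm_num) (by norm_num)
  have t3 : 10 * κ ^ 6 * κB * g * D2 ≤ 1920 * (Z * (a * Y)) := by
    calc 10 * κ ^ 6 * κB * g * D2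
        ≤ 10 * κ ^ 6 * κB * g * (192 * κ ^ 16 * κB ^ 5 * g ^ 5 * d * Y) := by gcongr
      _ = 1920 * ((κ ^ 22 * κB ^ 6 * g ^ 6 * d) * Y) := by ring
      _ ≤ _ := by
          gcongr
          exact hmono 22 6 6 (by norm_num) (by norm_num) (by norm_num)
  have t4 : (2 * h + 1) * (8 * D2) ≤ 24576 * (Z * (a * Y)) * L := by
    calc (2 * h + 1) * (8 * D2)
        ≤ (2 * h + 1) * (8 * (192 * κ ^ 16 * κB ^ 5 * g ^ 5 * d * Y)) := by gcongr
      _ ≤ (16 * (g * κ * L)) * (8 * (192 * κ ^ 16 * κB ^ 5 * g ^ 5 * d * Y)) := by gcongr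
      _ = 24576 * ((κ ^ 17 * κB ^ 5 * g ^ 6 * d) * Y) * L := by ring
      _ ≤ _ := by
          gcongr
          exact hmono 17 5 6 (by norm_num) (by norm_num) (by norm_num)
  -- As `2 L ≥ 1`, lower powers of `2 L` are at most the seventh. The terms above are of order at
  -- most `L²`, so the exponent `7` leaves room.
  have hpow : ∀ n ≤ 7, (2 * L) ^ n ≤ (2 * L) ^ 7 := fun n hn =>
    pow_le_pow_right₀ (by linarith) hn
  have p0 := hpow 0 (by norm_num)
  have p1 := hpow 1 (by norm_num)
  have p2 := hpow 2 (by norm_num)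
  rw [mul_pow, mul_pow] at p0 p1 p2
  norm_num at p0 p1 p2
  have hU : 0 ≤ Z * (a * Y) := by positivity
  have q0 : Z * (a * Y) ≤ Z * (a * Y) * (128 * L ^ 7) := le_mul_of_one_le_right hU p0
  have q1 : Z * (a * Y) * L ≤ Z * (a * Y) * (64 * L ^ 7) := by gcongr; linarith
  have q2 : Z * (a * Y) * L ^ 2 ≤ Z * (a * Y) * (32 * L ^ 7) := by gcongr; linarith
  have q3 : 0 ≤ Z * (a * Y) * L ^ 7 := by positivity
  -- The constant covers `36 · 64 + 3888 · 32 + 1920 · 128 + 24576 · 64 = 1945344`.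
  calc _ ≤ 2000000 * (Z * (a * Y) * L ^ 7) := by linarith
    _ = _ := by rw [hZ]; ring

/-- Without states or without controls, all controllers coincide. -/
theorem policyController_eq_linearController (hd : dx = 0 ∨ du = 0)
    (Kst K : Mat du dx) (M : ℕ → Policy H dx du) :
    policyController Kst M = linearController K := by
  funext t x w
  rcases hd with rfl | rfl
  · have h0 : ∀ y : Vec 0, y = 0 := fun y => Subsingleton.elim _ _
    simp [policyController, linearController, h0 x, h0 (w _)]
  · exact Subsingleton.elim _ _

end OnlineControl

/-! ### The main theorem. -/

open OnlineControl
theorem theorem2 :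
    -- the factor hidden in the O-notation: a polynomial in `γ⁻¹, κ_B, κ, d`
    ∃ p : MvPolynomial (Fin 4) ℝ,
      ∀ (dx du : ℕ) (A : Mat dx dx) (B : Mat dx du) (Kst : Mat du dx)
        (κ κB γ σ W α G : ℝ),
      1 ≤ κ → 0 < γ → γ < 1 → 0 < σ → 0 < α →
      ‖B‖ ≤ κB → 2 ≤ κB * (1 - γ) →
      DiagStronglyStable A B κ γ Kst →
      ∀ (ν : MeasureTheory.Measure (Vec dx)), NoiseLaw ν σ W →
      ∀ (Ω : Type*) [MeasurableSpace Ω] (P : MeasureTheory.Measure Ω)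
        [MeasureTheory.IsProbabilityMeasure P] (w : ℕ → Ω → Vec dx),
      (∀ t, Measurable (w t)) → (∀ t, P.map (w t) = ν) → ProbabilityTheory.iIndepFun w P →
      ∀ (T : ℕ), 2 ≤ T →
      ∀ (c : ℕ → Vec dx → Vec du → ℝ), (∀ t < T, CostClass (c t) α G) →
      -- step sizes of order `1 / (α t)`, the rounds being counted from `0`
      ∀ (a : ℝ), 1 ≤ a →
      ∀ (M : ℕ → Policy (memory κ γ T) dx du),
      IsNaturalGradientRun ν A B Kst c κ κB γ T (fun t => a / (α * ((t : ℝ) + 1))) M →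
      ∀ (K : Mat du dx), DiagStronglyStable A B κ γ K →
        totalCost P w A B c T (policyController Kst M)
            - totalCost P w A B c T (linearController K)
          ≤ a * MvPolynomial.eval ![γ⁻¹, κB, κ, ((max dx du : ℕ) : ℝ)] p
            * (G * W ^ 2 / α * muInv (memory κ γ T) ν A B Kst c κ κB γ T)
            * Real.log T ^ 7 := by
  -- The monomial of `collect_error_terms`; its exponents are those of the truncation term, `κ⁶ κ_B
  -- γ⁻¹` times `κ¹⁶ κ_B⁵ γ⁻⁵ d`.
  refine ⟨MvPolynomial.C 2000000 * MvPolynomial.X 0 ^ 6 * MvPolynomial.X 1 ^ 6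
    * MvPolynomial.X 2 ^ 22 * MvPolynomial.X 3, ?_⟩
  intro dx du A B Kst κ κB γ σ W α G hκ hγ hγ1 hσ hα hB h2 hst ν hν Ω _ P _ w hw hlaw hind T hT c
    hc a ha M hrun K hK
  have heval : MvPolynomial.eval ![γ⁻¹, κB, κ, ((max dx du : ℕ) : ℝ)]
      (MvPolynomial.C 2000000 * MvPolynomial.X 0 ^ 6 * MvPolynomial.X 1 ^ 6
        * MvPolynomial.X 2 ^ 22 * MvPolynomial.X 3)
      = 2000000 * γ⁻¹ ^ 6 * κB ^ 6 * κ ^ 22 * ((max dx du : ℕ) : ℝ) := by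
    simp
  rw [heval]
  have h : Setting A B Kst κ κB γ ν σ W := ⟨hκ, hγ, hγ1, hσ, hB, h2, hst, hν⟩
  have hκB := h.one_le_κB
  have hg := h.one_le_inv_γ
  have hT0 : 0 < T := by omega
  have hG := (hc 0 hT0).gradBound_nonneg
  have hL := half_le_log hT
  have hmu := muInv_nonneg (H := memory κ γ T) (ν := ν) (A := A) (B := B) (Kst := Kst) (cs := c)
    (κ := κ) (κB := κB) (γ := γ) (T := T)
  have hY : 0 ≤ G * W ^ 2 / α * muInv (memory κ γ T) ν A B Kst c κ κB γ T := by positivity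
  -- The lower bound on `muInv` needs a nonzero policy direction; without one the two controllers
  -- agree and the regret is zero.
  by_cases hd : dx = 0 ∨ du = 0
  · rw [policyController_eq_linearController hd Kst K M, sub_self]
    have : 0 ≤ Real.log T := by linarith
    positivity
  obtain ⟨hdx, hdu⟩ := not_or.1 hd
  have hdx1 : (1 : ℝ) ≤ dx := by exact_mod_cast Nat.one_le_iff_ne_zero.2 hdx
  have hdmax : (dx : ℝ) ≤ ((max dx du : ℕ) : ℝ) := by exact_mod_cast le_max_left dx du
  refine (h.totalCost_sub_le hc hα ha hT0 (pow_memory_le hκ hγ hγ1 hT) hrun hw hlaw hind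
    hK).trans ?_
  have hlow := h.le_muInv hc hT0 (memory_pos hκ hγ hT) (Nat.pos_of_ne_zero hdx)
    (Nat.pos_of_ne_zero hdu)
  refine collect_error_terms hg hκB hκ (hdx1.trans hdmax) hL hY ha (Nat.cast_nonneg _)
    (memory_le hκ hγ hγ1 hT) ?_ ?_ ?_
  -- `G D²` carries no `1 / (α μ)`; `Setting.le_muInv` makes this quotient at least `1` up to a
  -- polynomial factor, which is where the dimension enters.
  · have h1 : 1 ≤ 12 * κ ^ 4 * κB * γ⁻¹ * dx * muInv (memory κ γ T) ν A B Kst c κ κB γ T / α := by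
      rwa [one_le_div hα]
    have h3 : 0 ≤ G * sizeBound κ κB γ W ^ 2 := by positivity
    calc G * sizeBound κ κB γ W ^ 2
        ≤ G * sizeBound κ κB γ W ^ 2 *
          (12 * κ ^ 4 * κB * γ⁻¹ * dx * muInv (memory κ γ T) ν A B Kst c κ κB γ T / α) :=
          le_mul_of_one_le_right h3 h1
      _ = 192 * κ ^ 16 * κB ^ 5 * γ⁻¹ ^ 5 * dx
          * (G * W ^ 2 / α * muInv (memory κ γ T) ν A B Kst c κ κB γ T) := by
          unfold sizeBound
          ring
      _ ≤ _ := by gcongr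
  · unfold sizeBound
    ring
  · unfold sizeBound
    ring
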